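/- Let $d\ge 1$, $\omega=e^{2\pi i/d}$, and let $X|x\rangle=|x+1\rangle$, $Z|x\rangle=\omega^x|x\rangle$ on $\mathbb{C}^d$ with basis labelled by $\mathbb{Z}_d$. The Weyl operators of $n$ qudits are $W_{p,q}=\bigotimes_i Z^{p_i}X^{q_i}$ for $(p,q)\in(\mathbb{Z}_d\times\mathbb{Z}_d)^n$. For $N\in\{1,2,\dots\}\cup\{\infty\}$, the stabilizer subtheory of registers of at most $N$ qudits (single-particle for $N=1$, multi-particle for $N\ge 2$) consists of the processes generated, by sequential composition, parallel composition and convex mixture within registers of at most $N$ qudits (the empty register is the trivial system), from: preparations of pure states that are uniquely identified as a simultaneous eigenstate of a set of Weyl operators with given eigenvalues; the outcomes $\rho\mapsto P\rho P$ of projective measurements in the spectral decomposition of Weyl operators; Clifford unitaries (those which map Weyl operators to Weyl operators up to a phase under conjugation), including wire permutations; and discarding of a register. A diagram-preserving quasiprobability representation on a finite sample space $\Lambda$ assigns to every process $T$ from $n$ to $m$ qudits of the subtheory a real matrix $\xi_T(\lambda'|\lambda)$, $\lambda\in\Lambda^n$, $\lambda'\in\Lambda^m$, such that sequential and parallel composition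 and identity and crossing wires are preserved, convex mixtures and coarse-grainings are preserved, discarding is represented by the constant function $1$, and the quantum probabilities are recovered. It is nonnegative if $0\le\xi_T(\lambda'|\lambda)\le 1$ always. An ontological model assigns likewise a substochastic matrix to every procedure (formal circuit of the above generators), with the outcomes of every complete measurement having total probability $1$ at each ontic state; it is noncontextual if operationally equivalent procedures have equal matrices. The subtheory is contextual if it has no noncontextual ontological model. (a) Let $d$ be odd. Then Gross's representation $$\xi_T(a'|a)=\mathrm{tr}\big(d^{-m}A_{a'}\,T(A_a)\big),\qquad A_a=\frac1{d^n}\sum_{b}\omega^{-[a,b]}\big(\omega^{-2^{-1}p_b\cdot q_b}W_b\big)^\dagger ,$$ where $a,b\in(\mathbb{Z}_d\times\mathbb{Z}_d)^n$, $b=(p_b,q_b)$ and $[(p,q),(p',q')]=p\cdot q'-q\cdot p'$, is a nonnegative and diagram-preserving quasiprobability representation of the subtheory, and it is the only one, up to relabelling the sample space of one qudit by a bijection $\Lambda\cong\mathbb{Z}_d\times\mathbb{Z}_d$. Equivalently, up to the same relabelling, the subtheory has exactly one noncontextual ontological model, namely Spekkens' epistemically restricted toy theory: with the Weyl operator $\omega^{-2^{-1}p_a\cdot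 q_a}W_a$ corresponding to the quadrature $\lambda\mapsto[a,\lambda]$ on phase space, a pure stabilizer state is represented by the uniform distribution on the phase space points compatible with its sharp quadratures, a Clifford unitary by its affine symplectic map, and a measurement outcome of a quadrature by the indicator of its value followed by uniform randomization along the translations generated by that quadrature. (b) Let $d$ be even. Then there is no nonnegative and diagram-preserving quasiprobability representation of the subtheory, and no noncontextual ontological model of it: the subtheory is contextual. -/

import Mathlib

open scoped Matrix

universe u

noncomputable section

namespace Stab

/-! ## Registers of qudits -/

/-- Labels of the computational basis of `n` qudits of dimension `d`. -/
abbrev Config (d n : ℕ) : Type := Fin n → ZMod d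

/-- Points `((p₁, q₁), …, (pₙ, qₙ))` of the phase space of `n` qudits. -/
abbrev Phase (d n : ℕ) : Type := Fin n → ZMod d × ZMod d

/-- Operators on the Hilbert space of `n` qudits. -/
abbrev Op (d n : ℕ) : Type := Matrix (Config d n) (Config d n) ℂ

/-- Superoperators from `n` qudits to `m` qudits. The trivial system is `n = 0`, whose operators
are the `1 × 1` matrices: states are superoperators from `0`, effects are superoperators to `0`. -/
abbrev SuperOp (d n m : ℕ) : Type := Op d n →ₗ[ℂ] Op d m

/-- Parallel composition (Kronecker product) of matrices indexed by strings of letters. -/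
def parMatrix {α R : Type*} [Mul R] {n m n' m' : ℕ}
    (A : Matrix (Fin m → α) (Fin n → α) R) (B : Matrix (Fin m' → α) (Fin n' → α) R) :
    Matrix (Fin (m + m') → α) (Fin (n + n') → α) R :=
  Matrix.of fun u v =>
    A (u ∘ Fin.castAdd m') (v ∘ Fin.castAdd n') * B (u ∘ Fin.natAdd m) (v ∘ Fin.natAdd n)

open Classical in
/-- The matrix which permutes the letters of strings of length `n` (the identity for `σ = 1`). -/
def wireMatrix (α R : Type*) [Zero R] [One R] {n : ℕ} (σ : Equiv.Perm (Fin n)) :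
    Matrix (Fin n → α) (Fin n → α) R :=
  Matrix.of fun u v => if u = v ∘ σ then 1 else 0

section Quantum

variable {d : ℕ} [NeZero d] {n m n' m' : ℕ}

/-- The superoperator `M ↦ A M A†`. -/
def conjBy (A : Op d n) : SuperOp d n n where
  toFun M := A * M * Aᴴ
  map_add' M M' := by rw [mul_add, add_mul]
  map_smul' c M := by simp

/-- Preparation of the pure state `|ψ⟩⟨ψ|`. -/
def prepare (ψ : Config d n → ℂ) : SuperOp d 0 n where
  toFun M := M ![] ![] • Matrix.vecMulVec ψ (star ψ)
  map_add' M M' := by rw [Matrix.add_apply, add_smul]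
  map_smul' c M := by simp [mul_smul]

/-- Discarding a register, i.e. the trace. -/
def discardOp (d n : ℕ) [NeZero d] : SuperOp d n 0 where
  toFun M := M.trace • (1 : Op d 0)
  map_add' M M' := by rw [Matrix.trace_add, add_smul]
  map_smul' c M := by simp [Matrix.trace_smul, mul_smul]

/-- The tensor product of superoperators, determined by
`A ⊗ B ↦ T A ⊗ T' B` on the matrix units. -/
def superTensor (T : SuperOp d n m) (T' : SuperOp d n' m') : SuperOp d (n + n') (m + m') where
  toFun M := ∑ x : Config d n, ∑ y : Config d n, ∑ x' : Config d n', ∑ y' : Config d n',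
    M (Fin.append x x') (Fin.append y y') •
      parMatrix (T (Matrix.single x y 1)) (T' (Matrix.single x' y' 1))
  map_add' M M' := by simp only [Matrix.add_apply, add_smul, Finset.sum_add_distrib]
  map_smul' c M := by
    simp only [Matrix.smul_apply, smul_eq_mul, mul_smul, Finset.smul_sum, RingHom.id_apply]

/-! ## Weyl operators, Clifford unitaries, stabilizer states, Weyl measurements -/

/-- The translation operator `X |x⟩ = |x + 1⟩`. -/
def shiftX (d : ℕ) [NeZero d] : Matrix (ZMod d) (ZMod d) ℂ :=
  Matrix.of fun y x => if y = x + 1 then 1 else 0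

/-- The boost operator `Z |x⟩ = ω ^ x |x⟩`, where `ω = exp (2 π i / d)`. -/
def clockZ (d : ℕ) [NeZero d] : Matrix (ZMod d) (ZMod d) ℂ :=
  Matrix.diagonal fun x => ZMod.stdAddChar x

/-- The single-particle Weyl operator `Z ^ p X ^ q`. -/
def weylOne (a : ZMod d × ZMod d) : Matrix (ZMod d) (ZMod d) ℂ :=
  clockZ d ^ a.1.val * shiftX d ^ a.2.val

/-- Weyl operators of `n` qudits: tensor products of single-particle Weyl operators. -/
def weyl (a : Phase d n) : Op d n :=
  Matrix.of fun x y => ∏ i, weylOne (a i) (x i) (y i)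

/-- Clifford unitaries: up to a phase, they map Weyl operators to Weyl operators. -/
def IsClifford (U : Op d n) : Prop :=
  U ∈ Matrix.unitaryGroup (Config d n) ℂ ∧
    ∀ a : Phase d n, ∃ b : Phase d n, ∃ c : ℂ, U * weyl a * Uᴴ = c • weyl b

/-- `ψ` is a unit vector which is, up to scalars, uniquely identified by being the simultaneous
eigenvector of a set of Weyl operators with given eigenvalues. -/
def IsStabilizerVector (ψ : Config d n → ℂ) : Prop :=
  star ψ ⬝ᵥ ψ = 1 ∧
    ∃ (S : Set (Phase d n)) (ev : Phase d n → ℂ), ∀ φ : Config d n → ℂ,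
      (∀ a ∈ S, weyl a *ᵥ φ = ev a • φ) ↔ ∃ c : ℂ, φ = c • ψ

/-- `P` is the (nonzero) orthogonal projector onto the eigenspace of the Weyl operator of `a`
with eigenvalue `z`. -/
structure IsSpectralProjector (a : Phase d n) (z : ℂ) (P : Op d n) : Prop where
  isHermitian : P.IsHermitian
  idempotent : P * P = P
  ne_zero : P ≠ 0
  range_eq : ∀ φ : Config d n → ℂ, P *ᵥ φ = φ ↔ weyl a *ᵥ φ = z • φ

end Quantum

/-! ## The stabilizer subtheory -/

/-- Operational procedures of the stabilizer subtheory of qudits of dimension `d` with registers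
of at most `N` particles, from registers of `n` particles to registers of `m` particles. The
single-particle subtheory is `N = 1`; the unrestricted multi-particle subtheory is `N = ⊤`.
A measurement procedure comes with a chosen outcome (an eigenvalue `z`). -/
inductive Proc (d : ℕ) [NeZero d] (N : ℕ∞) : ℕ → ℕ → Type
  /-- preparation of a pure stabilizer state -/
  | prep {n : ℕ} (hn : (n : ℕ∞) ≤ N) (ψ : Config d n → ℂ) (hψ : IsStabilizerVector ψ) :
      Proc d N 0 n
  /-- a Clifford unitary -/
  | gate {n : ℕ} (hn : (n : ℕ∞) ≤ N) (U : Op d n) (hU : IsClifford U) : Proc d N n n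
  /-- outcome `z` of the projective measurement of a Weyl operator -/
  | meas {n : ℕ} (hn : (n : ℕ∞) ≤ N) (a : Phase d n) (z : ℂ) (P : Op d n)
      (hP : IsSpectralProjector a z P) : Proc d N n n
  /-- discarding a register -/
  | discard {n : ℕ} (hn : (n : ℕ∞) ≤ N) : Proc d N n 0
  /-- permuting the wires of a register (doing nothing, for `σ = 1`) -/
  | wires {n : ℕ} (hn : (n : ℕ∞) ≤ N) (σ : Equiv.Perm (Fin n)) : Proc d N n n
  /-- sequential composition: first `T`, then `S` -/
  | seq {n m k : ℕ} (S : Proc d N m k) (T : Proc d N n m) : Proc d N n k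
  /-- parallel composition -/
  | par {n m n' m' : ℕ} (hn : ((n + n' : ℕ) : ℕ∞) ≤ N) (hm : ((m + m' : ℕ) : ℕ∞) ≤ N)
      (T : Proc d N n m) (T' : Proc d N n' m') : Proc d N (n + n') (m + m')
  /-- convex mixture -/
  | mix {n m : ℕ} (p : ℝ) (hp : 0 ≤ p) (hp' : p ≤ 1) (T T' : Proc d N n m) : Proc d N n m

section Theory

variable {d : ℕ} [NeZero d] {N : ℕ∞}

/-- The quantum process (superoperator) realized by a procedure. -/
def Proc.eval {n m : ℕ} : Proc d N n m → SuperOp d n m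
  | .prep _ ψ _ => prepare ψ
  | .gate _ U _ => conjBy U
  | .meas _ _ _ P _ => conjBy P
  | .discard _ => discardOp d _
  | .wires _ σ => conjBy (wireMatrix (ZMod d) ℂ σ)
  | .seq S T => S.eval ∘ₗ T.eval
  | .par _ _ T T' => superTensor T.eval T'.eval
  | .mix p _ _ T T' => (p : ℂ) • T.eval + ((1 - p : ℝ) : ℂ) • T'.eval

/-- The processes of the stabilizer subtheory. -/
def IsProcess (N : ℕ∞) {n m : ℕ} (T : SuperOp d n m) : Prop :=
  ∃ P : Proc d N n m, P.eval = T

/-- The number which a superoperator on the trivial system is. -/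
def scalar (T : SuperOp d 0 0) : ℂ := T 1 ![] ![]

/-- Two procedures are operationally equivalent if they give equal probabilities in every
circuit, possibly with a side register of `k` particles. -/
def OpEquiv {n m : ℕ} (P Q : Proc d N n m) : Prop :=
  ∀ (k : ℕ) (hk : (k : ℕ∞) ≤ N) (hn : ((n + k : ℕ) : ℕ∞) ≤ N) (hm : ((m + k : ℕ) : ℕ∞) ≤ N)
    (S : Proc d N 0 (n + k)) (E : Proc d N (m + k) 0),
    scalar (E.seq ((Proc.par hn hm P (Proc.wires hk 1)).seq S)).eval =
      scalar (E.seq ((Proc.par hn hm Q (Proc.wires hk 1)).seq S)).eval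

end Theory

/-! ## Quasiprobability representations and ontological models -/

/-- Diagram-preserving quasiprobability representations of the stabilizer subtheory on a finite
sample space `Λ` for one particle, hence `Λⁿ` for `n` particles. The process `T` is represented
by the matrix with entries `map T l' l = ξ_T(l' | l)`; only the values of `map` on processes of
the subtheory matter. -/
structure QuasiRep (d : ℕ) [NeZero d] (N : ℕ∞) (Λ : Type u) [Fintype Λ] where
  /-- the real matrix which represents a process -/
  map : ∀ {n m : ℕ}, SuperOp d n m → Matrix (Fin m → Λ) (Fin n → Λ) ℝ
  /-- sequential composition is preserved -/
  map_seq : ∀ {n m k : ℕ} (S : SuperOp d m k) (T : SuperOp d n m),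
    IsProcess N S → IsProcess N T → map (S ∘ₗ T) = map S * map T
  /-- parallel composition is preserved -/
  map_par : ∀ {n m n' m' : ℕ} (T : SuperOp d n m) (T' : SuperOp d n' m'),
    ((n + n' : ℕ) : ℕ∞) ≤ N → ((m + m' : ℕ) : ℕ∞) ≤ N → IsProcess N T → IsProcess N T' →
      map (superTensor T T') = parMatrix (map T) (map T')
  /-- identity wires and crossings of wires are preserved -/
  map_wires : ∀ {n : ℕ} (σ : Equiv.Perm (Fin n)), (n : ℕ∞) ≤ N →
    map (conjBy (d := d) (wireMatrix (ZMod d) ℂ σ)) = wireMatrix Λ ℝ σ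
  /-- the deterministic effect is represented by the constant function `1` -/
  map_discard : ∀ {n : ℕ}, (n : ℕ∞) ≤ N → map (discardOp d n) = Matrix.of fun _ _ => 1
  /-- the quantum probabilities are recovered -/
  map_scalar : ∀ T : SuperOp d 0 0, IsProcess N T → ((map T ![] ![] : ℝ) : ℂ) = scalar T
  /-- convex mixtures are preserved -/
  map_mix : ∀ {n m : ℕ} (p : ℝ) (T T' : SuperOp d n m), 0 ≤ p → p ≤ 1 →
    IsProcess N T → IsProcess N T' →
      map ((p : ℂ) • T + ((1 - p : ℝ) : ℂ) • T') = p • map T + (1 - p) • map T'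
  /-- coarse-grainings are preserved -/
  map_add : ∀ {n m : ℕ} (T T' : SuperOp d n m),
    IsProcess N T → IsProcess N T' → IsProcess N (T + T') → map (T + T') = map T + map T'

/-- Nonnegative quasiprobability representations. -/
def QuasiRep.Nonneg {d : ℕ} [NeZero d] {N : ℕ∞} {Λ : Type u} [Fintype Λ]
    (R : QuasiRep d N Λ) : Prop :=
  ∀ {n m : ℕ} (T : SuperOp d n m), IsProcess N T →
    ∀ (l' : Fin m → Λ) (l : Fin n → Λ), 0 ≤ R.map T l' l ∧ R.map T l' l ≤ 1

/-- Ontological models of the stabilizer subtheory: every procedure is represented by a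
substochastic matrix on ontic states, compatibly with the composition of procedures. -/
structure OntModel (d : ℕ) [NeZero d] (N : ℕ∞) (Λ : Type u) [Fintype Λ] where
  /-- the matrix which represents a procedure -/
  map : ∀ {n m : ℕ}, Proc d N n m → Matrix (Fin m → Λ) (Fin n → Λ) ℝ
  nonneg : ∀ {n m : ℕ} (P : Proc d N n m) (l' : Fin m → Λ) (l : Fin n → Λ), 0 ≤ map P l' l
  sum_le_one : ∀ {n m : ℕ} (P : Proc d N n m) (l : Fin n → Λ), ∑ l', map P l' l ≤ 1
  map_seq : ∀ {n m k : ℕ} (S : Proc d N m k) (T : Proc d N n m), map (S.seq T) = map S * map T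
  map_par : ∀ {n m n' m' : ℕ} (hn : ((n + n' : ℕ) : ℕ∞) ≤ N) (hm : ((m + m' : ℕ) : ℕ∞) ≤ N)
    (T : Proc d N n m) (T' : Proc d N n' m'),
      map (Proc.par hn hm T T') = parMatrix (map T) (map T')
  map_wires : ∀ {n : ℕ} (hn : (n : ℕ∞) ≤ N) (σ : Equiv.Perm (Fin n)),
    map (Proc.wires hn σ) = wireMatrix Λ ℝ σ
  map_discard : ∀ {n : ℕ} (hn : (n : ℕ∞) ≤ N), map (Proc.discard hn) = Matrix.of fun _ _ => 1
  map_mix : ∀ {n m : ℕ} (p : ℝ) (hp : 0 ≤ p) (hp' : p ≤ 1) (T T' : Proc d N n m),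
    map (Proc.mix p hp hp' T T') = p • map T + (1 - p) • map T'
  /-- the outcomes of a complete measurement have total probability `1` at every ontic state -/
  map_meas_total : ∀ {n r : ℕ} (hn : (n : ℕ∞) ≤ N) (a : Phase d n) (z : Fin r → ℂ)
    (P : Fin r → Op d n) (hP : ∀ i, IsSpectralProjector a (z i) (P i)), ∑ i, P i = 1 →
      ∀ l, ∑ i, ∑ l', map (Proc.meas hn a (z i) (P i) (hP i)) l' l = 1
  /-- the quantum probabilities are recovered -/
  map_scalar : ∀ P : Proc d N 0 0, ((map P ![] ![] : ℝ) : ℂ) = scalar P.eval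

/-- Generalized noncontextuality: operationally equivalent procedures have equal
representations. -/
def OntModel.Noncontextual {d : ℕ} [NeZero d] {N : ℕ∞} {Λ : Type u} [Fintype Λ]
    (M : OntModel d N Λ) : Prop :=
  ∀ {n m : ℕ} (P Q : Proc d N n m), OpEquiv P Q → M.map P = M.map Q

/-! ## Gross's representation and Spekkens' toy theory (for odd `d`) -/

section Gross

variable {d : ℕ} [NeZero d] {N : ℕ∞} {n m : ℕ}

/-- The symplectic form `[(p, q), (p', q')] = p q' - q p'`. -/
def symp (a b : Phase d n) : ZMod d := ∑ i, ((a i).1 * (b i).2 - (a i).2 * (b i).1)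

/-- `2⁻¹ p q`. -/
def halfPQ (a : Phase d n) : ZMod d := 2⁻¹ * ∑ i, (a i).1 * (a i).2

/-- Gross's Weyl operators `ω ^ (- 2⁻¹ p q) Z ^ p X ^ q`, the phase for which the adjoint of the
operator of `a` is the operator of `-a`. -/
def grossWeyl (a : Phase d n) : Op d n := ZMod.stdAddChar (-halfPQ a) • weyl a

/-- Gross's phase point operators `A_a = d⁻ⁿ ∑ b, ω ^ (- [a, b]) (W_b)†`. -/
def phasePoint (a : Phase d n) : Op d n :=
  ((d : ℂ) ^ n)⁻¹ • ∑ b : Phase d n, ZMod.stdAddChar (-symp a b) • (grossWeyl b)ᴴ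

/-- Gross's representation `tr (D_a' T(F_a))`, where `F_a = A_a` and `D_a' = d⁻ᵐ A_a'`. -/
def grossKernel (T : SuperOp d n m) (a' : Phase d m) (a : Phase d n) : ℂ :=
  (((d : ℂ) ^ m)⁻¹ • phasePoint a' * T (phasePoint a)).trace

/-- The representation `R` is Gross's representation, up to the labelling `e` of the sample space
by the points of phase space. -/
def QuasiRep.IsGross {Λ : Type u} [Fintype Λ] (R : QuasiRep d N Λ)
    (e : Λ ≃ ZMod d × ZMod d) : Prop :=
  ∀ {n m : ℕ} (T : SuperOp d n m), IsProcess N T → ∀ (l' : Fin m → Λ) (l : Fin n → Λ),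
    ((R.map T l' l : ℝ) : ℂ) = grossKernel T (e ∘ l') (e ∘ l)

/-- The ontic states at which every quadrature that is sharp in `ψ` has its value in `ψ`. The
quadrature of `a` is the function `l ↦ [a, l]`; it belongs to the operator `grossWeyl a`. -/
def knownSet (ψ : Config d n → ℂ) : Set (Phase d n) :=
  {l | ∀ (a : Phase d n) (k : ZMod d),
    grossWeyl a *ᵥ ψ = (ZMod.stdAddChar k : ℂ) • ψ → symp a l = k}

open Classical in
/-- The model `M` is Spekkens' epistemically restricted toy theory, up to the labelling `e` of the
ontic states by the points of phase space: states are uniform on the ontic states compatible with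
the known quadratures, Clifford gates act as affine symplectic maps, and a quadrature measurement
reveals the value of the quadrature and randomizes the conjugate one. -/
structure OntModel.IsSpekkens {Λ : Type u} [Fintype Λ] (M : OntModel d N Λ)
    (e : Λ ≃ ZMod d × ZMod d) : Prop where
  prep : ∀ {n : ℕ} (hn : (n : ℕ∞) ≤ N) (ψ : Config d n → ℂ) (hψ : IsStabilizerVector ψ)
    (l' : Fin n → Λ) (l : Fin 0 → Λ),
    M.map (Proc.prep hn ψ hψ) l' l =
      if e ∘ l' ∈ knownSet ψ then ((knownSet ψ).ncard : ℝ)⁻¹ else 0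
  gate : ∀ {n : ℕ} (hn : (n : ℕ∞) ≤ N) (U : Op d n) (hU : IsClifford U),
    ∃ (S : Phase d n →ₗ[ZMod d] Phase d n) (t : Phase d n),
      (∀ a b, symp (S a) (S b) = symp a b) ∧
      (∀ a, U * grossWeyl a * Uᴴ = (ZMod.stdAddChar (symp t (S a)) : ℂ) • grossWeyl (S a)) ∧
      ∀ l' l : Fin n → Λ,
        M.map (Proc.gate hn U hU) l' l = if e ∘ l' = S (e ∘ l) + t then 1 else 0
  meas : ∀ {n : ℕ} (hn : (n : ℕ∞) ≤ N) (a : Phase d n) (z : ℂ) (P : Op d n)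
    (hP : IsSpectralProjector a z P),
    ∃ k : ZMod d, z = ZMod.stdAddChar (halfPQ a + k) ∧
      ∀ l' l : Fin n → Λ,
        M.map (Proc.meas hn a z P hP) l' l =
          if symp a (e ∘ l) = k then
            ({j : ZMod d | e ∘ l' = e ∘ l + j • a}.ncard : ℝ) / d
          else 0

end Gross

end Stab

end

set_option linter.unusedSectionVars false

open scoped Matrix

noncomputable section

namespace Stab

-- Nonnegative quasiprobability representations and noncontextual ontological models share one
-- skeleton, `PosRep`: procedures that realize the same process are operationally equivalent, so a
-- noncontextual model descends to processes. Both uniqueness and nonexistence are proved for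
-- `PosRep`.
--
-- Local tomography for one qudit (`id_mem_span_one`): the rank-one spectral projectors of Weyl
-- operators span all operators, so the identity wire is a real combination of measure-and-prepare
-- processes. A representation extends linearly to the real span of processes, so the identity
-- matrix decomposes with the same coefficients (`PosRep.exists_decomposition`). This gives a linear
-- isomorphism `Φ` from the operators on one qudit to the functions on `Λ`, a frame
-- (`PosRep.exists_frame`); in particular `Λ` has `d ^ 2` points.
--
-- A Clifford unitary and its inverse are both represented by nonnegative stochastic matrices, so it
-- permutes `Λ` (`PosRep.IsFrame.exists_perm`). The uniform mixture of the Weyl unitaries is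
-- completely depolarizing, which makes their permutations transitive
-- (`PosRep.IsFrame.exists_translation`). Since a translation only changes the phase of a Weyl
-- operator, no Weyl operator vanishes at any ontic state.
--
-- Even `d`: the gate with phases `exp (π i x² / d)` shears phase space. Composed with a suitable
-- translation it fixes an ontic state, and following the values of the operators at `(p, 1)` around
-- the cycle of length `d` in `p` multiplies a nonzero number by `-1` (`PosRep.false_of_even`).
--
-- Odd `d`: parity acts as an involution on an odd number of ontic states and fixes one of them.
-- There the outcomes `k` and `-k` of a sharp measurement are on a par, but states of different
-- outcomes have disjoint supports; so only `k = 0` survives and every Gross Weyl operator has the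
-- value `d⁻¹` (`PosRep.IsFrame.grossWeyl_apply`). That state therefore carries the phase point
-- operator at the origin, and translations yield the others. For larger registers, product states
-- and product effects already agree with Gross's representation and span the identity matrix;
-- sandwiching a process between them leaves closed circuits, whose values are quantum probabilities
-- (`PosRep.exists_eq_gross`).
--
-- Existence for odd `d`: Gross's kernel is multiplicative because the phase point operators form a
-- dual basis of themselves up to scale, and the generators are computed to be substochastic and of
-- Spekkens' form (`grossMatrix_prepare`, `IsClifford.exists_symplectic`,
-- `conjBy_isoProj_phasePoint`). Noncontextuality of this model is local tomography again
-- (`OpEquiv.eval_eq`).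

local notation "χ" => (ZMod.stdAddChar : AddChar (ZMod _) ℂ)

/-! ## The phase space and the characters of `ZMod d` -/

section Weyl

variable {d : ℕ} [NeZero d] {n m n' m' : ℕ}

/-- The momenta of a point of phase space. -/
def mom (a : Phase d n) : Config d n := fun i => (a i).1

/-- The positions of a point of phase space. -/
def pos (a : Phase d n) : Config d n := fun i => (a i).2

/-- The point of phase space with given momenta and positions. -/
def mkPhase (p q : Config d n) : Phase d n := fun i => (p i, q i)

@[simp] lemma mom_mkPhase (p q : Config d n) : mom (mkPhase p q) = p := rfl
@[simp] lemma pos_mkPhase (p q : Config d n) : pos (mkPhase p q) = q := rfl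
@[simp] lemma mkPhase_mom_pos (a : Phase d n) : mkPhase (mom a) (pos a) = a := rfl
@[simp] lemma mom_add (a b : Phase d n) : mom (a + b) = mom a + mom b := rfl
@[simp] lemma pos_add (a b : Phase d n) : pos (a + b) = pos a + pos b := rfl
@[simp] lemma mom_neg (a : Phase d n) : mom (-a) = -mom a := rfl
@[simp] lemma pos_neg (a : Phase d n) : pos (-a) = -pos a := rfl
@[simp] lemma mom_zero : mom (0 : Phase d n) = 0 := rfl
@[simp] lemma pos_zero : pos (0 : Phase d n) = 0 := rfl
@[simp] lemma mom_smul (k : ZMod d) (a : Phase d n) : mom (k • a) = k • mom a := rfl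
@[simp] lemma pos_smul (k : ZMod d) (a : Phase d n) : pos (k • a) = k • pos a := rfl

lemma phase_ext {a b : Phase d n} (h : mom a = mom b) (h' : pos a = pos b) : a = b := by
  rw [← mkPhase_mom_pos a, ← mkPhase_mom_pos b, h, h']

lemma symp_eq (a b : Phase d n) : symp a b = mom a ⬝ᵥ pos b - pos a ⬝ᵥ mom b := by
  simp [symp, dotProduct, mom, pos, Finset.sum_sub_distrib]

lemma halfPQ_eq (a : Phase d n) : halfPQ a = 2⁻¹ * (mom a ⬝ᵥ pos a) := rfl

lemma symp_add_left (a b c : Phase d n) : symp (a + b) c = symp a c + symp b c := by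
  simp only [symp_eq, mom_add, pos_add, add_dotProduct]; ring

lemma symp_add_right (a b c : Phase d n) : symp a (b + c) = symp a b + symp a c := by
  simp only [symp_eq, mom_add, pos_add, dotProduct_add]; ring

lemma symp_smul_left (k : ZMod d) (a b : Phase d n) : symp (k • a) b = k * symp a b := by
  simp only [symp_eq, mom_smul, pos_smul, smul_dotProduct, smul_eq_mul]; ring

lemma symp_smul_right (k : ZMod d) (a b : Phase d n) : symp a (k • b) = k * symp a b := by
  simp only [symp_eq, mom_smul, pos_smul, dotProduct_smul, smul_eq_mul]; ring

lemma symp_neg_left (a b : Phase d n) : symp (-a) b = -symp a b := by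
  simp only [symp_eq, mom_neg, pos_neg, neg_dotProduct]; ring

lemma symp_neg_right (a b : Phase d n) : symp a (-b) = -symp a b := by
  simp only [symp_eq, mom_neg, pos_neg, dotProduct_neg]; ring

lemma symp_sub_right (a b c : Phase d n) : symp a (b - c) = symp a b - symp a c := by
  rw [sub_eq_add_neg, symp_add_right, symp_neg_right, sub_eq_add_neg]

lemma symp_swap (a b : Phase d n) : symp a b = -symp b a := by
  rw [symp_eq, symp_eq, dotProduct_comm (mom a), dotProduct_comm (pos a)]; ring

@[simp] lemma symp_self (a : Phase d n) : symp a a = 0 := by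
  rw [symp_eq, dotProduct_comm]; ring

@[simp] lemma symp_zero_left (a : Phase d n) : symp 0 a = 0 := by simp [symp_eq]
@[simp] lemma symp_zero_right (a : Phase d n) : symp a 0 = 0 := by simp [symp_eq]

/-- Pairing with the coordinate vectors reads off each coordinate, so nondegeneracy needs no
primality of `d`. -/
lemma eq_zero_of_symp_eq_zero {a : Phase d n} (h : ∀ b, symp b a = 0) : a = 0 := by
  apply phase_ext
  · ext i
    have := h (mkPhase 0 (Pi.single i 1))
    simpa [symp_eq] using this
  · ext i
    have := h (mkPhase (Pi.single i 1) 0)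
    simpa [symp_eq] using this

lemma chi_add (x y : ZMod d) : χ (x + y) = χ x * χ y := AddChar.map_add_eq_mul _ _ _

lemma chi_ne_zero (x : ZMod d) : χ x ≠ 0 := by
  intro h
  have := chi_add x (-x)
  rw [h, add_neg_cancel, AddChar.map_zero_eq_one, zero_mul] at this
  exact one_ne_zero this

lemma star_chi (x : ZMod d) : star (χ x) = χ (-x) := by
  rw [AddChar.map_neg_eq_conj]; rfl

lemma chi_sum {ι : Type*} (s : Finset ι) (f : ι → ZMod d) :
    χ (∑ i ∈ s, f i) = ∏ i ∈ s, χ (f i) := by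
  classical
  induction s using Finset.induction_on with
  | empty => simp
  | insert i s hi ih => rw [Finset.sum_insert hi, Finset.prod_insert hi, chi_add, ih]

lemma chi_mul_star (x : ZMod d) : χ x * star (χ x) = 1 := by
  rw [star_chi, ← chi_add, add_neg_cancel, AddChar.map_zero_eq_one]

lemma chi_inj {x y : ZMod d} : χ x = χ y ↔ x = y :=
  ZMod.injective_stdAddChar.eq_iff

lemma chi_eq_one {x : ZMod d} : χ x = 1 ↔ x = 0 := by
  rw [← chi_inj, AddChar.map_zero_eq_one]

lemma chi_pow_card (x : ZMod d) : χ x ^ d = 1 := by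
  rw [← AddChar.map_nsmul_eq_pow]
  simp

/-- Every `d`-th root of unity is a value of the standard character. -/
lemma exists_chi_eq {z : ℂ} (hz : z ^ d = 1) : ∃ k : ZMod d, z = χ k := by
  have hprim : IsPrimitiveRoot (χ (1 : ZMod d)) d := by
    have := Complex.isPrimitiveRoot_exp d (NeZero.ne d)
    convert this using 1
    simpa using ZMod.stdAddChar_coe (N := d) 1
  obtain ⟨i, -, hi⟩ := hprim.eq_pow_of_pow_eq_one hz
  refine ⟨i • 1, ?_⟩
  rw [AddChar.map_nsmul_eq_pow, hi]

/-- Orthogonality of characters; `χ` is injective, so `χ ∘ f` is trivial only if `f` is zero. -/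
lemma sum_chi_eq {G : Type*} [AddCommGroup G] [Fintype G] (f : G →+ ZMod d)
    [Decidable (∀ g, f g = 0)] :
    ∑ g, χ (f g) = if ∀ g, f g = 0 then (Fintype.card G : ℂ) else 0 := by
  classical
  have h := AddChar.sum_eq_ite (R := ℂ) ((ZMod.stdAddChar (N := d)).compAddMonoidHom f)
  simp only [AddChar.compAddMonoidHom_apply] at h
  rw [h]
  congr 1
  rw [AddChar.ext_iff, eq_iff_iff]
  simp [chi_eq_one]

lemma sum_chi_mul (k : ZMod d) : ∑ j : ZMod d, χ (j * k) = if k = 0 then (d : ℂ) else 0 := by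
  have h := sum_chi_eq (AddMonoidHom.mulRight k)
  simp only [AddMonoidHom.mulRight_apply, ZMod.card] at h
  rw [h]
  congr 1
  rw [eq_iff_iff]
  exact ⟨fun h => by simpa using h 1, fun h => by simp [h]⟩

lemma sum_chi_dot (x : Config d n) :
    ∑ p : Config d n, χ (p ⬝ᵥ x) = if x = 0 then (d : ℂ) ^ n else 0 := by
  classical
  have h := sum_chi_eq (AddMonoidHom.mk' (fun p : Config d n => p ⬝ᵥ x)
    (fun p q => add_dotProduct p q x))
  simp only [AddMonoidHom.mk'_apply] at h
  rw [h]
  have : (∀ g : Config d n, g ⬝ᵥ x = 0) ↔ x = 0 := by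
    refine ⟨fun h => ?_, fun h => by simp [h]⟩
    ext i
    simpa using h (Pi.single i 1)
  simp [this]

lemma sum_chi_symp (a : Phase d n) :
    ∑ b : Phase d n, χ (symp b a) = if a = 0 then ((d : ℂ) ^ n) ^ 2 else 0 := by
  classical
  have h := sum_chi_eq (AddMonoidHom.mk' (fun b : Phase d n => symp b a)
    (fun b c => symp_add_left b c a))
  simp only [AddMonoidHom.mk'_apply] at h
  rw [h]
  have : (∀ g : Phase d n, symp g a = 0) ↔ a = 0 :=
    ⟨eq_zero_of_symp_eq_zero, fun h => by simp [h]⟩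
  simp only [this]
  congr 1
  simp only [Phase, Fintype.card_fun, Fintype.card_prod, ZMod.card, Fintype.card_fin]
  push_cast; ring

/-! ## Weyl operators -/

lemma clockZ_pow (k : ℕ) : clockZ d ^ k = Matrix.diagonal fun x : ZMod d => χ ((k : ZMod d) * x) := by
  rw [clockZ, Matrix.diagonal_pow]
  congr 1
  ext x
  rw [Pi.pow_apply, ← AddChar.map_nsmul_eq_pow, nsmul_eq_mul]

lemma shiftX_pow (k : ℕ) :
    shiftX d ^ k = Matrix.of fun y x : ZMod d => if y = x + (k : ZMod d) then 1 else 0 := by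
  induction k with
  | zero => ext x y; simp [Matrix.one_apply]
  | succ k ih =>
    rw [pow_succ', ih]
    ext x y
    simp only [Matrix.mul_apply, shiftX, Matrix.of_apply, mul_ite, mul_one, mul_zero,
      Finset.sum_ite_eq', Finset.mem_univ, if_true, Nat.cast_succ, add_assoc]

lemma weylOne_apply (a : ZMod d × ZMod d) (x y : ZMod d) :
    weylOne a x y = if x = y + a.2 then χ (a.1 * x) else 0 := by
  rw [weylOne, clockZ_pow, shiftX_pow, Matrix.diagonal_mul]
  simp

lemma weyl_apply (a : Phase d n) (x y : Config d n) :
    weyl a x y = if x = y + pos a then χ (mom a ⬝ᵥ x) else 0 := by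
  simp only [weyl, Matrix.of_apply, weylOne_apply, Finset.prod_ite_zero, Finset.mem_univ,
    true_implies]
  congr 1
  · rw [eq_iff_iff, funext_iff]; rfl
  · rw [dotProduct, chi_sum]; rfl

lemma weyl_zero : weyl (0 : Phase d n) = 1 := by
  ext x y; simp [weyl_apply, Matrix.one_apply]

lemma weyl_mul (a b : Phase d n) :
    weyl a * weyl b = χ (-(pos a ⬝ᵥ mom b)) • weyl (a + b) := by
  ext x y
  simp only [Matrix.mul_apply, weyl_apply, mul_ite, mul_zero, ite_mul, zero_mul,
    Finset.sum_ite_eq', Finset.mem_univ, if_true, Matrix.smul_apply, smul_eq_mul]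
  by_cases h : x = y + pos b + pos a
  · have h' : x = y + pos (a + b) := by rw [h, pos_add]; abel
    rw [if_pos h, if_pos h', ← chi_add, ← chi_add]
    congr 1
    subst h
    simp only [mom_add, add_dotProduct, dotProduct_add]
    rw [dotProduct_comm (pos a) (mom b)]
    ring
  · have h' : ¬ x = y + pos (a + b) := by
      intro h'; exact h (by rw [h', pos_add]; abel)
    rw [if_neg h, if_neg h']

lemma weyl_conjTranspose (a : Phase d n) :
    (weyl a)ᴴ = χ (-(pos a ⬝ᵥ mom a)) • weyl (-a) := by
  ext x y
  simp only [Matrix.conjTranspose_apply, weyl_apply, Matrix.smul_apply, smul_eq_mul]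
  by_cases h : y = x + pos a
  · have h' : x = y + pos (-a) := by rw [h, pos_neg]; abel
    rw [if_pos h, if_pos h', star_chi, ← chi_add]
    congr 1
    subst h
    simp only [mom_neg, neg_dotProduct, dotProduct_add]
    rw [dotProduct_comm (pos a) (mom a)]
    ring
  · have h' : ¬ x = y + pos (-a) := by
      intro h'; exact h (by rw [h', pos_neg]; abel)
    rw [if_neg h, if_neg h', star_zero, mul_zero]

lemma weyl_mul_conjTranspose (a : Phase d n) : weyl a * (weyl a)ᴴ = 1 := by
  rw [weyl_conjTranspose, Matrix.mul_smul, weyl_mul, add_neg_cancel, weyl_zero, smul_smul,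
    ← chi_add]
  simp

lemma weyl_mem_unitary (a : Phase d n) : weyl a ∈ Matrix.unitaryGroup (Config d n) ℂ := by
  rw [Matrix.mem_unitaryGroup_iff]
  exact weyl_mul_conjTranspose a

lemma weyl_conjTranspose_mul (a : Phase d n) : (weyl a)ᴴ * weyl a = 1 :=
  Matrix.mem_unitaryGroup_iff'.1 (weyl_mem_unitary a)

lemma weyl_ne_zero (a : Phase d n) : weyl a ≠ 0 := by
  intro h
  have := weyl_mul_conjTranspose a
  rw [h, zero_mul] at this
  exact zero_ne_one this

lemma weyl_comm (a b : Phase d n) :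
    weyl a * weyl b = χ (symp a b) • (weyl b * weyl a) := by
  rw [weyl_mul, weyl_mul, smul_smul, ← chi_add, add_comm b a, symp_eq]
  congr 2
  rw [dotProduct_comm (pos b) (mom a)]
  ring

/-- Weyl operators are Clifford. -/
lemma weyl_conj (a b : Phase d n) :
    weyl a * weyl b * (weyl a)ᴴ = χ (symp a b) • weyl b := by
  rw [weyl_comm, Matrix.smul_mul, mul_assoc, weyl_mul_conjTranspose, mul_one]

lemma isClifford_weyl (a : Phase d n) : IsClifford (weyl a) :=
  ⟨weyl_mem_unitary a, fun b => ⟨b, _, weyl_conj a b⟩⟩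

lemma trace_weyl (a : Phase d n) : (weyl a).trace = if a = 0 then (d : ℂ) ^ n else 0 := by
  simp only [Matrix.trace, Matrix.diag, weyl_apply, left_eq_add]
  by_cases hq : pos a = 0
  · simp only [hq, if_true]
    simp_rw [dotProduct_comm (mom a)]
    rw [sum_chi_dot]
    congr 1
    rw [eq_iff_iff]
    exact ⟨fun h => phase_ext h hq, fun h => by simp [h]⟩
  · have : a ≠ 0 := by rintro rfl; exact hq rfl
    simp [hq, this]

/-- Fourier inversion in the momentum: the sum over `p` selects the row `x`, and the shift `x - y`
then selects the column `y`. -/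
lemma single_eq_sum_weyl (x y : Config d n) :
    Matrix.single x y (1 : ℂ) =
      ((d : ℂ) ^ n)⁻¹ • ∑ p : Config d n, χ (-(p ⬝ᵥ x)) • weyl (mkPhase p (x - y)) := by
  have hd : ((d : ℂ) ^ n) ≠ 0 := pow_ne_zero _ (Nat.cast_ne_zero.2 (NeZero.ne d))
  ext u w
  rw [Matrix.smul_apply, Matrix.sum_apply]
  simp only [Matrix.smul_apply, weyl_apply, mom_mkPhase, pos_mkPhase, smul_eq_mul]
  by_cases h : u = w + (x - y)
  · have h1 : ∀ p : Config d n, χ (-(p ⬝ᵥ x)) * χ (p ⬝ᵥ u) = χ (p ⬝ᵥ (u - x)) := fun p => by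
      rw [← chi_add, dotProduct_sub]; ring_nf
    simp only [h, if_true] at h1 ⊢
    simp only [h1, sum_chi_dot]
    by_cases h' : w = y
    · subst h'
      simp [hd]
    · have h3 : w + (x - y) - x ≠ 0 := by
        intro h4; apply h'
        have : w - y = 0 := by rw [← h4]; abel
        exact sub_eq_zero.1 this
      simp [Ne.symm h', h3]
  · have : ¬ (x = u ∧ y = w) := by rintro ⟨rfl, rfl⟩; exact h (by abel)
    simp [h, this]

/-- The Weyl operators span all operators. -/
lemma span_weyl : Submodule.span ℂ (Set.range (weyl : Phase d n → Op d n)) = ⊤ := by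
  rw [eq_top_iff]
  intro M _
  rw [Matrix.matrix_eq_sum_single M]
  refine Submodule.sum_mem _ fun x _ => Submodule.sum_mem _ fun y _ => ?_
  have : Matrix.single x y (M x y) = M x y • Matrix.single x y (1 : ℂ) := by
    rw [Matrix.smul_single, smul_eq_mul, mul_one]
  rw [this, single_eq_sum_weyl]
  refine Submodule.smul_mem _ _ (Submodule.smul_mem _ _ (Submodule.sum_mem _ fun p _ =>
    Submodule.smul_mem _ _ (Submodule.subset_span ⟨_, rfl⟩)))

/-- Linear maps which agree on the Weyl operators are equal. -/
lemma linearMap_ext_weyl {V : Type*} [AddCommGroup V] [Module ℂ V] {f g : Op d n →ₗ[ℂ] V}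
    (h : ∀ a, f (weyl a) = g (weyl a)) : f = g :=
  LinearMap.ext_on_range span_weyl h

/-- The uniform mixture of all translations is completely depolarizing. -/
lemma sum_weyl_conj (M : Op d n) :
    ∑ b : Phase d n, weyl b * M * (weyl b)ᴴ = ((d : ℂ) ^ n * M.trace) • (1 : Op d n) := by
  have key : (∑ b : Phase d n, conjBy (weyl b)) =
      ((d : ℂ) ^ n) • (Matrix.traceLinearMap _ ℂ ℂ).smulRight (1 : Op d n) := by
    refine linearMap_ext_weyl fun a => ?_
    simp only [LinearMap.sum_apply, conjBy, LinearMap.coe_mk, AddHom.coe_mk, weyl_conj,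
      LinearMap.smul_apply, LinearMap.smulRight_apply, Matrix.traceLinearMap_apply]
    rw [← Finset.sum_smul, sum_chi_symp, trace_weyl]
    split_ifs with h
    · rw [h, weyl_zero, smul_smul]; ring_nf
    · simp
  have := LinearMap.congr_fun key M
  simpa [conjBy, smul_smul] using this

/-- The Weyl operator determines its label, and its phase. -/
lemma weyl_label_unique {a b : Phase d n} {c c' : ℂ} (hc : c ≠ 0)
    (h : c • weyl a = c' • weyl b) : a = b ∧ c = c' := by
  have hab : a = b := by
    by_contra hab
    -- Multiplying by the adjoint of `weyl a` and taking traces separates different labels, since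
    -- only the label `0` has nonzero trace.
    have h1 := congrArg (fun M => (M * (weyl a)ᴴ).trace) h
    simp only [Matrix.smul_mul, Matrix.trace_smul, weyl_conjTranspose, Matrix.mul_smul, weyl_mul, trace_weyl] at h1
    have : b + -a ≠ 0 := fun h => hab (add_neg_eq_zero.1 h).symm
    simp [this, hc, NeZero.ne d, chi_ne_zero] at h1
  subst hab
  refine ⟨rfl, ?_⟩
  have : (c - c') • weyl a = 0 := by rw [sub_smul, h, sub_self]
  exact sub_eq_zero.1 ((smul_eq_zero.1 this).resolve_right (weyl_ne_zero a))

end Weyl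

/-! ## Spectral projectors of unitary representations of `ZMod d` -/

section Spectral

variable {d : ℕ} [NeZero d] {n m n' m' : ℕ}

/-- A unitary representation of the cyclic group `ZMod d`. -/
structure IsCyclicRep (u : ZMod d → Op d n) : Prop where
  map_zero : u 0 = 1
  map_add : ∀ i j, u (i + j) = u i * u j
  map_star : ∀ j, (u j)ᴴ = u (-j)

/-- The projector onto the isotypic component of a character. -/
def isoProj (u : ZMod d → Op d n) (k : ZMod d) : Op d n :=
  (d : ℂ)⁻¹ • ∑ j : ZMod d, χ (-(j * k)) • u j

lemma natCast_dim_ne_zero : (d : ℂ) ≠ 0 := Nat.cast_ne_zero.2 (NeZero.ne d)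

namespace IsCyclicRep

variable {u : ZMod d → Op d n} (hu : IsCyclicRep u)
include hu

lemma mul_isoProj (j k : ZMod d) : u j * isoProj u k = χ (j * k) • isoProj u k := by
  rw [isoProj, Matrix.mul_smul, smul_comm (χ (j * k))]
  congr 1
  rw [Finset.mul_sum, Finset.smul_sum]
  rw [← Equiv.sum_comp (Equiv.addLeft j) (fun i => χ (j * k) • χ (-(i * k)) • u i)]
  refine Finset.sum_congr rfl fun i _ => ?_
  rw [Equiv.coe_addLeft, Matrix.mul_smul, ← hu.map_add, smul_smul, ← chi_add]
  congr 2
  ring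

lemma isoProj_mul (j k : ZMod d) :
    isoProj u j * isoProj u k = if j = k then isoProj u k else 0 := by
  have h : isoProj u j * isoProj u k =
      ((d : ℂ)⁻¹ * ∑ i : ZMod d, χ (i * (k - j))) • isoProj u k := by
    conv_lhs => rw [isoProj]
    rw [Matrix.smul_mul, Finset.sum_mul, mul_smul, Finset.sum_smul]
    congr 1
    refine Finset.sum_congr rfl fun i _ => ?_
    rw [Matrix.smul_mul, hu.mul_isoProj, smul_smul, ← chi_add]
    congr 2
    ring
  rw [h, sum_chi_mul]
  by_cases hjk : j = k
  · simp [hjk]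
  · simp [hjk, sub_eq_zero, Ne.symm hjk]

lemma sum_isoProj : ∑ k, isoProj u k = 1 := by
  simp only [isoProj]
  rw [← Finset.smul_sum, Finset.sum_comm]
  have : ∀ j : ZMod d, ∑ k : ZMod d, χ (-(j * k)) • u j = (if j = 0 then (d : ℂ) else 0) • u j := by
    intro j
    rw [← Finset.sum_smul]
    have h := sum_chi_mul (-j)
    simp only [mul_neg, neg_eq_zero] at h
    rw [← h]
    simp only [mul_comm]
  simp only [this, ite_smul, zero_smul, Finset.sum_ite_eq', Finset.mem_univ, if_true, hu.map_zero,
    smul_smul, inv_mul_cancel₀ (natCast_dim_ne_zero (d := d)), one_smul]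

lemma eq_sum_isoProj (j : ZMod d) : u j = ∑ k, χ (j * k) • isoProj u k := by
  rw [← mul_one (u j), ← hu.sum_isoProj, Finset.mul_sum]
  exact Finset.sum_congr rfl fun k _ => hu.mul_isoProj j k

lemma isoProj_isHermitian (k : ZMod d) : (isoProj u k).IsHermitian := by
  rw [Matrix.IsHermitian, isoProj, Matrix.conjTranspose_smul, Matrix.conjTranspose_sum]
  congr 1
  · simp
  · rw [← Equiv.sum_comp (Equiv.neg (ZMod d)) (fun j => χ (-(j * k)) • u j)]
    refine Finset.sum_congr rfl fun j _ => ?_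
    rw [Matrix.conjTranspose_smul, hu.map_star, star_chi, Equiv.neg_apply]
    congr 2
    ring

/-- The group is cyclic, so the eigenvalue of the generator determines the eigenvalues of all `u j`.
-/
lemma isoProj_mulVec_iff (k : ZMod d) (φ : Config d n → ℂ) :
    isoProj u k *ᵥ φ = φ ↔ u 1 *ᵥ φ = χ k • φ := by
  constructor
  · intro h
    rw [← h, Matrix.mulVec_mulVec, hu.mul_isoProj, one_mul, Matrix.smul_mulVec]
  · intro h
    have h1 : ∀ j : ℕ, u (j : ZMod d) *ᵥ φ = χ ((j : ZMod d) * k) • φ := by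
      intro j
      induction j with
      | zero => simp [hu.map_zero]
      | succ j ih =>
        rw [Nat.cast_succ, hu.map_add, ← Matrix.mulVec_mulVec, h, Matrix.mulVec_smul, ih,
          smul_smul, ← chi_add, add_mul, one_mul, add_comm]
    have h2 : ∀ j : ZMod d, u j *ᵥ φ = χ (j * k) • φ := by
      intro j
      have := h1 j.val
      rwa [ZMod.natCast_zmod_val] at this
    rw [isoProj, Matrix.smul_mulVec, Matrix.sum_mulVec]
    have h3 : ∀ j ∈ Finset.univ, (χ (-(j * k)) • u j) *ᵥ φ = φ := by
      intro j _
      rw [Matrix.smul_mulVec, h2, smul_smul, ← chi_add, neg_add_cancel, AddChar.map_zero_eq_one,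
        one_smul]
    rw [Finset.sum_congr rfl h3, Finset.sum_const, Finset.card_univ, ZMod.card,
      ← Nat.cast_smul_eq_nsmul ℂ, smul_smul, inv_mul_cancel₀ natCast_dim_ne_zero, one_smul]

/-- The factor `c` is essential for even `d`: there the `d`-th power of a Weyl operator need not be
`1`, and its eigenvalues need not be `d`-th roots of unity. -/
lemma isSpectralProjector {a : Phase d n} {c z : ℂ} (hc : c ≠ 0) (h1 : u 1 = c • weyl a)
    {k : ZMod d} (hz : c * z = χ k) (hne : isoProj u k ≠ 0) :
    IsSpectralProjector a z (isoProj u k) where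
  isHermitian := hu.isoProj_isHermitian k
  idempotent := by rw [hu.isoProj_mul, if_pos rfl]
  ne_zero := hne
  range_eq φ := by
    rw [hu.isoProj_mulVec_iff, h1, ← hz, Matrix.smul_mulVec, mul_smul]
    exact (smul_right_injective _ hc).eq_iff

lemma trace_isoProj (htr : ∀ j, j ≠ 0 → (u j).trace = 0) (k : ZMod d) :
    (isoProj u k).trace = (d : ℂ)⁻¹ * (d : ℂ) ^ n := by
  rw [isoProj, Matrix.trace_smul, Matrix.trace_sum, Finset.sum_eq_single 0]
  · simp [hu.map_zero, Matrix.trace_one]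
  · intro j _ hj
    rw [Matrix.trace_smul, htr j hj, smul_zero]
  · simp

end IsCyclicRep

/-- A spectral projector is determined by the operator and the eigenvalue. -/
lemma IsSpectralProjector.unique {a : Phase d n} {z : ℂ} {P P' : Op d n}
    (h : IsSpectralProjector a z P) (h' : IsSpectralProjector a z P') : P = P' := by
  -- Both projectors fix the same vectors, so each absorbs the other on its right; taking adjoints
  -- gives equality.
  have key : ∀ {P P' : Op d n}, IsSpectralProjector a z P → IsSpectralProjector a z P' →
      P * P' = P' := by
    intro P P' h h'
    refine Matrix.ext_of_mulVec_single fun i => ?_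
    rw [← Matrix.mulVec_mulVec, h.range_eq, ← h'.range_eq, Matrix.mulVec_mulVec, h'.idempotent]
  have h1 := congrArg Matrix.conjTranspose (key h h')
  rw [Matrix.conjTranspose_mul, h.isHermitian.eq, h'.isHermitian.eq, key h' h] at h1
  exact h1

lemma vecMulVec_star_mul_self {ι : Type*} [Fintype ι] {ψ : ι → ℂ} (h : star ψ ⬝ᵥ ψ = 1) :
    Matrix.vecMulVec ψ (star ψ) * Matrix.vecMulVec ψ (star ψ) = Matrix.vecMulVec ψ (star ψ) := by
  rw [Matrix.vecMulVec_mul_vecMulVec, h, one_smul]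

lemma trace_vecMulVec_star {ι : Type*} [Fintype ι] {ψ : ι → ℂ} (h : star ψ ⬝ᵥ ψ = 1) :
    (Matrix.vecMulVec ψ (star ψ)).trace = 1 := by
  rw [Matrix.trace_vecMulVec, dotProduct_comm, h]

lemma conjTranspose_vecMulVec_star {ι : Type*} (ψ : ι → ℂ) :
    (Matrix.vecMulVec ψ (star ψ))ᴴ = Matrix.vecMulVec ψ (star ψ) := by
  rw [Matrix.conjTranspose_vecMulVec, star_star]

open scoped ComplexOrder in
/-- Orthogonal projectors of trace one have rank one. -/
lemma exists_eq_vecMulVec {ι : Type*} [Fintype ι] [DecidableEq ι] {P : Matrix ι ι ℂ}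
    (hP : P.IsHermitian) (hP2 : P * P = P) (htr : P.trace = 1) :
    ∃ ψ : ι → ℂ, star ψ ⬝ᵥ ψ = 1 ∧ P = Matrix.vecMulVec ψ (star ψ) := by
  have hne : ∃ i, P *ᵥ Pi.single i 1 ≠ 0 := by
    by_contra! h
    have : P = 0 := Matrix.ext_of_mulVec_single fun i => by rw [h, Matrix.zero_mulVec]
    rw [this, Matrix.trace_zero] at htr
    exact zero_ne_one htr
  obtain ⟨i, hi⟩ := hne
  -- Any nonzero column of `P`, once normalized, spans the range.
  set v := P *ᵥ Pi.single i 1 with hv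
  have hPv : P *ᵥ v = v := by rw [hv, Matrix.mulVec_mulVec, hP2]
  have hpos : 0 < star v ⬝ᵥ v := Matrix.dotProduct_star_self_pos_iff.2 hi
  obtain ⟨hre, him⟩ := Complex.pos_iff.1 hpos
  set r := (star v ⬝ᵥ v).re with hr
  have hvr : star v ⬝ᵥ v = (r : ℂ) := Complex.ext rfl (by simpa using him.symm)
  set c : ℂ := (((Real.sqrt r)⁻¹ : ℝ) : ℂ) with hcdef
  have hc : star c * c * r = 1 := by
    have h1 : star c = c := Complex.conj_ofReal _
    rw [h1, hcdef, ← Complex.ofReal_mul, ← Complex.ofReal_mul, ← mul_inv, Real.mul_self_sqrt hre.le,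
      inv_mul_cancel₀ hre.ne', Complex.ofReal_one]
  have hnorm : star (c • v) ⬝ᵥ (c • v) = 1 := by
    rw [star_smul, smul_dotProduct, dotProduct_smul, hvr, smul_eq_mul, smul_eq_mul, ← mul_assoc, hc]
  refine ⟨c • v, hnorm, ?_⟩
  set ψ := c • v with hψ
  have hPψ : P *ᵥ ψ = ψ := by rw [hψ, Matrix.mulVec_smul, hPv]
  have h1 : P * Matrix.vecMulVec ψ (star ψ) = Matrix.vecMulVec ψ (star ψ) := by
    rw [Matrix.mul_vecMulVec, hPψ]
  have h2 : Matrix.vecMulVec ψ (star ψ) * P = Matrix.vecMulVec ψ (star ψ) := by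
    have := congrArg Matrix.conjTranspose h1
    rwa [Matrix.conjTranspose_mul, hP.eq, conjTranspose_vecMulVec_star] at this
  -- The difference is a Hermitian idempotent of trace zero, so its Hilbert–Schmidt norm vanishes.
  have h3 : ((P - Matrix.vecMulVec ψ (star ψ))ᴴ * (P - Matrix.vecMulVec ψ (star ψ))).trace = 0 := by
    rw [Matrix.conjTranspose_sub, hP.eq, conjTranspose_vecMulVec_star, sub_mul, mul_sub, mul_sub,
      hP2, h1, h2, vecMulVec_star_mul_self hnorm, sub_self, sub_zero, Matrix.trace_sub, htr,
      trace_vecMulVec_star hnorm, sub_self]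
  exact sub_eq_zero.1 (Matrix.trace_conjTranspose_mul_self_eq_zero_iff.1 h3)

/-- If a Weyl operator has a spectral projector of trace one, then it is a stabilizer state. -/
lemma IsSpectralProjector.exists_stabilizerVector {a : Phase d n} {z : ℂ} {P : Op d n}
    (h : IsSpectralProjector a z P) (htr : P.trace = 1) :
    ∃ ψ : Config d n → ℂ, IsStabilizerVector ψ ∧ P = Matrix.vecMulVec ψ (star ψ) := by
  obtain ⟨ψ, hψ, hP⟩ := exists_eq_vecMulVec h.isHermitian h.idempotent htr
  refine ⟨ψ, ⟨hψ, {a}, fun _ => z, fun φ => ?_⟩, hP⟩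
  simp only [Set.mem_singleton_iff, forall_eq]
  rw [← h.range_eq, hP, Matrix.vecMulVec_mulVec]
  constructor
  · intro h
    exact ⟨star ψ ⬝ᵥ φ, by simpa using h.symm⟩
  · rintro ⟨c, rfl⟩
    rw [dotProduct_smul, hψ]
    simp

/-! ## One qudit -/

/-- A point of phase space which generates a copy of `ZMod d`. -/
def IsFree (v : Phase d n) : Prop := ∀ k : ZMod d, k • v = 0 → k = 0

/-- Dividing both coordinates by their greatest common divisor leaves a coprime pair, and Bézout's
identity makes it free. For composite `d` a nonzero point need not be free itself. -/
lemma exists_isFree (a : Phase d 1) : ∃ (v : Phase d 1) (j : ZMod d), IsFree v ∧ a = j • v := by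
  obtain ⟨p, q, hpq, hp, hq⟩ := Nat.exists_coprime (a 0).1.val (a 0).2.val
  refine ⟨fun _ => ((p : ZMod d), (q : ZMod d)), (Nat.gcd (a 0).1.val (a 0).2.val : ℕ), ?_, ?_⟩
  · intro k hk
    have h0 := congrFun hk 0
    simp only [Pi.smul_apply, Prod.smul_mk, smul_eq_mul, Pi.zero_apply, Prod.mk_eq_zero] at h0
    have hb := Nat.gcd_eq_gcd_ab p q
    rw [hpq.gcd_eq_one] at hb
    have hb' : (1 : ZMod d) = p * (Nat.gcdA p q : ℤ) + q * (Nat.gcdB p q : ℤ) := by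
      have := congrArg (Int.cast : ℤ → ZMod d) hb
      push_cast at this
      exact this
    calc k = k * 1 := (mul_one k).symm
      _ = (k * p) * (Nat.gcdA p q : ℤ) + (k * q) * (Nat.gcdB p q : ℤ) := by rw [hb']; ring
      _ = 0 := by rw [h0.1, h0.2]; ring
  · funext i
    rw [Subsingleton.elim i 0]
    have hp' := congrArg (Nat.cast : ℕ → ZMod d) hp
    have hq' := congrArg (Nat.cast : ℕ → ZMod d) hq
    rw [ZMod.natCast_zmod_val, Nat.cast_mul] at hp' hq'
    simp only [Pi.smul_apply, Prod.smul_mk, smul_eq_mul]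
    rw [mul_comm, ← hp', mul_comm, ← hq']

lemma weyl_pow (a : Phase d n) (k : ℕ) :
    ∃ c : ZMod d, weyl a ^ k = χ c • weyl ((k : ZMod d) • a) := by
  induction k with
  | zero => exact ⟨0, by simp [weyl_zero]⟩
  | succ k ih =>
    obtain ⟨c, hc⟩ := ih
    refine ⟨c + -(pos ((k : ZMod d) • a) ⬝ᵥ mom a), ?_⟩
    rw [pow_succ, hc, Matrix.smul_mul, weyl_mul, smul_smul, ← chi_add, Nat.cast_succ, add_smul,
      one_smul]

/-- The powers of a Weyl operator, rescaled to be a representation of `ZMod d`. -/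
lemma exists_isCyclicRep (a : Phase d n) :
    ∃ (u : ZMod d → Op d n) (c : ℂ), IsCyclicRep u ∧ c ≠ 0 ∧ u 1 = c • weyl a ∧
      ∀ j, ∃ c' : ℂ, c' ≠ 0 ∧ u j = c' • weyl (j • a) := by
  -- The `d`-th power of `weyl a` is the phase `χ s`; rescaling by a `d`-th root `z` of its inverse
  -- gives a unitary whose `d`-th power is `1`.
  obtain ⟨s, hs⟩ := weyl_pow a d
  rw [ZMod.natCast_self, zero_smul, weyl_zero] at hs
  obtain ⟨z, hz⟩ := IsAlgClosed.exists_pow_nat_eq (χ (-s)) (NeZero.pos d)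
  have hz0 : z ≠ 0 := by
    rintro rfl
    rw [zero_pow (NeZero.ne d)] at hz
    exact chi_ne_zero _ hz.symm
  have hzz : z * star z = 1 := by
    have h1 : ‖z‖ ^ d = 1 := by
      rw [← norm_pow, hz, ZMod.stdAddChar_apply, Circle.norm_coe]
    have h2 : ‖z‖ = 1 := (pow_eq_one_iff_of_nonneg (norm_nonneg _) (NeZero.ne d)).1 h1
    rw [Complex.star_def, Complex.mul_conj, Complex.normSq_eq_norm_sq, h2]
    simp
  set U := z • weyl a with hU
  have hUd : U ^ d = 1 := by
    rw [hU, smul_pow, hz, hs, smul_smul, ← chi_add]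
    simp
  have hUU : U * Uᴴ = 1 := by
    rw [hU, Matrix.conjTranspose_smul, Matrix.smul_mul, Matrix.mul_smul, smul_smul, hzz,
      weyl_mul_conjTranspose, one_smul]
  have hUU' : Uᴴ * U = 1 := mul_eq_one_comm.1 hUU
  have hadd : ∀ i j : ZMod d, U ^ (i + j).val = U ^ i.val * U ^ j.val := by
    intro i j
    rw [ZMod.val_add, ← pow_eq_pow_mod _ hUd, pow_add]
  refine ⟨fun j => U ^ j.val, z, ⟨by simp, hadd, fun j => ?_⟩, hz0, ?_, fun j => ?_⟩
  · have h1 : (U ^ j.val)ᴴ * U ^ j.val = 1 := by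
      have : U ∈ Matrix.unitaryGroup (Config d n) ℂ := Matrix.mem_unitaryGroup_iff.2 hUU
      exact Matrix.mem_unitaryGroup_iff'.1 (pow_mem this _)
    have h2 : U ^ j.val * U ^ (-j).val = 1 := by rw [← hadd]; simp
    exact left_inv_eq_right_inv h1 h2
  · change U ^ (1 : ZMod d).val = U
    conv_rhs => rw [← pow_one U, pow_eq_pow_mod 1 hUd]
    rw [← ZMod.val_natCast, Nat.cast_one]
  · obtain ⟨c, hc⟩ := weyl_pow a j.val
    refine ⟨z ^ j.val * χ c, mul_ne_zero (pow_ne_zero _ hz0) (chi_ne_zero c), ?_⟩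
    change U ^ j.val = _
    rw [hU, smul_pow, hc, smul_smul, ZMod.natCast_zmod_val]

lemma IsFree.trace_eq_zero {v : Phase d n} (hv : IsFree v) {j : ZMod d} (hj : j ≠ 0) (c : ℂ) :
    (c • weyl (j • v)).trace = 0 := by
  rw [Matrix.trace_smul, trace_weyl, if_neg (fun h => hj (hv j h)), smul_zero]

/-- The pure stabilizer states of one qudit which are eigenstates of a Weyl operator with simple
spectrum. -/
def IsSharp (Q : Op d 1) : Prop :=
  (∃ (a : Phase d 1) (z : ℂ), IsSpectralProjector a z Q) ∧
    ∃ ψ : Config d 1 → ℂ, IsStabilizerVector ψ ∧ Q = Matrix.vecMulVec ψ (star ψ)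

/-- On a free line every `u j` with `j ≠ 0` is traceless, so each isotypic projector has trace `d⁻¹
* d = 1` and hence rank one. -/
lemma IsCyclicRep.isSharp {u : ZMod d → Op d 1} (hu : IsCyclicRep u) {v : Phase d 1}
    (hv : IsFree v) (huv : ∀ j, ∃ c : ℂ, c ≠ 0 ∧ u j = c • weyl (j • v)) (k : ZMod d) :
    IsSharp (isoProj u k) := by
  have htr : (isoProj u k).trace = 1 := by
    rw [hu.trace_isoProj, pow_one, inv_mul_cancel₀ natCast_dim_ne_zero]
    intro j hj
    obtain ⟨c, -, hc⟩ := huv j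
    rw [hc, hv.trace_eq_zero hj]
  obtain ⟨c, hc, h1⟩ := huv 1
  rw [one_smul] at h1
  have hsp := hu.isSpectralProjector hc h1 (k := k) (z := c⁻¹ * χ k)
    (by rw [mul_inv_cancel_left₀ hc]) (by
      intro h0; rw [h0, Matrix.trace_zero] at htr; exact zero_ne_one htr)
  exact ⟨⟨_, _, hsp⟩, hsp.exists_stabilizerVector htr⟩

/-- Each Weyl operator lies on a free line and is a combination of the spectral projectors of that
line. -/
lemma span_isSharp : Submodule.span ℂ {Q : Op d 1 | IsSharp Q} = ⊤ := by
  rw [eq_top_iff, ← span_weyl, Submodule.span_le]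
  rintro _ ⟨a, rfl⟩
  obtain ⟨v, j, hv, rfl⟩ := exists_isFree a
  obtain ⟨u, -, hu, -, -, huv⟩ := exists_isCyclicRep v
  obtain ⟨c, hc, hj⟩ := huv j
  have : weyl (j • v) = c⁻¹ • u j := by rw [hj, smul_smul, inv_mul_cancel₀ hc, one_smul]
  rw [SetLike.mem_coe, this, hu.eq_sum_isoProj]
  exact Submodule.smul_mem _ _ (Submodule.sum_mem _ fun k _ => Submodule.smul_mem _ _
    (Submodule.subset_span (hu.isSharp hv huv k)))

end Spectral

/-! ## Parallel composition -/

section ParMatrix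

variable {α R : Type*} [CommRing R] {n m k n' m' k' : ℕ}

/-- Parallel composition of matrices as a bilinear map. -/
def parMatrixₗ (α R : Type*) [CommRing R] (n m n' m' : ℕ) :
    Matrix (Fin m → α) (Fin n → α) R →ₗ[R] Matrix (Fin m' → α) (Fin n' → α) R →ₗ[R]
      Matrix (Fin (m + m') → α) (Fin (n + n') → α) R :=
  LinearMap.mk₂ R parMatrix
    (fun A A' B => by ext; exact add_mul _ _ _)
    (fun c A B => by ext; exact mul_assoc _ _ _)
    (fun A B B' => by ext; exact mul_add _ _ _)
    (fun c A B => by ext; exact mul_left_comm _ _ _)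

lemma parMatrixₗ_apply (A : Matrix (Fin m → α) (Fin n → α) R)
    (B : Matrix (Fin m' → α) (Fin n' → α) R) :
    parMatrixₗ α R n m n' m' A B = parMatrix A B := rfl

lemma parMatrix_apply (A : Matrix (Fin m → α) (Fin n → α) R)
    (B : Matrix (Fin m' → α) (Fin n' → α) R) (u : Fin (m + m') → α) (v : Fin (n + n') → α) :
    parMatrix A B u v =
      A (u ∘ Fin.castAdd m') (v ∘ Fin.castAdd n') * B (u ∘ Fin.natAdd m) (v ∘ Fin.natAdd n) := rfl

lemma append_comp_eq (u : Fin (n + n') → α) :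
    Fin.append (u ∘ Fin.castAdd n') (u ∘ Fin.natAdd n) = u := Fin.append_castAdd_natAdd

lemma append_comp_castAdd (u : Fin n → α) (v : Fin n' → α) :
    Fin.append u v ∘ Fin.castAdd n' = u := by ext i; simp

lemma append_comp_natAdd (u : Fin n → α) (v : Fin n' → α) :
    Fin.append u v ∘ Fin.natAdd n = v := by ext i; simp

/-- Sums over strings are double sums over their two parts. -/
lemma sum_append [Fintype α] {M : Type*} [AddCommMonoid M] (f : (Fin (n + n') → α) → M) :
    ∑ u, f u = ∑ x : Fin n → α, ∑ y : Fin n' → α, f (Fin.append x y) := by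
  rw [← Fintype.sum_prod_type', ← Equiv.sum_comp (Fin.appendEquiv n n')]
  rfl

lemma parMatrix_mul [Fintype α] (A : Matrix (Fin k → α) (Fin m → α) R)
    (B : Matrix (Fin m → α) (Fin n → α) R) (A' : Matrix (Fin k' → α) (Fin m' → α) R)
    (B' : Matrix (Fin m' → α) (Fin n' → α) R) :
    parMatrix (A * B) (A' * B') = parMatrix A A' * parMatrix B B' := by
  ext u v
  simp only [parMatrix_apply, Matrix.mul_apply, sum_append, append_comp_castAdd,
    append_comp_natAdd, Finset.sum_mul_sum]
  refine Finset.sum_congr rfl fun x _ => Finset.sum_congr rfl fun y _ => ?_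
  ring

lemma parMatrix_one [DecidableEq α] :
    parMatrix (1 : Matrix (Fin n → α) (Fin n → α) R) (1 : Matrix (Fin n' → α) (Fin n' → α) R) =
      1 := by
  ext u v
  rw [parMatrix_apply]
  by_cases h : u = v
  · subst h; simp
  · have : ¬ (u ∘ Fin.castAdd n' = v ∘ Fin.castAdd n' ∧ u ∘ Fin.natAdd n = v ∘ Fin.natAdd n) := by
      rintro ⟨h1, h2⟩
      exact h (by rw [← append_comp_eq u, ← append_comp_eq v, h1, h2])
    rw [not_and_or] at this
    rw [Matrix.one_apply_ne h]
    rcases this with h1 | h1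
    · rw [Matrix.one_apply_ne h1, zero_mul]
    · rw [Matrix.one_apply_ne h1, mul_zero]

lemma trace_parMatrix [Fintype α] (A : Matrix (Fin n → α) (Fin n → α) R)
    (B : Matrix (Fin n' → α) (Fin n' → α) R) :
    (parMatrix A B).trace = A.trace * B.trace := by
  simp only [Matrix.trace, Matrix.diag, sum_append, parMatrix_apply, append_comp_castAdd,
    append_comp_natAdd, Finset.sum_mul_sum]

lemma wireMatrix_one [DecidableEq α] :
    wireMatrix α R (1 : Equiv.Perm (Fin n)) = 1 := by
  ext u v
  simp [wireMatrix, Matrix.one_apply]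

end ParMatrix

section SuperTensor

variable {d : ℕ} [NeZero d] {n m k n' m' k' : ℕ}

lemma single_append (x y : Config d n) (x' y' : Config d n') :
    Matrix.single (Fin.append x x') (Fin.append y y') (1 : ℂ) =
      parMatrix (Matrix.single x y 1) (Matrix.single x' y' 1) := by
  ext u v
  rw [parMatrix_apply, Matrix.single_apply, Matrix.single_apply, Matrix.single_apply]
  have h : (Fin.append x x' = u ∧ Fin.append y y' = v) ↔
      (x = u ∘ Fin.castAdd n' ∧ y = v ∘ Fin.castAdd n') ∧
        (x' = u ∘ Fin.natAdd n ∧ y' = v ∘ Fin.natAdd n) := by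
    constructor
    · rintro ⟨rfl, rfl⟩
      simp only [append_comp_castAdd, append_comp_natAdd, and_self]
    · rintro ⟨⟨rfl, rfl⟩, rfl, rfl⟩
      simp only [append_comp_eq, and_self]
  simp only [h]
  split_ifs <;> simp_all

/-- Linear maps which agree on product operators are equal. -/
lemma linearMap_ext_par {V : Type*} [AddCommGroup V] [Module ℂ V] {f g : Op d (n + n') →ₗ[ℂ] V}
    (h : ∀ (A : Op d n) (B : Op d n'), f (parMatrix A B) = g (parMatrix A B)) : f = g := by
  refine Matrix.ext_linearMap _ fun u v => LinearMap.ext_ring ?_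
  change f (Matrix.single u v 1) = g (Matrix.single u v 1)
  rw [← append_comp_eq u, ← append_comp_eq v, single_append, h]

lemma linearMap_apply_eq_sum {V : Type*} [AddCommGroup V] [Module ℂ V] (f : Op d n →ₗ[ℂ] V)
    (A : Op d n) : f A = ∑ x, ∑ y, A x y • f (Matrix.single x y 1) := by
  conv_lhs => rw [Matrix.matrix_eq_sum_single A]
  simp only [map_sum]
  refine Finset.sum_congr rfl fun x _ => Finset.sum_congr rfl fun y _ => ?_
  rw [← map_smul, Matrix.smul_single, smul_eq_mul, mul_one]

lemma superTensor_apply_par (T : SuperOp d n m) (T' : SuperOp d n' m') (A : Op d n) (B : Op d n') :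
    superTensor T T' (parMatrix A B) = parMatrix (T A) (T' B) := by
  rw [linearMap_apply_eq_sum T A, linearMap_apply_eq_sum T' B]
  change _ = parMatrixₗ (ZMod d) ℂ m m m' m' _ _
  rw [LinearMap.map_sum₂]
  refine Finset.sum_congr rfl fun x _ => ?_
  rw [LinearMap.map_sum₂]
  refine Finset.sum_congr rfl fun y _ => ?_
  rw [map_sum]
  refine Finset.sum_congr rfl fun x' _ => ?_
  rw [map_sum]
  refine Finset.sum_congr rfl fun y' _ => ?_
  rw [map_smul, map_smul, LinearMap.smul_apply, smul_smul, parMatrix_apply, append_comp_castAdd,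
    append_comp_castAdd, append_comp_natAdd, append_comp_natAdd, parMatrixₗ_apply, mul_comm]

lemma superTensor_comp (S : SuperOp d m k) (T : SuperOp d n m) (S' : SuperOp d m' k')
    (T' : SuperOp d n' m') :
    superTensor (S ∘ₗ T) (S' ∘ₗ T') = superTensor S S' ∘ₗ superTensor T T' :=
  linearMap_ext_par fun A B => by
    simp only [superTensor_apply_par, LinearMap.comp_apply]

lemma superTensor_id :
    superTensor (LinearMap.id : SuperOp d n n) (LinearMap.id : SuperOp d n' n') = LinearMap.id :=
  linearMap_ext_par fun A B => by
    simp only [superTensor_apply_par, LinearMap.id_apply]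

/-- The tensor product of superoperators as a bilinear map over the reals. -/
def superTensorₗ (d : ℕ) [NeZero d] (n m n' m' : ℕ) :
    SuperOp d n m →ₗ[ℝ] SuperOp d n' m' →ₗ[ℝ] SuperOp d (n + n') (m + m') :=
  LinearMap.mk₂ ℝ superTensor
    (fun T S T' => linearMap_ext_par fun A B => by
      simp only [superTensor_apply_par, LinearMap.add_apply]
      ext; exact add_mul _ _ _)
    (fun c T T' => linearMap_ext_par fun A B => by
      simp only [superTensor_apply_par, LinearMap.smul_apply]
      ext
      simp only [parMatrix_apply, Matrix.smul_apply, smul_mul_assoc])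
    (fun T T' S' => linearMap_ext_par fun A B => by
      simp only [superTensor_apply_par, LinearMap.add_apply]
      ext; exact mul_add _ _ _)
    (fun c T T' => linearMap_ext_par fun A B => by
      simp only [superTensor_apply_par, LinearMap.smul_apply]
      ext
      simp only [parMatrix_apply, Matrix.smul_apply, mul_smul_comm])

@[simp] lemma conjBy_apply (A M : Op d n) : conjBy A M = A * M * Aᴴ := rfl

lemma conjBy_one : conjBy (1 : Op d n) = LinearMap.id := by
  ext1 M; simp

lemma conjBy_mul (A B : Op d n) : conjBy (A * B) = conjBy A ∘ₗ conjBy B := by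
  ext1 M; simp [Matrix.mul_assoc, Matrix.conjTranspose_mul]

lemma discardOp_apply (M : Op d n) : discardOp d n M = M.trace • 1 := rfl

lemma prepare_apply (ψ : Config d n → ℂ) (M : Op d 0) :
    prepare ψ M = M ![] ![] • Matrix.vecMulVec ψ (star ψ) := rfl

lemma op_zero_eq (M : Op d 0) : M = M ![] ![] • (1 : Op d 0) := by
  ext x y
  rw [Subsingleton.elim x ![], Subsingleton.elim y ![]]
  simp

lemma superOp_zero_eq (T : SuperOp d 0 0) : T = scalar T • LinearMap.id := by
  ext1 M
  rw [op_zero_eq M, map_smul, op_zero_eq (T 1)]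
  rw [LinearMap.smul_apply, LinearMap.id_apply, smul_comm]
  rfl

end SuperTensor

/-! ## Processes -/

section Processes

variable {d : ℕ} [NeZero d] {N : ℕ∞} {n m k n' m' : ℕ}

lemma Proc.le (P : Proc d N n m) : (n : ℕ∞) ≤ N ∧ (m : ℕ∞) ≤ N := by
  induction P with
  | prep hn => exact ⟨by simp, hn⟩
  | gate hn => exact ⟨hn, hn⟩
  | meas hn => exact ⟨hn, hn⟩
  | discard hn => exact ⟨hn, by simp⟩
  | wires hn => exact ⟨hn, hn⟩
  | seq S T hS hT => exact ⟨hT.1, hS.2⟩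
  | par hn hm => exact ⟨hn, hm⟩
  | mix p hp hp' T T' hT _ => exact hT

lemma IsProcess.le {T : SuperOp d n m} (h : IsProcess N T) : (n : ℕ∞) ≤ N ∧ (m : ℕ∞) ≤ N := by
  obtain ⟨P, -⟩ := h
  exact P.le

lemma IsProcess.comp {S : SuperOp d m k} {T : SuperOp d n m} (hS : IsProcess N S)
    (hT : IsProcess N T) : IsProcess N (S ∘ₗ T) := by
  obtain ⟨P, rfl⟩ := hS
  obtain ⟨Q, rfl⟩ := hT
  exact ⟨P.seq Q, rfl⟩

lemma IsProcess.par {T : SuperOp d n m} {T' : SuperOp d n' m'} (hT : IsProcess N T)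
    (hT' : IsProcess N T') (hn : ((n + n' : ℕ) : ℕ∞) ≤ N) (hm : ((m + m' : ℕ) : ℕ∞) ≤ N) :
    IsProcess N (superTensor T T') := by
  obtain ⟨P, rfl⟩ := hT
  obtain ⟨Q, rfl⟩ := hT'
  exact ⟨Proc.par hn hm P Q, rfl⟩

lemma IsProcess.mix {T T' : SuperOp d n m} (hT : IsProcess N T) (hT' : IsProcess N T') {p : ℝ}
    (hp : 0 ≤ p) (hp' : p ≤ 1) : IsProcess N ((p : ℂ) • T + ((1 - p : ℝ) : ℂ) • T') := by
  obtain ⟨P, rfl⟩ := hT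
  obtain ⟨Q, rfl⟩ := hT'
  exact ⟨Proc.mix p hp hp' P Q, rfl⟩

lemma isProcess_wires (hn : (n : ℕ∞) ≤ N) (σ : Equiv.Perm (Fin n)) :
    IsProcess N (conjBy (d := d) (wireMatrix (ZMod d) ℂ σ)) := ⟨Proc.wires hn σ, rfl⟩

lemma isProcess_id (hn : (n : ℕ∞) ≤ N) : IsProcess N (LinearMap.id : SuperOp d n n) := by
  have := isProcess_wires (d := d) hn 1
  rwa [wireMatrix_one, conjBy_one] at this

lemma isProcess_discard (hn : (n : ℕ∞) ≤ N) : IsProcess N (discardOp d n) :=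
  ⟨Proc.discard hn, rfl⟩

lemma isProcess_gate (hn : (n : ℕ∞) ≤ N) {U : Op d n} (hU : IsClifford U) :
    IsProcess N (conjBy U) := ⟨Proc.gate hn U hU, rfl⟩

lemma isProcess_meas (hn : (n : ℕ∞) ≤ N) {a : Phase d n} {z : ℂ} {P : Op d n}
    (hP : IsSpectralProjector a z P) : IsProcess N (conjBy P) := ⟨Proc.meas hn a z P hP, rfl⟩

lemma isProcess_prepare (hn : (n : ℕ∞) ≤ N) {ψ : Config d n → ℂ} (hψ : IsStabilizerVector ψ) :
    IsProcess N (prepare ψ) := ⟨Proc.prep hn ψ hψ, rfl⟩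

/-- The state preparation with density operator `Q`. -/
def stateOp (Q : Op d n) : SuperOp d 0 n := (LinearMap.toSpanSingleton ℂ _ Q) ∘ₗ
  (Matrix.traceLinearMap (Config d 0) ℂ ℂ)

/-- The effect `M ↦ tr (Q M)`. -/
def effectOp (Q : Op d n) : SuperOp d n 0 := discardOp d n ∘ₗ LinearMap.mulLeft ℂ Q

lemma stateOp_apply (Q : Op d n) (M : Op d 0) : stateOp Q M = M ![] ![] • Q := by
  have : M.trace = M ![] ![] := by
    rw [op_zero_eq M, Matrix.trace_smul, Matrix.trace_one]
    simp
  simp [stateOp, this]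

lemma effectOp_apply (Q M : Op d n) : effectOp Q M = (Q * M).trace • 1 := rfl

lemma isProcess_stateOp (hN : 1 ≤ N) {Q : Op d 1} (hQ : IsSharp Q) : IsProcess N (stateOp Q) := by
  obtain ⟨-, ψ, hψ, rfl⟩ := hQ
  convert isProcess_prepare (N := N) (by exact_mod_cast hN) hψ using 1
  ext1 M
  rw [stateOp_apply, prepare_apply]

lemma isProcess_effectOp (hN : 1 ≤ N) {Q : Op d 1} (hQ : IsSharp Q) :
    IsProcess N (effectOp Q) := by
  obtain ⟨⟨a, z, hz⟩, -⟩ := hQ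
  convert (isProcess_discard (d := d) (n := 1) (N := N) (by exact_mod_cast hN)).comp
    (isProcess_meas (by exact_mod_cast hN) hz) using 1
  ext1 M
  rw [LinearMap.comp_apply, effectOp_apply, discardOp_apply, conjBy_apply, hz.isHermitian.eq,
    Matrix.trace_mul_comm (Q * M), ← mul_assoc, hz.idempotent]

/-- The measure-and-prepare processes which pass through the trivial system. -/
def factoring (d : ℕ) [NeZero d] (N : ℕ∞) (n : ℕ) : Set (SuperOp d n n) :=
  {T | ∃ (S : SuperOp d 0 n) (E : SuperOp d n 0), IsProcess N S ∧ IsProcess N E ∧ T = S ∘ₗ E}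

/-- A Hermiticity-preserving superoperator in the complex span of Hermiticity-preserving
superoperators is in their real span. -/
lemma mem_span_real_of_mem_span_complex {X : Set (SuperOp d n m)}
    (hX : ∀ T ∈ X, ∀ M, T Mᴴ = (T M)ᴴ) {T : SuperOp d n m} (hT : ∀ M, T Mᴴ = (T M)ᴴ)
    (h : T ∈ Submodule.span ℂ X) : T ∈ Submodule.span ℝ X := by
  have h1 : ∀ T ∈ Submodule.span ℝ X, ∀ M, T Mᴴ = (T M)ᴴ := by
    intro T hT
    induction hT using Submodule.span_induction with
    | mem T hT => exact hX T hT
    | zero => intro M; simp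
    | add T T' _ _ h h' => intro M; simp [h, h', Matrix.conjTranspose_add]
    | smul c T _ h => intro M; simp [h, Matrix.conjTranspose_smul]
  -- Split `T = A + i B` with `A` and `B` in the real span. As `T` and `A` preserve Hermiticity, so
  -- does `i B`; as `B` does too, `B` vanishes.
  have h2 : ∃ A ∈ Submodule.span ℝ X, ∃ B ∈ Submodule.span ℝ X, T = A + Complex.I • B := by
    clear hT
    induction h using Submodule.span_induction with
    | mem T hT => exact ⟨T, Submodule.subset_span hT, 0, Submodule.zero_mem _, by simp⟩
    | zero => exact ⟨0, Submodule.zero_mem _, 0, Submodule.zero_mem _, by simp⟩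
    | add T T' _ _ h h' =>
      obtain ⟨A, hA, B, hB, rfl⟩ := h
      obtain ⟨A', hA', B', hB', rfl⟩ := h'
      exact ⟨A + A', Submodule.add_mem _ hA hA', B + B', Submodule.add_mem _ hB hB', by
        rw [smul_add]; abel⟩
    | smul c T _ h =>
      obtain ⟨A, hA, B, hB, rfl⟩ := h
      refine ⟨c.re • A - c.im • B, Submodule.sub_mem _ (Submodule.smul_mem _ _ hA)
        (Submodule.smul_mem _ _ hB), c.re • B + c.im • A, Submodule.add_mem _
        (Submodule.smul_mem _ _ hB) (Submodule.smul_mem _ _ hA), ?_⟩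
      have hre : ∀ (x : ℝ) (S : SuperOp d n m), x • S = (x : ℂ) • S := fun x S => by
        ext1 M; simp
      simp only [hre]
      conv_lhs => rw [← Complex.re_add_im c]
      simp only [smul_add, add_smul, smul_smul]
      have h3 : ((c.re : ℂ) + c.im * Complex.I) * Complex.I = c.re * Complex.I - c.im := by
        linear_combination (c.im : ℂ) * Complex.I_mul_I
      rw [h3]
      module
  obtain ⟨A, hA, B, hB, rfl⟩ := h2
  have h3 : B = 0 := by
    ext1 M
    have h4 := hT Mᴴ
    simp only [LinearMap.add_apply, LinearMap.smul_apply, Matrix.conjTranspose_add,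
      Matrix.conjTranspose_smul, h1 A hA, h1 B hB, Matrix.conjTranspose_conjTranspose,
      add_right_inj, Complex.star_def, Complex.conj_I] at h4
    have h5 : (2 * Complex.I) • B M = 0 := by
      rw [neg_smul, ← sub_eq_zero, sub_neg_eq_add, ← two_smul ℂ, smul_smul] at h4
      exact h4
    exact (smul_eq_zero.1 h5).resolve_left (by simp)
  rw [h3, smul_zero, add_zero]
  exact hA

/-- The superoperators `M ↦ tr (A M) B` with `A` and `B` sharp are measure-and-prepare processes.
Sharp projectors span all operators over `ℂ`, so these contain the identity in their complex span,
and Hermiticity brings it into the real span. -/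
lemma id_mem_span_one (hN : 1 ≤ N) :
    (LinearMap.id : SuperOp d 1 1) ∈ Submodule.span ℝ (factoring d N 1) := by
  let r : Op d 1 →ₗ[ℂ] Op d 1 →ₗ[ℂ] SuperOp d 1 1 := LinearMap.mk₂ ℂ
    (fun A B => stateOp B ∘ₗ effectOp A)
    (fun A A' B => by
      ext1 M
      simp [stateOp_apply, effectOp_apply, add_mul, Matrix.trace_add, add_smul])
    (fun c A B => by
      ext1 M
      simp [stateOp_apply, effectOp_apply, mul_smul])
    (fun A B B' => by
      ext1 M
      simp [stateOp_apply, effectOp_apply])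
    (fun c A B => by
      ext1 M
      simp [stateOp_apply, effectOp_apply, smul_smul, mul_comm])
  let X : Set (SuperOp d 1 1) := Set.image2 (fun A B => r A B) {Q | IsSharp Q} {Q | IsSharp Q}
  have hX : X ⊆ factoring d N 1 := by
    rintro _ ⟨A, hA, B, hB, rfl⟩
    exact ⟨_, _, isProcess_stateOp hN hB, isProcess_effectOp hN hA, rfl⟩
  have hherm : ∀ Q : Op d 1, IsSharp Q → Qᴴ = Q := by
    rintro Q ⟨⟨a, z, h⟩, -⟩
    exact h.isHermitian
  refine Submodule.span_mono hX (mem_span_real_of_mem_span_complex ?_ (fun M => rfl) ?_)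
  · rintro _ ⟨A, hA, B, hB, rfl⟩ M
    simp only [r, LinearMap.mk₂_apply, LinearMap.comp_apply, effectOp_apply, stateOp_apply,
      Matrix.smul_apply, Matrix.one_apply_eq, smul_eq_mul, mul_one, Matrix.conjTranspose_smul]
    rw [hherm B hB, ← Matrix.trace_conjTranspose, Matrix.conjTranspose_mul, hherm A hA,
      Matrix.trace_mul_comm]
  · have hspan : ∀ A B : Op d 1, r A B ∈ Submodule.span ℂ X := by
      intro A B
      have := Submodule.apply_mem_map₂ r (p := Submodule.span ℂ {Q : Op d 1 | IsSharp Q})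
        (q := Submodule.span ℂ {Q : Op d 1 | IsSharp Q}) (m := A) (n := B)
        (by rw [span_isSharp]; trivial) (by rw [span_isSharp]; trivial)
      rwa [Submodule.map₂_span_span] at this
    have hid : (LinearMap.id : SuperOp d 1 1) =
        ∑ x, ∑ y, r (Matrix.single y x 1) (Matrix.single x y 1) := by
      ext1 M
      simp only [LinearMap.sum_apply, r, LinearMap.mk₂_apply, LinearMap.comp_apply, effectOp_apply,
        stateOp_apply, Matrix.smul_apply, Matrix.one_apply_eq, smul_eq_mul, mul_one,
        LinearMap.id_apply]
      conv_lhs => rw [Matrix.matrix_eq_sum_single M]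
      refine Finset.sum_congr rfl fun x _ => Finset.sum_congr rfl fun y _ => ?_
      rw [Matrix.trace_single_mul, Matrix.smul_single]
      simp
    rw [hid]
    exact Submodule.sum_mem _ fun x _ => Submodule.sum_mem _ fun y _ => hspan _ _

/-- Local tomography: identity wires are real combinations of measure-and-prepare processes. -/
lemma id_mem_span (hN : 1 ≤ N) (n : ℕ) (hn : (n : ℕ∞) ≤ N) :
    (LinearMap.id : SuperOp d n n) ∈ Submodule.span ℝ (factoring d N n) := by
  induction n with
  | zero =>
    exact Submodule.subset_span ⟨LinearMap.id, LinearMap.id, isProcess_id hn, isProcess_id hn, rfl⟩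
  | succ n ih =>
    have hn' : (n : ℕ∞) ≤ N := le_trans (by exact_mod_cast Nat.le_succ n) hn
    have h0 : ((0 + 0 : ℕ) : ℕ∞) ≤ N := by simp
    rw [← superTensor_id]
    have := Submodule.apply_mem_map₂ (superTensorₗ d n n 1 1) (ih hn') (id_mem_span_one hN)
    rw [Submodule.map₂_span_span] at this
    refine Submodule.span_mono ?_ this
    rintro _ ⟨_, ⟨S, E, hS, hE, rfl⟩, _, ⟨S', E', hS', hE', rfl⟩, rfl⟩
    exact ⟨superTensor S S', superTensor E E', hS.par hS' h0 hn, hE.par hE' hn h0,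
      superTensor_comp _ _ _ _⟩

end Processes

/-! ## Nonnegative representations and their frames -/

/-- Diagram-preserving nonnegative representations of the processes of the subtheory. -/
structure PosRep (d : ℕ) [NeZero d] (N : ℕ∞) (Λ : Type u) [Fintype Λ] where
  /-- the real matrix which represents a process -/
  map : ∀ {n m : ℕ}, SuperOp d n m → Matrix (Fin m → Λ) (Fin n → Λ) ℝ
  map_seq : ∀ {n m k : ℕ} (S : SuperOp d m k) (T : SuperOp d n m),
    IsProcess N S → IsProcess N T → map (S ∘ₗ T) = map S * map T
  map_par : ∀ {n m n' m' : ℕ} (T : SuperOp d n m) (T' : SuperOp d n' m'),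
    ((n + n' : ℕ) : ℕ∞) ≤ N → ((m + m' : ℕ) : ℕ∞) ≤ N → IsProcess N T → IsProcess N T' →
      map (superTensor T T') = parMatrix (map T) (map T')
  map_id : ∀ {n : ℕ}, (n : ℕ∞) ≤ N →
    map (LinearMap.id : SuperOp d n n) = wireMatrix Λ ℝ 1
  map_discard : ∀ {n : ℕ}, (n : ℕ∞) ≤ N → map (discardOp d n) = Matrix.of fun _ _ => 1
  map_scalar : ∀ T : SuperOp d 0 0, IsProcess N T → ((map T ![] ![] : ℝ) : ℂ) = scalar T
  map_mix : ∀ {n m : ℕ} (p : ℝ) (T T' : SuperOp d n m), 0 ≤ p → p ≤ 1 →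
    IsProcess N T → IsProcess N T' →
      map ((p : ℂ) • T + ((1 - p : ℝ) : ℂ) • T') = p • map T + (1 - p) • map T'
  nonneg : ∀ {n m : ℕ} (T : SuperOp d n m), IsProcess N T →
    ∀ (l' : Fin m → Λ) (l : Fin n → Λ), 0 ≤ map T l' l

section Constructions

variable {d : ℕ} [NeZero d] {N : ℕ∞} {Λ : Type u} [Fintype Λ] {n m : ℕ}

/-- A nonnegative quasiprobability representation is a nonnegative representation. -/
def QuasiRep.toPosRep (R : QuasiRep d N Λ) (hR : R.Nonneg) : PosRep d N Λ where
  map := R.map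
  map_seq := R.map_seq
  map_par := R.map_par
  map_id hn := by
    rw [← R.map_wires 1 hn, wireMatrix_one, conjBy_one]
  map_discard := R.map_discard
  map_scalar := R.map_scalar
  map_mix := R.map_mix
  nonneg T hT l' l := (hR T hT l' l).1

/-- Procedures which realize the same process are operationally equivalent. -/
lemma OpEquiv.of_eval_eq {P Q : Proc d N n m} (h : P.eval = Q.eval) : OpEquiv P Q := by
  intro k hk hn hm S E
  simp only [Proc.eval, h]

open Classical in
/-- The representation of processes by a noncontextual ontological model. -/
def OntModel.processMap (M : OntModel d N Λ) {n m : ℕ} (T : SuperOp d n m) :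
    Matrix (Fin m → Λ) (Fin n → Λ) ℝ :=
  if h : IsProcess N T then M.map h.choose else 0

lemma OntModel.processMap_eval (M : OntModel d N Λ) (hM : M.Noncontextual) (P : Proc d N n m) :
    M.processMap P.eval = M.map P := by
  have h : IsProcess N P.eval := ⟨P, rfl⟩
  rw [OntModel.processMap, dif_pos h]
  exact hM _ _ (OpEquiv.of_eval_eq h.choose_spec)

/-- A noncontextual ontological model is a nonnegative representation. -/
def OntModel.toPosRep (M : OntModel d N Λ) (hM : M.Noncontextual) : PosRep d N Λ where
  map := M.processMap
  map_seq S T hS hT := by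
    obtain ⟨P, rfl⟩ := hS
    obtain ⟨Q, rfl⟩ := hT
    rw [M.processMap_eval hM, M.processMap_eval hM, ← M.map_seq, ← M.processMap_eval hM]
    rfl
  map_par T T' hn hm hT hT' := by
    obtain ⟨P, rfl⟩ := hT
    obtain ⟨Q, rfl⟩ := hT'
    rw [M.processMap_eval hM, M.processMap_eval hM, ← M.map_par hn hm, ← M.processMap_eval hM]
    rfl
  map_id hn := by
    rw [← M.map_wires hn, ← M.processMap_eval hM, Proc.eval, wireMatrix_one, conjBy_one]
  map_discard hn := by
    rw [← M.map_discard hn, ← M.processMap_eval hM]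
    rfl
  map_scalar T hT := by
    obtain ⟨P, rfl⟩ := hT
    rw [M.processMap_eval hM, M.map_scalar]
  map_mix p T T' hp hp' hT hT' := by
    obtain ⟨P, rfl⟩ := hT
    obtain ⟨Q, rfl⟩ := hT'
    rw [M.processMap_eval hM, M.processMap_eval hM, ← M.map_mix p hp hp', ← M.processMap_eval hM]
    rfl
  nonneg T hT l' l := by
    obtain ⟨P, rfl⟩ := hT
    rw [M.processMap_eval hM]
    exact M.nonneg P l' l

end Constructions

/-! ### Linear extension of a representation to the real span of the processes -/

lemma coe_smul_superOp {d : ℕ} [NeZero d] {n m : ℕ} (p : ℝ) (T : SuperOp d n m) :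
    (p : ℂ) • T = p • T := by
  ext1 M; simp

lemma exists_isSharp (d : ℕ) [NeZero d] : ∃ Q : Op d 1, IsSharp Q := by
  obtain ⟨v, -, hv, -⟩ := exists_isFree (0 : Phase d 1)
  obtain ⟨u, -, hu, -, -, huv⟩ := exists_isCyclicRep v
  exact ⟨_, hu.isSharp hv huv 0⟩

/-- Two different outcomes of one sharp measurement in succession are impossible; `d ≠ 1` provides
two outcomes. -/
lemma isProcess_zero {d : ℕ} [NeZero d] {N : ℕ∞} (hN : 1 ≤ N) (hd : d ≠ 1) :
    IsProcess N (0 : SuperOp d 1 1) := by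
  obtain ⟨v, -, hv, -⟩ := exists_isFree (0 : Phase d 1)
  obtain ⟨u, -, hu, -, -, huv⟩ := exists_isCyclicRep v
  obtain ⟨⟨a, z, h⟩, -⟩ := hu.isSharp hv huv 0
  obtain ⟨⟨a', z', h'⟩, -⟩ := hu.isSharp hv huv 1
  have hN' : ((1 : ℕ) : ℕ∞) ≤ N := by exact_mod_cast hN
  have h01 : (0 : ZMod d) ≠ 1 := by
    have : Fact (1 < d) := ⟨by have := NeZero.ne d; omega⟩
    exact zero_ne_one
  have := (isProcess_meas hN' h).comp (isProcess_meas hN' h')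
  rw [← conjBy_mul, hu.isoProj_mul, if_neg h01] at this
  convert this using 1
  ext1 M
  simp

namespace PosRep

variable {d : ℕ} [NeZero d] {N : ℕ∞} {Λ : Type u} [Fintype Λ] {n m : ℕ} (R : PosRep d N Λ)

lemma map_id_eq_one [DecidableEq Λ] (hn : (n : ℕ∞) ≤ N) :
    R.map (LinearMap.id : SuperOp d n n) = 1 := by
  rw [R.map_id hn, wireMatrix_one]

/-- The zero process factors through the scalar `0`, whose representation is fixed by the quantum
probabilities. -/
lemma map_zero (hN : 1 ≤ N) (h : IsProcess N (0 : SuperOp d 1 1)) :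
    R.map (0 : SuperOp d 1 1) = 0 := by
  obtain ⟨Q, hQ⟩ := exists_isSharp d
  have hS := isProcess_stateOp hN hQ
  have hD : IsProcess N (discardOp d 1) := isProcess_discard (by exact_mod_cast hN)
  have hc := (hD.comp (h.comp hS))
  have h1 : R.map (discardOp d 1 ∘ₗ (0 : SuperOp d 1 1) ∘ₗ stateOp Q) = 0 := by
    ext x y
    rw [Subsingleton.elim x ![], Subsingleton.elim y ![], ← Complex.ofReal_inj,
      R.map_scalar _ hc]
    simp [scalar]
  have h2 : (0 : SuperOp d 1 1) =
      stateOp Q ∘ₗ (discardOp d 1 ∘ₗ (0 : SuperOp d 1 1) ∘ₗ stateOp Q) ∘ₗ discardOp d 1 := by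
    ext1 M; simp
  rw [h2, R.map_seq _ _ hS (hc.comp hD), R.map_seq _ _ hc hD, h1, Matrix.zero_mul, Matrix.mul_zero]

/-- Positive combinations of processes are positive multiples of processes, compatibly with the
representation. -/
lemma exists_add_eq {T T' : SuperOp d n m} (hT : IsProcess N T) (hT' : IsProcess N T') {t t' : ℝ}
    (ht : 0 ≤ t) (ht' : 0 ≤ t') :
    ∃ S : SuperOp d n m, IsProcess N S ∧ t • T + t' • T' = (t + t') • S ∧
      t • R.map T + t' • R.map T' = (t + t') • R.map S := by
  rcases (add_nonneg ht ht').eq_or_lt with h | h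
  · have h1 : t = 0 := by linarith
    have h2 : t' = 0 := by linarith
    exact ⟨T, hT, by simp [h1, h2], by simp [h1, h2]⟩
  · have hp : 0 ≤ t / (t + t') := by positivity
    have hp' : t / (t + t') ≤ 1 := (div_le_one h).2 (by linarith)
    refine ⟨_, hT.mix hT' hp hp', ?_, ?_⟩
    · rw [coe_smul_superOp, coe_smul_superOp, smul_add, smul_smul, smul_smul]
      congr 2
      · field_simp
      · field_simp; ring
    · rw [R.map_mix _ _ _ hp hp' hT hT', smul_add, smul_smul, smul_smul]
      congr 2
      · field_simp
      · field_simp; ring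

/-- A subnormalized process is a mixture with the zero process; this supplies the homogeneity that
convexity alone does not give. -/
lemma map_eq_smul (hN : 1 ≤ N) (hd : d ≠ 1) {T S : SuperOp d 1 1} (hS : IsProcess N S) {p : ℝ}
    (hp : 0 ≤ p) (hp' : p ≤ 1) (h : T = p • S) : R.map T = p • R.map S := by
  have h0 := isProcess_zero hN hd
  have := R.map_mix p S 0 hp hp' hS h0
  rwa [R.map_zero hN h0, smul_zero, smul_zero, add_zero, add_zero, coe_smul_superOp, ← h] at this

/-- Dividing by the larger coefficient turns the other one into a probability. -/
lemma smul_map_eq_smul_map (hN : 1 ≤ N) (hd : d ≠ 1) {T S : SuperOp d 1 1} (hT : IsProcess N T)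
    (hS : IsProcess N S) {t s : ℝ} (ht : 0 ≤ t) (hs : 0 ≤ s) (h : t • T = s • S) :
    t • R.map T = s • R.map S := by
  wlog hst : s ≤ t generalizing t s T S
  · exact (this hS hT hs ht h.symm (le_of_not_ge hst)).symm
  rcases ht.eq_or_lt with h0 | h0
  · have h1 : t = 0 := h0.symm
    have h2 : s = 0 := by linarith
    simp [h1, h2]
  · have hT' : T = (s / t) • S := by
      rw [div_eq_inv_mul, mul_smul, ← h, smul_smul, inv_mul_cancel₀ h0.ne', one_smul]
    rw [R.map_eq_smul hN hd hS (by positivity) ((div_le_one h0).2 hst) hT', smul_smul,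
      mul_div_cancel₀ _ h0.ne']

/-- The graph of the linear extension of a representation. -/
def graph (hN : 1 ≤ N) : Submodule ℝ (SuperOp d 1 1 × Matrix (Fin 1 → Λ) (Fin 1 → Λ) ℝ) where
  -- Differences of two multiples of single processes suffice, because mixing merges any nonnegative
  -- combination into one process.
  carrier := {x | ∃ (t s : ℝ) (T S : SuperOp d 1 1), 0 ≤ t ∧ 0 ≤ s ∧ IsProcess N T ∧
    IsProcess N S ∧ x = (t • T - s • S, t • R.map T - s • R.map S)}
  zero_mem' := by
    have := isProcess_id (d := d) (n := 1) (N := N) (by exact_mod_cast hN)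
    exact ⟨0, 0, _, _, le_rfl, le_rfl, this, this, by simp [Prod.zero_eq_mk]⟩
  add_mem' := by
    rintro _ _ ⟨t, s, T, S, ht, hs, hT, hS, rfl⟩ ⟨t', s', T', S', ht', hs', hT', hS', rfl⟩
    obtain ⟨A, hA, hA1, hA2⟩ := R.exists_add_eq hT hT' ht ht'
    obtain ⟨B, hB, hB1, hB2⟩ := R.exists_add_eq hS hS' hs hs'
    refine ⟨t + t', s + s', A, B, add_nonneg ht ht', add_nonneg hs hs', hA, hB, ?_⟩
    rw [← hA1, ← hA2, ← hB1, ← hB2, Prod.mk_add_mk]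
    congr 1 <;> abel
  smul_mem' := by
    rintro c _ ⟨t, s, T, S, ht, hs, hT, hS, rfl⟩
    rcases le_total 0 c with hc | hc
    · refine ⟨c * t, c * s, T, S, by positivity, by positivity, hT, hS, ?_⟩
      simp only [Prod.smul_mk, smul_sub, smul_smul]
    · refine ⟨-c * s, -c * t, S, T, mul_nonneg (by linarith) hs, mul_nonneg (by linarith) ht, hS,
        hT, ?_⟩
      simp only [Prod.smul_mk, smul_sub, smul_smul, neg_mul, neg_smul]
      congr 1 <;> module

lemma mem_graph (hN : 1 ≤ N) {T : SuperOp d 1 1} (hT : IsProcess N T) :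
    (T, R.map T) ∈ R.graph hN := by
  exact ⟨1, 0, T, T, zero_le_one, le_rfl, hT, hT, by simp⟩

/-- This makes the graph single-valued: the linear extension is well defined. -/
lemma eq_zero_of_mem_graph (hN : 1 ≤ N) (hd : d ≠ 1)
    {A : Matrix (Fin 1 → Λ) (Fin 1 → Λ) ℝ} (h : ((0 : SuperOp d 1 1), A) ∈ R.graph hN) : A = 0 := by
  obtain ⟨t, s, T, S, ht, hs, hT, hS, hx⟩ := h
  rw [Prod.mk.injEq] at hx
  rw [hx.2, R.smul_map_eq_smul_map hN hd hT hS ht hs (sub_eq_zero.1 hx.1.symm), sub_self]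

/-- The identity wire and its representation decompose in the same way into states and effects. -/
lemma exists_decomposition [DecidableEq Λ] (hN : 1 ≤ N) :
    ∃ (r : ℕ) (c : Fin r → ℝ) (S : Fin r → SuperOp d 0 1) (E : Fin r → SuperOp d 1 0),
      (∀ i, IsProcess N (S i)) ∧ (∀ i, IsProcess N (E i)) ∧
      LinearMap.id = ∑ i, c i • (S i ∘ₗ E i) ∧ 1 = ∑ i, c i • (R.map (S i) * R.map (E i)) := by
  have hN1 : ((1 : ℕ) : ℕ∞) ≤ N := by exact_mod_cast hN
  have hid := isProcess_id (d := d) (n := 1) hN1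
  -- For `d = 1` the linear extension is not available, as `isProcess_zero` needs two outcomes; but
  -- then a qudit is trivial and its identity wire factors through the trivial system.
  by_cases hd : d = 1
  · obtain ⟨Q, hQ⟩ := exists_isSharp d
    have hS := isProcess_stateOp hN hQ
    have hE : IsProcess N (discardOp d 1) := isProcess_discard hN1
    have h : (LinearMap.id : SuperOp d 1 1) = stateOp Q ∘ₗ discardOp d 1 := by
      obtain ⟨-, ψ, hψ, rfl⟩ := hQ
      have htr := trace_vecMulVec_star hψ.1
      subst hd
      have : Subsingleton (ZMod 1) := inferInstanceAs (Subsingleton (Fin 1))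
      ext1 M
      ext x y
      rw [Matrix.trace, Fintype.sum_subsingleton _ x, Matrix.diag] at htr
      rw [LinearMap.comp_apply, discardOp_apply, stateOp_apply, Matrix.trace,
        Fintype.sum_subsingleton _ x, Subsingleton.elim y x, Matrix.smul_apply, htr]
      simp
    refine ⟨1, fun _ => 1, fun _ => _, fun _ => _, fun _ => hS, fun _ => hE, ?_, ?_⟩
    · simpa using h
    · rw [← R.map_id_eq_one hN1, h, R.map_seq _ _ hS hE]
      simp
  · let X : Set (SuperOp d 1 1 × Matrix (Fin 1 → Λ) (Fin 1 → Λ) ℝ) :=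
      {x | ∃ (S : SuperOp d 0 1) (E : SuperOp d 1 0), IsProcess N S ∧ IsProcess N E ∧
        x = (S ∘ₗ E, R.map S * R.map E)}
    have h1 := id_mem_span (d := d) hN 1 hN1
    have h2 : factoring d N 1 ⊆ (LinearMap.fst ℝ _ _) '' X := by
      rintro _ ⟨S, E, hS, hE, rfl⟩
      exact ⟨_, ⟨S, E, hS, hE, rfl⟩, rfl⟩
    have h3 := Submodule.span_mono (R := ℝ) h2 h1
    rw [← Submodule.map_span, Submodule.mem_map] at h3
    obtain ⟨x, hx, hx1⟩ := h3
    have hXg : Submodule.span ℝ X ≤ R.graph hN := by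
      rw [Submodule.span_le]
      rintro _ ⟨S, E, hS, hE, rfl⟩
      rw [← R.map_seq _ _ hS hE]
      exact R.mem_graph hN (hS.comp hE)
    -- The lifted decomposition and the identity wire lie in the graph over the same superoperator,
    -- so their matrices agree.
    have h4 := Submodule.sub_mem _ (hXg hx) (R.mem_graph hN hid)
    have h5 : x - (LinearMap.id, R.map LinearMap.id) = (0, x.2 - 1) := by
      rw [R.map_id_eq_one hN1]
      refine Prod.ext ?_ rfl
      exact sub_eq_zero.2 hx1
    rw [h5] at h4
    have h6 := sub_eq_zero.1 (R.eq_zero_of_mem_graph hN hd h4)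
    obtain ⟨r, c, g, hg⟩ := Submodule.mem_span_set'.1 hx
    choose S E hS hE hSE using fun i => (g i).2
    refine ⟨r, c, S, E, hS, hE, ?_, ?_⟩
    · rw [← hx1, ← hg, map_sum]
      refine Finset.sum_congr rfl fun i _ => ?_
      rw [hSE i]; rfl
    · rw [← h6, ← hg, Prod.snd_sum]
      refine Finset.sum_congr rfl fun i _ => ?_
      rw [hSE i]; rfl

/-- A linear isomorphism through which a representation acts on the processes of one qudit. -/
structure IsFrame (Φ : Op d 1 ≃ₗ[ℂ] ((Fin 1 → Λ) → ℂ)) : Prop where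
  process : ∀ T : SuperOp d 1 1, IsProcess N T → ∀ M l,
    Φ (T M) l = ∑ l', (R.map T l l' : ℂ) * Φ M l'
  state : ∀ S : SuperOp d 0 1, IsProcess N S → ∀ l, Φ (S 1) l = R.map S l ![]
  effect : ∀ E : SuperOp d 1 0, IsProcess N E → ∀ M,
    E M ![] ![] = ∑ l, (R.map E ![] l : ℂ) * Φ M l

lemma effect_state (E : SuperOp d 1 0) (S : SuperOp d 0 1) (hE : IsProcess N E)
    (hS : IsProcess N S) :
    E (S 1) ![] ![] = ∑ l, (R.map E ![] l : ℂ) * R.map S l ![] := by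
  have := R.map_scalar _ (hE.comp hS)
  rw [R.map_seq _ _ hE hS, Matrix.mul_apply] at this
  push_cast at this
  exact this.symm

/-- Every nonnegative representation has a frame. -/
lemma exists_frame (hN : 1 ≤ N) : ∃ Φ : Op d 1 ≃ₗ[ℂ] ((Fin 1 → Λ) → ℂ), R.IsFrame Φ := by
  classical
  obtain ⟨r, c, S, E, hS, hE, h1, h2⟩ := R.exists_decomposition hN
  -- Tomographic reconstruction of an operator from the effects `E i`; `hδ` is its counterpart for
  -- functions on ontic states, with the same coefficients.
  have hM : ∀ M : Op d 1, M = ∑ i, (c i : ℂ) • (E i M ![] ![] • S i 1) := by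
    intro M
    have := LinearMap.congr_fun h1 M
    rw [LinearMap.id_apply] at this
    rw [LinearMap.sum_apply] at this
    refine this.trans (Finset.sum_congr rfl fun i _ => ?_)
    rw [LinearMap.smul_apply, LinearMap.comp_apply, op_zero_eq (E i M), map_smul, Complex.coe_smul]
    simp
  have hδ : ∀ (v : (Fin 1 → Λ) → ℂ) (l : Fin 1 → Λ),
      ∑ i, (c i : ℂ) * (∑ l', (R.map (E i) ![] l' : ℂ) * v l') * R.map (S i) l ![] = v l := by
    intro v l
    have h3 : ∀ l', ∑ i, (c i : ℂ) * R.map (E i) ![] l' * R.map (S i) l ![] =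
        if l = l' then 1 else 0 := by
      intro l'
      have := congrFun (congrFun h2 l) l'
      rw [Matrix.one_apply, Matrix.sum_apply] at this
      have h4 := congrArg (fun x : ℝ => (x : ℂ)) this
      simp only [apply_ite Complex.ofReal, Complex.ofReal_one, Complex.ofReal_zero,
        Complex.ofReal_sum] at h4
      rw [h4]
      refine Finset.sum_congr rfl fun i _ => ?_
      rw [Matrix.smul_apply, Matrix.mul_apply, Fintype.sum_unique,
        Subsingleton.elim (default : Fin 0 → Λ) ![]]
      simp only [smul_eq_mul]
      push_cast
      ring
    calc _ = ∑ l', (∑ i, (c i : ℂ) * R.map (E i) ![] l' * R.map (S i) l ![]) * v l' := by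
          simp only [Finset.mul_sum, Finset.sum_mul]
          rw [Finset.sum_comm]
          refine Finset.sum_congr rfl fun l' _ => Finset.sum_congr rfl fun i _ => ?_
          ring
      _ = v l := by simp [h3]
  let Φ : Op d 1 →ₗ[ℂ] ((Fin 1 → Λ) → ℂ) :=
    { toFun := fun M l => ∑ i, (c i : ℂ) * E i M ![] ![] * R.map (S i) l ![]
      map_add' := fun M M' => by
        ext l
        simp [mul_add, add_mul, Finset.sum_add_distrib]
      map_smul' := fun z M => by
        ext l
        simp only [map_smul, Matrix.smul_apply, smul_eq_mul, RingHom.id_apply, Pi.smul_apply,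
          Finset.mul_sum]
        refine Finset.sum_congr rfl fun i _ => ?_
        ring }
  have hΦ : ∀ M l, Φ M l = ∑ i, (c i : ℂ) * E i M ![] ![] * R.map (S i) l ![] := fun _ _ => rfl
  have hstate : ∀ S : SuperOp d 0 1, IsProcess N S → ∀ l, Φ (S 1) l = R.map S l ![] := by
    intro T hT l
    rw [hΦ, ← hδ (fun l => R.map T l ![]) l]
    refine Finset.sum_congr rfl fun i _ => ?_
    rw [R.effect_state _ _ (hE i) hT]
  have heffect : ∀ E : SuperOp d 1 0, IsProcess N E → ∀ M,
      E M ![] ![] = ∑ l, (R.map E ![] l : ℂ) * Φ M l := by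
    intro F hF M
    conv_lhs => rw [hM M]
    simp only [map_sum, map_smul, Matrix.sum_apply, Matrix.smul_apply, smul_eq_mul,
      R.effect_state _ _ hF (hS _), hΦ, Finset.mul_sum]
    rw [Finset.sum_comm]
    refine Finset.sum_congr rfl fun l _ => Finset.sum_congr rfl fun i _ => ?_
    ring
  -- The inverse reads a function through the represented effects and prepares the states `S i`; the
  -- two reconstructions make `Φ` and `Ψ` mutually inverse.
  let Ψ : ((Fin 1 → Λ) → ℂ) → Op d 1 := fun v =>
    ∑ i, ((c i : ℂ) * ∑ l, (R.map (E i) ![] l : ℂ) * v l) • S i 1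
  refine ⟨{ Φ with invFun := Ψ, left_inv := fun M => ?_, right_inv := fun v => ?_ },
    fun T hT M l => ?_, hstate, heffect⟩
  · change Ψ (Φ M) = M
    conv_rhs => rw [hM M]
    refine Finset.sum_congr rfl fun i _ => ?_
    rw [← heffect _ (hE i), mul_smul]
  · change Φ (Ψ v) = v
    ext l
    rw [← hδ v l]
    simp only [Ψ, map_sum, map_smul, Finset.sum_apply, Pi.smul_apply, smul_eq_mul,
      hstate _ (hS _)]
  · change Φ (T M) l = ∑ l', (R.map T l l' : ℂ) * Φ M l'
    have h3 : ∀ i, Φ (T (S i 1)) l = ∑ l', (R.map T l l' : ℂ) * R.map (S i) l' ![] := by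
      intro i
      have := hstate _ (hT.comp (hS i)) l
      rw [R.map_seq _ _ hT (hS i), Matrix.mul_apply] at this
      push_cast at this
      exact this
    conv_lhs => rw [hM M]
    simp only [map_sum, map_smul, Finset.sum_apply, Pi.smul_apply, smul_eq_mul, h3]
    simp only [hΦ, Finset.mul_sum]
    rw [Finset.sum_comm]
    refine Finset.sum_congr rfl fun l' _ => Finset.sum_congr rfl fun i _ => ?_
    ring

end PosRep

/-! ## Reversible processes act by permutations -/

/-- Nonnegative matrices which are inverse to each other and stochastic are permutation
matrices. -/
lemma exists_perm_of_mul_eq_one {X : Type*} [Fintype X] [DecidableEq X] {A B : Matrix X X ℝ}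
    (hA : ∀ i j, 0 ≤ A i j) (hB : ∀ i j, 0 ≤ B i j) (hAB : A * B = 1) (hBA : B * A = 1)
    (hsum : ∀ j, ∑ i, A i j = 1) :
    ∃ π : Equiv.Perm X, ∀ i j, A i j = if i = π j then 1 else 0 := by
  -- An off-diagonal entry of the identity is a sum of nonnegative products, so every product
  -- vanishes. Consequently a column of `A` cannot have two nonzero entries.
  have hBA0 : ∀ k i j, k ≠ j → B k i * A i j = 0 := by
    intro k i j hkj
    have h := congrFun (congrFun hBA k) j
    rw [Matrix.mul_apply, Matrix.one_apply_ne hkj] at h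
    exact (Finset.sum_eq_zero_iff_of_nonneg fun i _ => mul_nonneg (hB _ _) (hA _ _)).1 h i
      (Finset.mem_univ _)
  have hex : ∀ j, ∃ i, A i j ≠ 0 := by
    intro j
    by_contra! h
    have := hsum j
    simp [h] at this
  choose f hf using hex
  have hBf : ∀ j k, k ≠ j → B k (f j) = 0 := fun j k hkj =>
    (mul_eq_zero.1 (hBA0 k (f j) j hkj)).resolve_right (hf j)
  have hAf : ∀ i j, i ≠ f j → A i j = 0 := by
    intro i j hij
    have h := congrFun (congrFun hAB i) (f j)
    rw [Matrix.mul_apply, Matrix.one_apply_ne hij, Finset.sum_eq_single j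
      (fun k _ hk => by rw [hBf j k hk, mul_zero]) (by simp)] at h
    refine (mul_eq_zero.1 h).resolve_right fun h0 => ?_
    have h1 := congrFun (congrFun hAB (f j)) (f j)
    rw [Matrix.mul_apply, Matrix.one_apply_eq, Finset.sum_eq_zero] at h1
    · exact zero_ne_one h1
    · intro k _
      by_cases hk : k = j
      · rw [hk, h0, mul_zero]
      · rw [hBf j k hk, mul_zero]
  have hAf1 : ∀ j, A (f j) j = 1 := by
    intro j
    rw [← hsum j]
    exact (Finset.sum_eq_single _ (fun i _ hi => hAf i j hi) (by simp)).symm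
  have hinj : Function.Injective f := by
    intro j k hjk
    by_contra hne
    have h := hBf k j hne
    rw [← hjk] at h
    have h1 := congrFun (congrFun hBA j) j
    rw [Matrix.mul_apply, Matrix.one_apply_eq, Finset.sum_eq_zero] at h1
    · exact zero_ne_one h1
    · intro i _
      by_cases hi : i = f j
      · rw [hi, h, zero_mul]
      · rw [hAf i j hi, mul_zero]
  refine ⟨Equiv.ofBijective f (Finite.injective_iff_bijective.1 hinj), fun i j => ?_⟩
  rw [Equiv.ofBijective_apply]
  split_ifs with h
  · rw [h, hAf1]
  · exact hAf i j h

/-! ### Inverses of Clifford unitaries and composition of translations -/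

section

variable {d : ℕ} [NeZero d] {n : ℕ}

lemma IsClifford.mul_conjTranspose {U : Op d n} (hU : IsClifford U) : U * Uᴴ = 1 :=
  Matrix.mem_unitaryGroup_iff.1 hU.1

lemma IsClifford.conjTranspose_mul {U : Op d n} (hU : IsClifford U) : Uᴴ * U = 1 :=
  Matrix.mem_unitaryGroup_iff'.1 hU.1

lemma ne_zero_of_conj_weyl {U : Op d n} (hU : IsClifford U) {a b : Phase d n} {c : ℂ}
    (h : U * weyl a * Uᴴ = c • weyl b) : c ≠ 0 := by
  rintro rfl
  rw [zero_smul] at h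
  apply weyl_ne_zero a
  calc weyl a = (Uᴴ * U) * weyl a * (Uᴴ * U) := by rw [hU.conjTranspose_mul]; simp
    _ = Uᴴ * (U * weyl a * Uᴴ) * U := by simp only [mul_assoc]
    _ = 0 := by rw [h]; simp

lemma IsClifford.conj_injective {U : Op d n} (hU : IsClifford U) {M M' : Op d n}
    (h : U * M * Uᴴ = U * M' * Uᴴ) : M = M' := by
  have key : ∀ M : Op d n, Uᴴ * (U * M * Uᴴ) * U = M := fun M => by
    calc Uᴴ * (U * M * Uᴴ) * U = (Uᴴ * U) * M * (Uᴴ * U) := by simp only [mul_assoc]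
      _ = M := by rw [hU.conjTranspose_mul]; simp
  rw [← key M, h, key]

/-- Equal labels would make two Weyl operators proportional, by cancelling the conjugation. -/
lemma IsClifford.label_injective {U : Op d n} (hU : IsClifford U) {f : Phase d n → Phase d n}
    {c : Phase d n → ℂ} (h : ∀ a, U * weyl a * Uᴴ = c a • weyl (f a)) : Function.Injective f := by
  intro a b hab
  have h1 : U * (c b • weyl a) * Uᴴ = U * (c a • weyl b) * Uᴴ := by
    rw [Matrix.mul_smul, Matrix.smul_mul, Matrix.mul_smul, Matrix.smul_mul, h, h, hab, smul_comm]
  exact (weyl_label_unique (ne_zero_of_conj_weyl hU (h b)) (hU.conj_injective h1)).1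

/-- Phase space is finite, so the injective label map is onto and every Weyl operator is, up to a
phase, the image of one. -/
lemma IsClifford.conjTranspose {U : Op d n} (hU : IsClifford U) : IsClifford Uᴴ := by
  choose f c h using hU.2
  have hf := Finite.injective_iff_surjective.1 (hU.label_injective h)
  refine ⟨Unitary.star_mem hU.1, fun b => ?_⟩
  obtain ⟨a, rfl⟩ := hf b
  have hc := ne_zero_of_conj_weyl hU (h a)
  refine ⟨a, (c a)⁻¹, ?_⟩
  have : weyl (f a) = (c a)⁻¹ • (U * weyl a * Uᴴ) := by
    rw [h, smul_smul, inv_mul_cancel₀ hc, one_smul]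
  rw [this, Matrix.conjTranspose_conjTranspose, Matrix.mul_smul, Matrix.smul_mul]
  congr 1
  calc Uᴴ * (U * weyl a * Uᴴ) * U = (Uᴴ * U) * weyl a * (Uᴴ * U) := by simp only [mul_assoc]
    _ = weyl a := by rw [hU.conjTranspose_mul]; simp

lemma conj_weyl_weyl (b c : Phase d n) (M : Op d n) :
    weyl b * (weyl c * M * (weyl c)ᴴ) * (weyl b)ᴴ = weyl (b + c) * M * (weyl (b + c))ᴴ := by
  have : weyl b * (weyl c * M * (weyl c)ᴴ) * (weyl b)ᴴ =
      (weyl b * weyl c) * M * (weyl b * weyl c)ᴴ := by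
    rw [Matrix.conjTranspose_mul]; simp only [mul_assoc]
  rw [this, weyl_mul, Matrix.conjTranspose_smul, Matrix.smul_mul, Matrix.smul_mul, Matrix.mul_smul,
    smul_smul, chi_mul_star, one_smul]

end

/-! ### Action of Clifford unitaries on the ontic states of one qudit -/

namespace PosRep.IsFrame

variable {d : ℕ} [NeZero d] {N : ℕ∞} {Λ : Type u} [Fintype Λ] {R : PosRep d N Λ}
  {Φ : Op d 1 ≃ₗ[ℂ] ((Fin 1 → Λ) → ℂ)} (hΦ : R.IsFrame Φ)
include hΦ

/-- The gate and its inverse give mutually inverse nonnegative matrices, and preservation of the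
trace makes the columns sum to one. -/
lemma exists_perm (hN : 1 ≤ N) {U : Op d 1} (hU : IsClifford U) :
    ∃ π : Equiv.Perm (Fin 1 → Λ), ∀ M l, Φ (U * M * Uᴴ) (π l) = Φ M l := by
  classical
  have hN1 : ((1 : ℕ) : ℕ∞) ≤ N := by exact_mod_cast hN
  have h1 := isProcess_gate hN1 hU
  have h2 := isProcess_gate hN1 hU.conjTranspose
  have hAB : R.map (conjBy U) * R.map (conjBy Uᴴ) = 1 := by
    rw [← R.map_seq _ _ h1 h2, ← conjBy_mul, hU.mul_conjTranspose, conjBy_one, R.map_id_eq_one hN1]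
  have hBA : R.map (conjBy Uᴴ) * R.map (conjBy U) = 1 := by
    rw [← R.map_seq _ _ h2 h1, ← conjBy_mul, hU.conjTranspose_mul, conjBy_one, R.map_id_eq_one hN1]
  have hsum : ∀ l, ∑ l', R.map (conjBy U) l' l = 1 := by
    intro l
    have hD : IsProcess N (discardOp d 1) := isProcess_discard hN1
    have h3 : discardOp d 1 ∘ₗ conjBy U = discardOp d 1 := by
      ext1 M
      rw [LinearMap.comp_apply, conjBy_apply, discardOp_apply, discardOp_apply,
        Matrix.trace_mul_comm, ← mul_assoc, hU.conjTranspose_mul, one_mul]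
    have h4 := R.map_seq _ _ hD h1
    rw [h3, R.map_discard hN1] at h4
    have h5 := congrFun (congrFun h4 ![]) l
    rw [Matrix.mul_apply] at h5
    simpa using h5.symm
  obtain ⟨π, hπ⟩ := exists_perm_of_mul_eq_one (R.nonneg _ h1) (R.nonneg _ h2) hAB hBA hsum
  refine ⟨π, fun M l => ?_⟩
  rw [← conjBy_apply, hΦ.process _ h1]
  simp [hπ, apply_ite Complex.ofReal]

/-- Averaging a point mass over all translations gives a multiple of `Φ 1`, because the average is
completely depolarizing. Hence every point can be moved to a point `l₀` where `Φ 1` does not vanish.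
-/
lemma exists_translation (hN : 1 ≤ N) (l l' : Fin 1 → Λ) :
    ∃ b : Phase d 1, ∀ M, Φ (weyl b * M * (weyl b)ᴴ) l' = Φ M l := by
  classical
  choose π hπ using fun b : Phase d 1 => hΦ.exists_perm hN (isClifford_weyl b)
  obtain ⟨l₀, hl₀⟩ : ∃ l₀, Φ 1 l₀ ≠ 0 := by
    by_contra! h
    have : Φ 1 = 0 := funext h
    rw [LinearEquiv.map_eq_zero_iff] at this
    exact one_ne_zero this
  have key : ∀ l, ∃ b, π b l = l₀ := by
    intro l
    set M := Φ.symm (Pi.single l 1) with hM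
    have hΦM : Φ M = Pi.single l 1 := by rw [hM, LinearEquiv.apply_symm_apply]
    have htw : ∑ b : Phase d 1, Φ (weyl b * M * (weyl b)ᴴ) = ((d : ℂ) ^ 1 * M.trace) • Φ 1 := by
      rw [← map_sum, sum_weyl_conj, map_smul]
    have hb : ∀ b k, Φ (weyl b * M * (weyl b)ᴴ) k = if k = π b l then 1 else 0 := by
      intro b k
      obtain ⟨k, rfl⟩ := (π b).surjective k
      rw [hπ, hΦM, Pi.single_apply]
      simp
    -- Otherwise the translated point masses would add up to zero, although their total mass is the
    -- number of translations.
    have htr : ((d : ℂ) ^ 1 * M.trace) ≠ 0 := by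
      intro h0
      rw [h0, zero_smul] at htw
      have h1 := congrArg (fun f : (Fin 1 → Λ) → ℂ => ∑ k, f k) htw
      simp only [Finset.sum_apply, hb, Pi.zero_apply, Finset.sum_const_zero] at h1
      rw [Finset.sum_comm] at h1
      simp [NeZero.ne d] at h1
    by_contra! hne
    have h1 := congrFun htw l₀
    simp only [Finset.sum_apply, hb, Pi.smul_apply, smul_eq_mul] at h1
    rw [Finset.sum_eq_zero (fun b _ => if_neg (hne b).symm)] at h1
    exact mul_ne_zero htr hl₀ h1.symm
  obtain ⟨b, hb⟩ := key l
  obtain ⟨b', hb'⟩ := key l'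
  -- Move `l` to `l₀` with `b`, then undo the translation `b'` that takes `l'` to `l₀`.
  refine ⟨b - b', fun M => ?_⟩
  rw [← hπ b' _ l', hb', conj_weyl_weyl, add_sub_cancel, ← hb, hπ]

lemma card_eq : Fintype.card (Fin 1 → Λ) = Fintype.card (Phase d 1) := by
  have h := LinearEquiv.finrank_eq Φ
  rw [Module.finrank_fintype_fun_eq_card, Module.finrank_matrix, Module.finrank_self] at h
  rw [← h]
  simp [Phase, Config]

/-- Translations multiply a Weyl operator by a phase, so a zero at one ontic state would spread to
all of them, against injectivity of `Φ`. -/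
lemma weyl_ne_zero_at (hN : 1 ≤ N) (a : Phase d 1) (l : Fin 1 → Λ) : Φ (weyl a) l ≠ 0 := by
  intro h
  apply weyl_ne_zero a
  rw [← LinearEquiv.map_eq_zero_iff Φ]
  funext l'
  obtain ⟨b, hb⟩ := hΦ.exists_translation hN l' l
  have := hb (weyl a)
  rw [weyl_conj, map_smul, Pi.smul_apply, h, smul_zero] at this
  exact this.symm

lemma nonempty : Nonempty (Fin 1 → Λ) := by
  rw [← Fintype.card_pos_iff, hΦ.card_eq]
  exact Fintype.card_pos

end PosRep.IsFrame

/-! ## Even dimension: the quadratic phase gate -/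

section Even

variable {d : ℕ} [NeZero d]

/-- A square root of the primitive `d`-th root of unity. -/
def rootPhase (d : ℕ) : ℂ := Complex.exp (Real.pi * Complex.I / d)

lemma rootPhase_pow_dim : rootPhase d ^ d = -1 := by
  rw [rootPhase, ← Complex.exp_nat_mul, mul_div_cancel₀ _ natCast_dim_ne_zero, Complex.exp_pi_mul_I]

lemma rootPhase_sq : rootPhase d ^ 2 = χ (1 : ZMod d) := by
  have := ZMod.stdAddChar_coe (N := d) 1
  rw [Int.cast_one] at this
  rw [this, rootPhase, ← Complex.exp_nat_mul]
  congr 1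
  push_cast
  ring

lemma rootPhase_mul_star : rootPhase d * star (rootPhase d) = 1 := by
  have h : ‖rootPhase d‖ = 1 := by
    have := Complex.norm_exp_ofReal_mul_I (Real.pi / d)
    rw [rootPhase, ← this]
    congr 2
    push_cast
    ring
  rw [Complex.star_def, Complex.mul_conj, Complex.normSq_eq_norm_sq, h]
  simp

/-- The quadratic phase `x ↦ exp (π i x² / d)`. -/
def quadPhase (x : ZMod d) : ℂ := rootPhase d ^ (x.val ^ 2)

/-- For even `d`, squares of congruent numbers differ by a multiple of `2 * d`, and `rootPhase d ^
(2 * d) = 1`; so the phase depends only on the class modulo `d`. -/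
lemma quadPhase_natCast (hd : Even d) (k : ℕ) : quadPhase (k : ZMod d) = rootPhase d ^ (k ^ 2) := by
  obtain ⟨e, he⟩ := hd
  rw [quadPhase, ZMod.val_natCast]
  have h1 : k ^ 2 = (k % d) ^ 2 + (2 * d) * ((k / d) * (k % d) + e * (k / d) ^ 2) := by
    have h2 := Nat.mod_add_div k d
    generalize k % d = r at *
    generalize k / d = s at *
    have h3 : d * d = 2 * d * e := by
      nth_rewrite 2 [he]; ring
    calc k ^ 2 = (r + d * s) ^ 2 := by rw [h2]
      _ = r ^ 2 + 2 * d * (s * r) + (d * d) * s ^ 2 := by ring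
      _ = _ := by rw [h3]; ring
  have h4 : rootPhase d ^ (2 * d) = 1 := by
    rw [mul_comm, pow_mul, rootPhase_pow_dim]; norm_num
  rw [h1, pow_add, pow_mul _ (2 * d), h4, one_pow, mul_one]

lemma quadPhase_add (hd : Even d) (x y : ZMod d) :
    quadPhase (x + y) = quadPhase x * quadPhase y * χ (x * y) := by
  have h1 := quadPhase_natCast hd (x.val + y.val)
  have h2 : χ (x * y) = rootPhase d ^ (2 * (x.val * y.val)) := by
    rw [pow_mul, rootPhase_sq, ← AddChar.map_nsmul_eq_pow, nsmul_one]
    push_cast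
    rw [ZMod.natCast_zmod_val, ZMod.natCast_zmod_val]
  rw [Nat.cast_add, ZMod.natCast_zmod_val, ZMod.natCast_zmod_val] at h1
  rw [h1, h2, quadPhase, quadPhase, ← pow_add, ← pow_add]
  congr 1
  ring

lemma quadPhase_mul_star (x : ZMod d) : quadPhase x * star (quadPhase x) = 1 := by
  rw [quadPhase, star_pow, ← mul_pow, rootPhase_mul_star, one_pow]

/-- The quadratic phase gate of one qudit of even dimension. -/
def quadGate (d : ℕ) [NeZero d] : Op d 1 := Matrix.diagonal fun x => quadPhase (x 0)

/-- The point `(p, q)` of the phase space of one qudit. -/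
def point (p q : ZMod d) : Phase d 1 := fun _ => (p, q)

/-- The entries at `x = y + q` acquire the phase `quadPhase (y + q)` over `quadPhase y`, which is
linear in `y` up to a constant: a shear in the momentum. -/
lemma quadGate_conj (hd : Even d) (p q : ZMod d) :
    quadGate d * weyl (point p q) * (quadGate d)ᴴ =
      (quadPhase q * χ (-(q * q))) • weyl (point (p + q) q) := by
  ext x y
  rw [quadGate, Matrix.diagonal_conjTranspose, Matrix.mul_diagonal, Matrix.diagonal_mul,
    Matrix.smul_apply, weyl_apply, weyl_apply, smul_eq_mul]
  have h1 : ∀ p q : ZMod d, mom (point p q) ⬝ᵥ x = p * x 0 := fun p q => by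
    simp [dotProduct, mom, point]
  have h2 : pos (point (p + q) q) = pos (point p q) := rfl
  rw [h1, h1, h2]
  by_cases h : x = y + pos (point p q)
  · rw [if_pos h, if_pos h]
    have hx : x 0 = y 0 + q := congrFun h 0
    rw [hx, quadPhase_add hd, Pi.star_apply]
    have h3 := quadPhase_mul_star (y 0)
    have h4 : χ (p * (y 0 + q)) * χ (y 0 * q) = χ (-(q * q)) * χ ((p + q) * (y 0 + q)) := by
      rw [← chi_add, ← chi_add]
      congr 1
      ring
    linear_combination (quadPhase q * χ (y 0 * q) * χ (p * (y 0 + q))) * h3 + quadPhase q * h4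
  · rw [if_neg h, if_neg h]
    simp

lemma isClifford_quadGate (hd : Even d) : IsClifford (quadGate d) := by
  refine ⟨?_, fun a => ⟨point ((a 0).1 + (a 0).2) (a 0).2,
    quadPhase (a 0).2 * χ (-((a 0).2 * (a 0).2)), ?_⟩⟩
  · rw [Matrix.mem_unitaryGroup_iff, Matrix.star_eq_conjTranspose, quadGate,
      Matrix.diagonal_conjTranspose, Matrix.diagonal_mul_diagonal, ← Matrix.diagonal_one]
    congr 1
    ext x
    exact quadPhase_mul_star _
  · have ha : a = point (a 0).1 (a 0).2 := by
      funext i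
      rw [Subsingleton.elim i 0]
      rfl
    conv_lhs => rw [ha]
    exact quadGate_conj hd _ _

/-- For even `d` there is no nonnegative representation. -/
theorem PosRep.false_of_even {N : ℕ∞} {Λ : Type u} [Fintype Λ] (hd : Even d) (hN : 1 ≤ N)
    (R : PosRep d N Λ) : False := by
  obtain ⟨Φ, hΦ⟩ := R.exists_frame hN
  obtain ⟨π, hπ⟩ := hΦ.exists_perm hN (isClifford_quadGate hd)
  obtain ⟨l⟩ := hΦ.nonempty
  obtain ⟨b, hb⟩ := hΦ.exists_translation hN (π l) l
  -- The gate moves `l` to `π l` and the translation by `b` moves it back, so the composite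
  -- preserves evaluation at `l`.
  have key : ∀ p q : ZMod d, Φ (weyl (point p q)) l = quadPhase q * χ (-(q * q)) *
      χ (symp b (point (p + q) q)) * Φ (weyl (point (p + q) q)) l := by
    intro p q
    rw [← hπ, ← hb, quadGate_conj hd, Matrix.mul_smul, Matrix.smul_mul, weyl_conj, smul_smul,
      map_smul, Pi.smul_apply, smul_eq_mul]
  have hsymp : ∀ p q : ZMod d, symp b (point p q) = (b 0).1 * q - (b 0).2 * p := fun p q => by
    simp [symp, point]
  -- The gate fixes the operator at `(1, 0)`, whose value is nonzero, so the translation may not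
  -- change its phase.
  have hb2 : (b 0).2 = 0 := by
    have h := key 1 0
    have hq0 : quadPhase (0 : ZMod d) = 1 := by simp [quadPhase]
    rw [hq0, hsymp, add_zero, mul_zero, neg_zero, AddChar.map_zero_eq_one, one_mul, one_mul] at h
    have h1 := mul_right_cancel₀ (hΦ.weyl_ne_zero_at hN _ l) ((one_mul _).trans h)
    have h2 := chi_eq_one.1 h1.symm
    simpa using h2
  have hd1 : 1 < d := by
    obtain ⟨e, he⟩ := hd
    have := NeZero.ne d
    omega
  have : Fact (1 < d) := ⟨hd1⟩
  have hq1 : quadPhase (1 : ZMod d) = rootPhase d := by simp [quadPhase, ZMod.val_one]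
  set r := rootPhase d * χ (-1 : ZMod d) * χ (b 0).1 with hr
  have hstep : ∀ p : ZMod d, Φ (weyl (point p 1)) l = r * Φ (weyl (point (p + 1) 1)) l := by
    intro p
    rw [key p 1, hsymp, hb2, hq1]
    simp [hr]
  -- After `d` steps the momentum is back at `0`, but the accumulated factor is `r ^ d = -1`, since
  -- the values of `χ` are `d`-th roots of unity.
  have hiter : ∀ k : ℕ, Φ (weyl (point (0 : ZMod d) 1)) l =
      r ^ k * Φ (weyl (point (k : ZMod d) 1)) l := by
    intro k
    induction k with
    | zero => simp
    | succ k ih => rw [ih, hstep (k : ZMod d), pow_succ, mul_assoc (r ^ k), Nat.cast_succ]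
  have h := hiter d
  rw [ZMod.natCast_self] at h
  have h1 := mul_right_cancel₀ (hΦ.weyl_ne_zero_at hN _ l) ((one_mul _).trans h)
  rw [hr, mul_pow, mul_pow, rootPhase_pow_dim, chi_pow_card, chi_pow_card] at h1
  norm_num at h1

end Even

/-! ## Odd dimension: Gross's Weyl operators and phase point operators -/

section Odd

variable {d : ℕ} [NeZero d] {n m k n' m' : ℕ}

lemma two_mul_inv_two (hd : Odd d) : (2 : ZMod d) * 2⁻¹ = 1 := by
  have := ZMod.coe_mul_inv_eq_one (n := d) 2 (Nat.coprime_two_left.2 hd)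
  exact_mod_cast this

lemma grossWeyl_eq (a : Phase d n) : grossWeyl a = χ (-halfPQ a) • weyl a := rfl

lemma weyl_eq_grossWeyl (a : Phase d n) : weyl a = χ (halfPQ a) • grossWeyl a := by
  rw [grossWeyl_eq, smul_smul, ← chi_add, add_neg_cancel, AddChar.map_zero_eq_one, one_smul]

lemma grossWeyl_zero : grossWeyl (0 : Phase d n) = 1 := by
  simp [grossWeyl_eq, halfPQ_eq, weyl_zero]

/-- The phase `- 2⁻¹ p q` replaces the cocycle of `weyl_mul` by its antisymmetric part, half the
symplectic form; this needs `2` to be invertible. -/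
lemma grossWeyl_mul (hd : Odd d) (a b : Phase d n) :
    grossWeyl a * grossWeyl b = χ (2⁻¹ * symp a b) • grossWeyl (a + b) := by
  rw [grossWeyl_eq, grossWeyl_eq, grossWeyl_eq, Matrix.smul_mul, Matrix.mul_smul, weyl_mul,
    smul_smul, smul_smul, smul_smul, ← chi_add, ← chi_add, ← chi_add]
  congr 2
  simp only [halfPQ_eq, symp_eq, mom_add, pos_add, add_dotProduct, dotProduct_add]
  rw [dotProduct_comm (mom b) (pos a)]
  linear_combination (pos a ⬝ᵥ mom b) * two_mul_inv_two hd

lemma grossWeyl_mul_of_symp_eq_zero (hd : Odd d) {a b : Phase d n} (h : symp a b = 0) :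
    grossWeyl a * grossWeyl b = grossWeyl (a + b) := by
  rw [grossWeyl_mul hd, h, mul_zero, AddChar.map_zero_eq_one, one_smul]

lemma grossWeyl_conjTranspose (hd : Odd d) (a : Phase d n) :
    (grossWeyl a)ᴴ = grossWeyl (-a) := by
  rw [grossWeyl_eq, grossWeyl_eq, Matrix.conjTranspose_smul, weyl_conjTranspose, star_chi,
    smul_smul, ← chi_add]
  congr 2
  simp only [halfPQ_eq, mom_neg, pos_neg, neg_dotProduct, dotProduct_neg]
  rw [dotProduct_comm (pos a)]
  linear_combination (mom a ⬝ᵥ pos a) * two_mul_inv_two hd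

lemma grossWeyl_conj (a b : Phase d n) :
    grossWeyl a * grossWeyl b * (grossWeyl a)ᴴ = χ (symp a b) • grossWeyl b := by
  rw [grossWeyl_eq a, Matrix.conjTranspose_smul, Matrix.smul_mul, Matrix.smul_mul, Matrix.mul_smul,
    smul_smul, chi_mul_star, one_smul, grossWeyl_eq b, Matrix.mul_smul, Matrix.smul_mul, weyl_conj,
    smul_comm]

lemma grossWeyl_mul_conjTranspose (a : Phase d n) : grossWeyl a * (grossWeyl a)ᴴ = 1 := by
  rw [grossWeyl_eq a, Matrix.conjTranspose_smul, Matrix.smul_mul, Matrix.mul_smul,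
    smul_smul, chi_mul_star, one_smul, weyl_mul_conjTranspose]

lemma grossWeyl_conjTranspose_mul (a : Phase d n) : (grossWeyl a)ᴴ * grossWeyl a = 1 :=
  mul_eq_one_comm.1 (grossWeyl_mul_conjTranspose a)

lemma trace_grossWeyl (a : Phase d n) :
    (grossWeyl a).trace = if a = 0 then (d : ℂ) ^ n else 0 := by
  rw [grossWeyl_eq, Matrix.trace_smul, trace_weyl]
  split_ifs with h
  · simp [h, halfPQ_eq]
  · simp

lemma grossWeyl_label_unique {a b : Phase d n} {c c' : ℂ} (hc : c ≠ 0)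
    (h : c • grossWeyl a = c' • grossWeyl b) : a = b ∧ c = c' := by
  rw [grossWeyl_eq, grossWeyl_eq, smul_smul, smul_smul] at h
  obtain ⟨hab, h1⟩ := weyl_label_unique (mul_ne_zero hc (chi_ne_zero _)) h
  subst hab
  exact ⟨rfl, mul_right_cancel₀ (chi_ne_zero _) h1⟩

lemma linearMap_ext_grossWeyl {V : Type*} [AddCommGroup V] [Module ℂ V] {f g : Op d n →ₗ[ℂ] V}
    (h : ∀ a, f (grossWeyl a) = g (grossWeyl a)) : f = g :=
  linearMap_ext_weyl fun a => by rw [weyl_eq_grossWeyl, map_smul, map_smul, h]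

/-- The Weyl operators on a line in phase space represent `ZMod d`. -/
lemma isCyclicRep_grossWeyl (hd : Odd d) (a : Phase d n) :
    IsCyclicRep fun j : ZMod d => grossWeyl (j • a) where
  map_zero := by rw [zero_smul, grossWeyl_zero]
  map_add i j := by
    rw [grossWeyl_mul_of_symp_eq_zero hd (by simp [symp_smul_left, symp_smul_right]), add_smul]
  map_star j := by rw [grossWeyl_conjTranspose hd, neg_smul]

lemma phasePoint_eq (hd : Odd d) (a : Phase d n) :
    phasePoint a = ((d : ℂ) ^ n)⁻¹ • ∑ b : Phase d n, χ (symp a b) • grossWeyl b := by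
  rw [phasePoint, ← Equiv.sum_comp (Equiv.neg (Phase d n))]
  simp only [Equiv.neg_apply, symp_neg_right, neg_neg, grossWeyl_conjTranspose hd]

lemma pow_dim_ne_zero : ((d : ℂ) ^ n) ≠ 0 := pow_ne_zero _ natCast_dim_ne_zero

lemma grossWeyl_conj_phasePoint (hd : Odd d) (a c : Phase d n) :
    grossWeyl c * phasePoint a * (grossWeyl c)ᴴ = phasePoint (a + c) := by
  rw [phasePoint_eq hd, phasePoint_eq hd, Matrix.mul_smul, Matrix.smul_mul, Finset.mul_sum,
    Finset.sum_mul]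
  congr 1
  refine Finset.sum_congr rfl fun b _ => ?_
  rw [Matrix.mul_smul, Matrix.smul_mul, grossWeyl_conj, smul_smul, ← chi_add, symp_add_left]

/-- Only the summand at `-c` has nonzero trace. -/
lemma trace_phasePoint_mul_grossWeyl (hd : Odd d) (a c : Phase d n) :
    (phasePoint a * grossWeyl c).trace = χ (symp c a) := by
  rw [phasePoint_eq hd, Matrix.smul_mul, Finset.sum_mul, Matrix.trace_smul, Matrix.trace_sum,
    Finset.sum_eq_single (-c)]
  · rw [Matrix.smul_mul, grossWeyl_mul hd, Matrix.trace_smul, Matrix.trace_smul, trace_grossWeyl,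
      symp_neg_left, symp_self, symp_neg_right, ← symp_swap]
    simp only [neg_zero, mul_zero, AddChar.map_zero_eq_one, neg_add_cancel, if_true,
      smul_eq_mul]
    rw [one_mul, mul_left_comm, inv_mul_cancel₀ pow_dim_ne_zero, mul_one]
  · intro b _ hb
    rw [Matrix.smul_mul, grossWeyl_mul hd, Matrix.trace_smul, Matrix.trace_smul, trace_grossWeyl,
      if_neg (fun h => hb (eq_neg_of_add_eq_zero_left h))]
    simp
  · simp

lemma trace_phasePoint (hd : Odd d) (a : Phase d n) : (phasePoint a).trace = 1 := by
  have := trace_phasePoint_mul_grossWeyl hd a 0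
  rwa [grossWeyl_zero, mul_one, symp_zero_left, AddChar.map_zero_eq_one] at this

lemma trace_phasePoint_mul (hd : Odd d) (a b : Phase d n) :
    (phasePoint a * phasePoint b).trace = if a = b then (d : ℂ) ^ n else 0 := by
  conv_lhs => rw [phasePoint_eq hd b]
  rw [Matrix.mul_smul, Finset.mul_sum, Matrix.trace_smul, Matrix.trace_sum]
  have : ∀ c : Phase d n, (phasePoint a * χ (symp b c) • grossWeyl c).trace =
      χ (symp c (a - b)) := by
    intro c
    rw [Matrix.mul_smul, Matrix.trace_smul, trace_phasePoint_mul_grossWeyl hd, smul_eq_mul,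
      ← chi_add, symp_swap b c, symp_sub_right]
    congr 1
    ring
  simp only [this, sum_chi_symp, sub_eq_zero]
  split_ifs with h
  · rw [smul_eq_mul, pow_two, inv_mul_cancel_left₀ pow_dim_ne_zero]
  · simp

/-- The phase point operators resolve the identity superoperator. -/
lemma sum_trace_smul_phasePoint (hd : Odd d) (M : Op d n) :
    ∑ a : Phase d n, (((d : ℂ) ^ n)⁻¹ * (phasePoint a * M).trace) • phasePoint a = M := by
  -- Evaluated on the Weyl operator of `c`, the sum over `a` is a character sum that forces `b = c`.
  have key : ∑ a : Phase d n, (((d : ℂ) ^ n)⁻¹ • (Matrix.traceLinearMap _ ℂ ℂ ∘ₗ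
      LinearMap.mulLeft ℂ (phasePoint a))).smulRight (phasePoint a) =
      (LinearMap.id : Op d n →ₗ[ℂ] Op d n) := by
    refine linearMap_ext_grossWeyl fun c => ?_
    simp only [LinearMap.sum_apply, LinearMap.smulRight_apply, LinearMap.smul_apply,
      LinearMap.comp_apply, LinearMap.mulLeft_apply, Matrix.traceLinearMap_apply,
      trace_phasePoint_mul_grossWeyl hd, LinearMap.id_apply, smul_eq_mul]
    simp only [phasePoint_eq hd, Finset.smul_sum, smul_smul]
    rw [Finset.sum_comm]
    have : ∀ b : Phase d n, ∑ a : Phase d n,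
        (((d : ℂ) ^ n)⁻¹ * χ (symp c a) * (((d : ℂ) ^ n)⁻¹ * χ (symp a b))) • grossWeyl b =
        if b = c then grossWeyl c else 0 := by
      intro b
      have h1 : ∀ a : Phase d n, ((d : ℂ) ^ n)⁻¹ * χ (symp c a) * (((d : ℂ) ^ n)⁻¹ * χ (symp a b)) =
          ((d : ℂ) ^ n)⁻¹ * ((d : ℂ) ^ n)⁻¹ * χ (symp a (b - c)) := by
        intro a
        rw [symp_sub_right, sub_eq_add_neg, ← symp_swap, chi_add]
        ring
      rw [← Finset.sum_smul]
      simp only [h1]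
      rw [← Finset.mul_sum, sum_chi_symp]
      have hne := pow_dim_ne_zero (d := d) (n := n)
      by_cases hb : b = c
      · rw [if_pos hb, if_pos (sub_eq_zero.2 hb), hb]
        have : ((d : ℂ) ^ n)⁻¹ * ((d : ℂ) ^ n)⁻¹ * ((d : ℂ) ^ n) ^ 2 = 1 := by field_simp
        rw [this, one_smul]
      · rw [if_neg hb, if_neg (fun h => hb (sub_eq_zero.1 h)), mul_zero, zero_smul]
    simp only [this, Finset.sum_ite_eq', Finset.mem_univ, if_true]
  have := LinearMap.congr_fun key M
  simpa using this

lemma sum_phasePoint (hd : Odd d) : ∑ a : Phase d n, phasePoint a = ((d : ℂ) ^ n) • 1 := by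
  have := sum_trace_smul_phasePoint hd (1 : Op d n)
  simp only [mul_one, trace_phasePoint hd] at this
  rw [← Finset.smul_sum] at this
  rw [← this, smul_smul, mul_inv_cancel₀ pow_dim_ne_zero, one_smul]

lemma weyl_par (a : Phase d (n + n')) :
    weyl a = parMatrix (weyl (a ∘ Fin.castAdd n')) (weyl (a ∘ Fin.natAdd n)) := by
  ext x y
  simp only [weyl, parMatrix_apply, Matrix.of_apply, Fin.prod_univ_add, Function.comp_apply]

lemma grossWeyl_par (a : Phase d (n + n')) :
    grossWeyl a = parMatrix (grossWeyl (a ∘ Fin.castAdd n')) (grossWeyl (a ∘ Fin.natAdd n)) := by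
  have h : halfPQ a = halfPQ (a ∘ Fin.castAdd n') + halfPQ (a ∘ Fin.natAdd n) := by
    simp only [halfPQ, Fin.sum_univ_add, Function.comp_apply, mul_add]
  rw [grossWeyl_eq, grossWeyl_eq, grossWeyl_eq, weyl_par, h, neg_add, chi_add]
  simp only [← parMatrixₗ_apply, map_smul, LinearMap.smul_apply, smul_smul]
  rw [mul_comm]

lemma symp_par (a b : Phase d (n + n')) :
    symp a b = symp (a ∘ Fin.castAdd n') (b ∘ Fin.castAdd n') +
      symp (a ∘ Fin.natAdd n) (b ∘ Fin.natAdd n) := by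
  simp only [symp, Fin.sum_univ_add, Function.comp_apply]

lemma phasePoint_par (hd : Odd d) (a : Phase d (n + n')) :
    phasePoint a = parMatrix (phasePoint (a ∘ Fin.castAdd n')) (phasePoint (a ∘ Fin.natAdd n)) := by
  rw [phasePoint_eq hd, phasePoint_eq hd, phasePoint_eq hd, sum_append, ← parMatrixₗ_apply,
    map_smul, map_smul, LinearMap.smul_apply, smul_smul, pow_add, mul_inv, mul_comm,
    LinearMap.map_sum₂]
  congr 1
  refine Finset.sum_congr rfl fun b _ => ?_
  rw [map_sum]
  refine Finset.sum_congr rfl fun b' _ => ?_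
  rw [map_smul, map_smul, LinearMap.smul_apply, smul_smul, symp_par, grossWeyl_par,
    append_comp_castAdd, append_comp_natAdd, chi_add, mul_comm, parMatrixₗ_apply]

lemma phasePoint_zero (hd : Odd d) (a : Phase d 0) : phasePoint a = 1 := by
  have h := trace_phasePoint hd a
  rw [op_zero_eq (phasePoint a), Matrix.trace_smul, Matrix.trace_one] at h
  rw [op_zero_eq (phasePoint a)]
  simp only [Fintype.card_unique, Nat.cast_one, smul_eq_mul, mul_one] at h
  rw [h, one_smul]

lemma conjBy_wireMatrix_apply (σ : Equiv.Perm (Fin n)) (M : Op d n) (x y : Config d n) :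
    conjBy (wireMatrix (ZMod d) ℂ σ) M x y = M (x ∘ ⇑σ⁻¹) (y ∘ ⇑σ⁻¹) := by
  have h : ∀ x u : Config d n, x = u ∘ σ ↔ u = x ∘ ⇑σ⁻¹ := by
    intro x u
    constructor
    · rintro rfl; ext i; simp
    · rintro rfl; ext i; simp
  simp only [conjBy_apply, Matrix.mul_apply, Matrix.conjTranspose_apply, wireMatrix,
    Matrix.of_apply, h]
  simp

lemma grossWeyl_comp (σ : Equiv.Perm (Fin n)) (a : Phase d n) (x y : Config d n) :
    grossWeyl a (x ∘ ⇑σ⁻¹) (y ∘ ⇑σ⁻¹) = grossWeyl (a ∘ σ) x y := by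
  have h : halfPQ (a ∘ σ) = halfPQ a := by
    simp only [halfPQ, Function.comp_apply]
    rw [Equiv.sum_comp σ (fun i => (a i).1 * (a i).2)]
  rw [grossWeyl_eq, grossWeyl_eq, Matrix.smul_apply, Matrix.smul_apply, h]
  congr 1
  simp only [weyl, Matrix.of_apply, Function.comp_apply]
  rw [← Equiv.prod_comp σ]
  simp

lemma conjBy_wireMatrix_phasePoint (hd : Odd d) (σ : Equiv.Perm (Fin n)) (a : Phase d n) :
    conjBy (wireMatrix (ZMod d) ℂ σ) (phasePoint a) = phasePoint (a ∘ σ) := by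
  ext x y
  rw [conjBy_wireMatrix_apply, phasePoint_eq hd, phasePoint_eq hd, Matrix.smul_apply,
    Matrix.smul_apply, Matrix.sum_apply, Matrix.sum_apply]
  congr 1
  conv_rhs => rw [← Equiv.sum_comp (Equiv.arrowCongr σ⁻¹ (Equiv.refl (ZMod d × ZMod d)))]
  refine Finset.sum_congr rfl fun b _ => ?_
  have hb : Equiv.arrowCongr σ⁻¹ (Equiv.refl (ZMod d × ZMod d)) b = b ∘ σ := by
    ext1 i; simp [Equiv.arrowCongr, Equiv.Perm.inv_def]
  have hs : symp (a ∘ σ) (b ∘ σ) = symp a b := by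
    simp only [symp, Function.comp_apply]
    rw [Equiv.sum_comp σ (fun i => (a i).1 * (b i).2 - (a i).2 * (b i).1)]
  rw [hb, hs, Matrix.smul_apply, Matrix.smul_apply, grossWeyl_comp]

/-! ## Gross's representation -/

/-- Gross's representation as a matrix. -/
def grossMatrix (T : SuperOp d n m) : Matrix (Phase d m) (Phase d n) ℂ :=
  Matrix.of fun a' a => grossKernel T a' a

lemma grossMatrix_apply (T : SuperOp d n m) (a' : Phase d m) (a : Phase d n) :
    grossMatrix T a' a = ((d : ℂ) ^ m)⁻¹ * (phasePoint a' * T (phasePoint a)).trace := by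
  rw [grossMatrix, Matrix.of_apply, grossKernel, Matrix.smul_mul, Matrix.trace_smul, smul_eq_mul]

lemma grossMatrix_add (T T' : SuperOp d n m) :
    grossMatrix (T + T') = grossMatrix T + grossMatrix T' := by
  ext a' a
  simp only [grossMatrix_apply, Matrix.add_apply, LinearMap.add_apply, mul_add, Matrix.trace_add]

lemma grossMatrix_smul (c : ℂ) (T : SuperOp d n m) : grossMatrix (c • T) = c • grossMatrix T := by
  ext a' a
  simp only [grossMatrix_apply, Matrix.smul_apply, LinearMap.smul_apply, Matrix.mul_smul,
    Matrix.trace_smul, smul_eq_mul]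
  ring

lemma grossMatrix_comp (hd : Odd d) (S : SuperOp d m k) (T : SuperOp d n m) :
    grossMatrix (S ∘ₗ T) = grossMatrix S * grossMatrix T := by
  ext a' a
  rw [Matrix.mul_apply, grossMatrix_apply, LinearMap.comp_apply]
  conv_lhs => rw [← sum_trace_smul_phasePoint hd (T (phasePoint a))]
  rw [map_sum, Finset.mul_sum, Matrix.trace_sum, Finset.mul_sum]
  refine Finset.sum_congr rfl fun b _ => ?_
  rw [map_smul, Matrix.mul_smul, Matrix.trace_smul, smul_eq_mul, grossMatrix_apply,
    grossMatrix_apply]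
  ring

lemma grossMatrix_of_apply (hd : Odd d) {T : SuperOp d n m} {a : Phase d n} {b : Phase d m}
    (h : T (phasePoint a) = phasePoint b) (a' : Phase d m) :
    grossMatrix T a' a = if a' = b then 1 else 0 := by
  rw [grossMatrix_apply, h, trace_phasePoint_mul hd]
  split_ifs
  · exact inv_mul_cancel₀ pow_dim_ne_zero
  · exact mul_zero _

lemma grossMatrix_wires (hd : Odd d) (σ : Equiv.Perm (Fin n)) :
    grossMatrix (conjBy (d := d) (wireMatrix (ZMod d) ℂ σ)) =
      wireMatrix (ZMod d × ZMod d) ℂ σ := by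
  ext a' a
  rw [grossMatrix_of_apply hd (conjBy_wireMatrix_phasePoint hd σ a), wireMatrix, Matrix.of_apply]
  congr

lemma grossMatrix_id (hd : Odd d) : grossMatrix (LinearMap.id : SuperOp d n n) = 1 := by
  ext a' a
  rw [grossMatrix_of_apply hd (LinearMap.id_apply _), Matrix.one_apply]

lemma grossMatrix_par (hd : Odd d) (T : SuperOp d n m) (T' : SuperOp d n' m') :
    grossMatrix (superTensor T T') = parMatrix (grossMatrix T) (grossMatrix T') := by
  ext a' a
  rw [grossMatrix_apply, parMatrix_apply, grossMatrix_apply, grossMatrix_apply,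
    phasePoint_par hd a, phasePoint_par hd a', superTensor_apply_par, ← parMatrix_mul,
    trace_parMatrix, pow_add]
  ring

lemma grossMatrix_discard (hd : Odd d) (a' : Phase d 0) (a : Phase d n) :
    grossMatrix (discardOp d n) a' a = 1 := by
  rw [grossMatrix_apply, discardOp_apply, trace_phasePoint hd, one_smul, mul_one,
    trace_phasePoint hd]
  simp

lemma grossMatrix_scalar (hd : Odd d) (T : SuperOp d 0 0) (a' a : Phase d 0) :
    grossMatrix T a' a = scalar T := by
  conv_lhs => rw [superOp_zero_eq T]
  rw [grossMatrix_smul, grossMatrix_id hd, Subsingleton.elim a' a]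
  simp

/-! ### Preparations -/

lemma mulVec_pow_of_isCyclicRep {u : ZMod d → Op d n} (hu : IsCyclicRep u) {φ : Config d n → ℂ}
    {c : ℂ} (h : u 1 *ᵥ φ = c • φ) (j : ℕ) : u j *ᵥ φ = c ^ j • φ := by
  induction j with
  | zero => simp [hu.map_zero]
  | succ j ih =>
    rw [Nat.cast_succ, hu.map_add, ← Matrix.mulVec_mulVec, h, Matrix.mulVec_smul, ih, smul_smul,
      pow_succ']

/-- With Gross's phases the `d`-th power of a Weyl operator is `1`. -/
lemma exists_eigenvalue_eq_chi (hd : Odd d) {a : Phase d n} {φ : Config d n → ℂ} (hφ : φ ≠ 0)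
    {c : ℂ} (h : grossWeyl a *ᵥ φ = c • φ) : ∃ j : ZMod d, c = χ j := by
  apply exists_chi_eq
  have hu := isCyclicRep_grossWeyl hd a
  have h1 := mulVec_pow_of_isCyclicRep hu (φ := φ) (c := c) (by simpa using h) d
  rw [ZMod.natCast_self, hu.map_zero, Matrix.one_mulVec] at h1
  have h2 : (c ^ d - 1) • φ = 0 := by rw [sub_smul, one_smul, ← h1, sub_self]
  exact sub_eq_zero.1 ((smul_eq_zero.1 h2).resolve_right hφ)

lemma IsStabilizerVector.ne_zero {ψ : Config d n → ℂ} (hψ : IsStabilizerVector ψ) : ψ ≠ 0 := by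
  rintro rfl
  simpa using hψ.1

lemma trace_mul_vecMulVec (M : Op d n) (ψ : Config d n → ℂ) :
    (M * Matrix.vecMulVec ψ (star ψ)).trace = star ψ ⬝ᵥ (M *ᵥ ψ) := by
  rw [Matrix.mul_vecMulVec, Matrix.trace_vecMulVec, dotProduct_comm]

/-- The expectation value of a Weyl operator in a stabilizer state vanishes, unless the state is
an eigenstate. -/
lemma IsStabilizerVector.trace_eq_zero {ψ : Config d n → ℂ}
    (hψ : IsStabilizerVector ψ) {b : Phase d n} (hb : ∀ c : ℂ, grossWeyl b *ᵥ ψ ≠ c • ψ) :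
    (grossWeyl b * Matrix.vecMulVec ψ (star ψ)).trace = 0 := by
  obtain ⟨hnorm, S, ev, hS⟩ := hψ
  have hev : ∀ a ∈ S, weyl a *ᵥ ψ = ev a • ψ := (hS ψ).2 ⟨1, (one_smul _ _).symm⟩
  have hcomm : ∀ a, weyl a * grossWeyl b = χ (symp a b) • (grossWeyl b * weyl a) := by
    intro a
    rw [grossWeyl_eq, Matrix.mul_smul, weyl_comm, Matrix.smul_mul, smul_comm]
  -- If `b` is symplectically orthogonal to `S`, then `grossWeyl b *ᵥ ψ` solves the equations that
  -- determine `ψ` up to scalars, so `ψ` is an eigenvector. Otherwise conjugation with some `weyl a`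
  -- fixes the state but multiplies the trace by a nontrivial phase.
  by_cases h : ∀ a ∈ S, symp a b = 0
  · obtain ⟨c, hc⟩ := (hS (grossWeyl b *ᵥ ψ)).1 (fun a ha => by
      rw [Matrix.mulVec_mulVec, hcomm, h a ha, AddChar.map_zero_eq_one, one_smul,
        ← Matrix.mulVec_mulVec, hev a ha, Matrix.mulVec_smul])
    exact absurd hc (hb c)
  · push Not at h
    obtain ⟨a, ha, hab⟩ := h
    set ρ := Matrix.vecMulVec ψ (star ψ) with hρ
    have h1 : weyl a * ρ * (weyl a)ᴴ = (ev a * star (ev a)) • ρ := by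
      rw [hρ, Matrix.mul_vecMulVec, Matrix.vecMulVec_mul, ← Matrix.star_mulVec, hev a ha, star_smul,
        Matrix.smul_vecMulVec, Matrix.vecMulVec_smul, smul_smul]
    have h2 : ev a * star (ev a) = 1 := by
      have h3 := congrArg Matrix.trace h1
      rw [Matrix.trace_mul_comm, ← mul_assoc, weyl_conjTranspose_mul, one_mul, Matrix.trace_smul,
        hρ, trace_vecMulVec_star hnorm, smul_eq_mul, mul_one] at h3
      exact h3.symm
    rw [h2, one_smul] at h1
    have h4 : (grossWeyl b * ρ).trace = χ (symp a b) * (grossWeyl b * ρ).trace := by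
      have h6 : (weyl a * grossWeyl b * ρ * (weyl a)ᴴ).trace = (grossWeyl b * ρ).trace := by
        rw [Matrix.trace_mul_comm, ← mul_assoc, ← mul_assoc, weyl_conjTranspose_mul, one_mul]
      rw [hcomm, Matrix.smul_mul, Matrix.smul_mul, Matrix.trace_smul, smul_eq_mul,
        mul_assoc (grossWeyl b), mul_assoc (grossWeyl b), h1] at h6
      exact h6.symm
    by_contra hne
    exact hab (chi_eq_one.1 (mul_right_cancel₀ hne ((one_mul _).trans h4)).symm)

/-- The Weyl operators of which a vector is an eigenvector. -/
def stabilizerGroup (hd : Odd d) (ψ : Config d n → ℂ) : AddSubgroup (Phase d n) where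
  carrier := {b | ∃ k : ZMod d, grossWeyl b *ᵥ ψ = χ k • ψ}
  zero_mem' := ⟨0, by simp [grossWeyl_zero]⟩
  add_mem' := by
    rintro a b ⟨k, hk⟩ ⟨k', hk'⟩
    refine ⟨k + k' - 2⁻¹ * symp a b, ?_⟩
    have h : grossWeyl (a + b) = χ (-(2⁻¹ * symp a b)) • (grossWeyl a * grossWeyl b) := by
      rw [grossWeyl_mul hd, smul_smul, ← chi_add, neg_add_cancel, AddChar.map_zero_eq_one, one_smul]
    rw [h, Matrix.smul_mulVec, ← Matrix.mulVec_mulVec, hk', Matrix.mulVec_smul, hk, smul_smul,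
      smul_smul, ← chi_add, ← chi_add]
    congr 2
    ring
  neg_mem' := by
    rintro a ⟨k, hk⟩
    refine ⟨-k, ?_⟩
    have h : ψ = χ k • (grossWeyl (-a) *ᵥ ψ) := by
      rw [← Matrix.mulVec_smul, ← hk, Matrix.mulVec_mulVec, ← grossWeyl_conjTranspose hd,
        grossWeyl_conjTranspose_mul, Matrix.one_mulVec]
    conv_rhs => rw [h]
    rw [smul_smul, ← chi_add, neg_add_cancel, AddChar.map_zero_eq_one, one_smul]

lemma chi_smul_inj {ψ : Config d n → ℂ} (hψ : ψ ≠ 0) {j k : ZMod d}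
    (h : (χ j : ℂ) • ψ = χ k • ψ) : j = k :=
  chi_inj.1 (smul_left_injective ℂ hψ h)

/-- On a common eigenvector the commutation phase must be `1`. -/
lemma symp_eq_zero_of_eigenvector {ψ : Config d n → ℂ} (hψ : ψ ≠ 0)
    {a b : Phase d n} {j k : ZMod d} (ha : grossWeyl a *ᵥ ψ = χ j • ψ)
    (hb : grossWeyl b *ᵥ ψ = χ k • ψ) : symp a b = 0 := by
  have h1 : grossWeyl a * grossWeyl b = χ (symp a b) • (grossWeyl b * grossWeyl a) := by
    rw [← Matrix.smul_mul, ← grossWeyl_conj, mul_assoc, grossWeyl_conjTranspose_mul, mul_one]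
  have h2 := congrArg (fun M => M *ᵥ ψ) h1
  simp only [Matrix.smul_mulVec, ← Matrix.mulVec_mulVec, ha, hb, Matrix.mulVec_smul,
    smul_smul, ← chi_add] at h2
  have h3 := chi_smul_inj hψ h2
  linear_combination -h3

open Classical in
/-- The Wigner function of a stabilizer state is uniform on the points compatible with the known
quadratures. -/
lemma grossMatrix_prepare (hd : Odd d) {ψ : Config d n → ℂ} (hψ : IsStabilizerVector ψ)
    (l : Phase d n) (o : Phase d 0) :
    grossMatrix (prepare ψ) l o = if l ∈ knownSet ψ then ((knownSet ψ).ncard : ℂ)⁻¹ else 0 := by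
  set ρ := Matrix.vecMulVec ψ (star ψ) with hρ
  have hK : ∀ l, grossMatrix (prepare ψ) l o = ((d : ℂ) ^ n)⁻¹ * (phasePoint l * ρ).trace := by
    intro l
    rw [grossMatrix_apply, phasePoint_zero hd, prepare_apply, Matrix.one_apply_eq, one_smul]
  set G := stabilizerGroup hd ψ with hG
  choose κ hκ using fun b : G => b.2
  have hκadd : ∀ a b : G, κ (a + b) = κ a + κ b := by
    intro a b
    apply chi_smul_inj hψ.ne_zero
    rw [← hκ, chi_add, mul_smul, AddSubgroup.coe_add, ← grossWeyl_mul_of_symp_eq_zero hd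
      (symp_eq_zero_of_eigenvector hψ.ne_zero (hκ a) (hκ b)), ← Matrix.mulVec_mulVec, hκ b,
      Matrix.mulVec_smul, hκ a, smul_comm]
  -- Only the stabilizer group contributes to the Wigner function, and on it the eigenvalues form a
  -- character; so the sum is the order of the group or zero.
  have hsum : ∀ l, (phasePoint l * ρ).trace =
      ((d : ℂ) ^ n)⁻¹ * if ∀ b : G, symp l b + κ b = 0 then (Fintype.card G : ℂ) else 0 := by
    intro l
    have h1 := sum_chi_eq (AddMonoidHom.mk' (fun b : G => symp l b + κ b) (fun a b => by
      rw [AddSubgroup.coe_add, symp_add_right, hκadd]; ring))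
    simp only [AddMonoidHom.mk'_apply] at h1
    rw [← h1, phasePoint_eq hd, Matrix.smul_mul, Matrix.trace_smul, smul_eq_mul, Finset.sum_mul,
      Matrix.trace_sum]
    congr 1
    have h2 : ∀ b : Phase d n, b ∉ G → (χ (symp l b) • grossWeyl b * ρ).trace = 0 := by
      intro b hb
      rw [Matrix.smul_mul, Matrix.trace_smul, hψ.trace_eq_zero, smul_zero]
      intro c hc
      obtain ⟨j, rfl⟩ := exists_eigenvalue_eq_chi hd hψ.ne_zero hc
      exact hb ⟨j, hc⟩
    rw [← Finset.sum_subset (Finset.subset_univ (Finset.univ.filter (· ∈ G)))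
      (fun b _ hb => h2 b (by simpa using hb)),
      Finset.sum_subtype (p := (· ∈ G)) _ (by simp)]
    refine Finset.sum_congr rfl fun b _ => ?_
    rw [Matrix.smul_mul, Matrix.trace_smul, trace_mul_vecMulVec, hκ b, dotProduct_smul, hψ.1,
      chi_add]
    simp
  have hmem : ∀ l, (∀ b : G, symp l b + κ b = 0) ↔ l ∈ knownSet ψ := by
    intro l
    constructor
    · intro h a j ha
      have haG : a ∈ G := ⟨j, ha⟩
      have h1 := h ⟨a, haG⟩
      have h2 : κ ⟨a, haG⟩ = j := chi_smul_inj hψ.ne_zero (by rw [← hκ ⟨a, haG⟩, ← ha])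
      rw [h2] at h1
      rw [symp_swap]
      linear_combination -h1
    · intro h b
      have h1 := h b (κ b) (hκ b)
      rw [symp_swap, h1]
      ring
  set C : ℂ := ((d : ℂ) ^ n)⁻¹ * (((d : ℂ) ^ n)⁻¹ * Fintype.card G) with hC
  have hval : ∀ l, grossMatrix (prepare ψ) l o = if l ∈ knownSet ψ then C else 0 := by
    intro l
    rw [hK, hsum]
    simp only [hmem]
    split_ifs
    · rfl
    · simp
  -- Normalization identifies the constant value `C` without counting the stabilizer group.
  have htot : ∑ l, grossMatrix (prepare ψ) l o = 1 := by
    simp only [hK]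
    rw [← Finset.mul_sum, ← Matrix.trace_sum, ← Finset.sum_mul, sum_phasePoint hd, Matrix.smul_mul,
      one_mul, Matrix.trace_smul, hρ, trace_vecMulVec_star hψ.1, smul_eq_mul, mul_one,
      inv_mul_cancel₀ pow_dim_ne_zero]
  have hcard : ((knownSet ψ).ncard : ℂ) * C = 1 := by
    rw [← htot]
    simp only [hval]
    rw [Finset.sum_ite, Finset.sum_const_zero, add_zero, Finset.sum_const, nsmul_eq_mul]
    congr 2
    rw [Set.ncard_eq_toFinset_card']
    congr 1
    ext; simp
  rw [hval, eq_inv_of_mul_eq_one_right hcard]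

end Odd

section Odd

variable {d : ℕ} [NeZero d] {n m k n' m' : ℕ}

/-! ### Clifford unitaries -/

/-- Additive functionals on phase space are given by the symplectic form. -/
lemma exists_symp_eq (L : Phase d n →+ ZMod d) : ∃ t, ∀ b, symp t b = L b := by
  -- The symplectic form exchanges momenta and positions, with a sign on the second.
  let t : Phase d n := fun i => (L (Pi.single i (0, 1)), -L (Pi.single i (1, 0)))
  let f : Phase d n →ₗ[ZMod d] ZMod d :=
    (AddMonoidHom.mk' (fun b => symp t b) (symp_add_right t)).toZModLinearMap d
  have h : f = L.toZModLinearMap d := by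
    refine LinearMap.pi_ext' fun i => LinearMap.prod_ext (LinearMap.ext_ring ?_)
      (LinearMap.ext_ring ?_)
    · change symp t (Pi.single i (1, 0)) = L (Pi.single i (1, 0))
      rw [symp, Finset.sum_eq_single i]
      · simp [t]
      · intro j _ hj
        simp [Pi.single_eq_of_ne hj]
      · simp
    · change symp t (Pi.single i (0, 1)) = L (Pi.single i (0, 1))
      rw [symp, Finset.sum_eq_single i]
      · simp [t]
      · intro j _ hj
        simp [Pi.single_eq_of_ne hj]
      · simp
  exact ⟨t, fun b => LinearMap.congr_fun h b⟩

/-- In odd dimension, Clifford unitaries act on phase space by affine symplectic maps. -/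
lemma IsClifford.exists_symplectic (hd : Odd d) {U : Op d n} (hU : IsClifford U) :
    ∃ (S : Phase d n →ₗ[ZMod d] Phase d n) (t : Phase d n),
      (∀ a b, symp (S a) (S b) = symp a b) ∧
      (∀ a, U * grossWeyl a * Uᴴ = (χ (symp t (S a)) : ℂ) • grossWeyl (S a)) ∧
      ∀ a, conjBy U (phasePoint a) = phasePoint (S a + t) := by
  choose f c hfc using hU.2
  have hinj : Function.Injective f := hU.label_injective hfc
  have hc0 : ∀ a, c a ≠ 0 := fun a => ne_zero_of_conj_weyl hU (hfc a)
  set c' : Phase d n → ℂ := fun a => χ (-halfPQ a) * (c a * χ (halfPQ (f a))) with hc'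
  have hc'0 : ∀ a, c' a ≠ 0 := fun a =>
    mul_ne_zero (chi_ne_zero _) (mul_ne_zero (hc0 a) (chi_ne_zero _))
  have hf : ∀ a, U * grossWeyl a * Uᴴ = c' a • grossWeyl (f a) := by
    intro a
    rw [grossWeyl_eq, Matrix.mul_smul, Matrix.smul_mul, hfc, weyl_eq_grossWeyl, smul_smul,
      smul_smul, hc', mul_assoc]
  -- Conjugation preserves the product rule. Comparing labels gives additivity of `f`, and comparing
  -- phases gives `hphase`.
  have hmul : ∀ a b, (χ (2⁻¹ * symp a b) * c' (a + b)) • grossWeyl (f (a + b)) =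
      (c' a * c' b * χ (2⁻¹ * symp (f a) (f b))) • grossWeyl (f a + f b) := by
    intro a b
    have h1 : U * (grossWeyl a * grossWeyl b) * Uᴴ =
        (U * grossWeyl a * Uᴴ) * (U * grossWeyl b * Uᴴ) := by
      calc U * (grossWeyl a * grossWeyl b) * Uᴴ
          = U * grossWeyl a * 1 * grossWeyl b * Uᴴ := by simp only [mul_assoc, one_mul]
        _ = _ := by rw [← hU.conjTranspose_mul]; simp only [mul_assoc]
    rw [grossWeyl_mul hd, Matrix.mul_smul, Matrix.smul_mul, hf, hf, hf, Matrix.smul_mul,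
      Matrix.mul_smul, grossWeyl_mul hd, smul_smul, smul_smul, smul_smul] at h1
    exact h1
  have hadd : ∀ a b, f (a + b) = f a + f b := fun a b =>
    (grossWeyl_label_unique (mul_ne_zero (chi_ne_zero _) (hc'0 _)) (hmul a b)).1
  have hphase : ∀ a b, χ (2⁻¹ * symp a b) * c' (a + b) =
      c' a * c' b * χ (2⁻¹ * symp (f a) (f b)) := fun a b =>
    (grossWeyl_label_unique (mul_ne_zero (chi_ne_zero _) (hc'0 _)) (hmul a b)).2
  -- Comparing `hphase` for the two orders of `a` and `b` eliminates `c'`.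
  have hsymp : ∀ a b, symp (f a) (f b) = symp a b := by
    intro a b
    have h1 := hphase a b
    have h2 := hphase b a
    rw [add_comm b a, mul_comm (c' b) (c' a)] at h2
    have h3 : χ (2⁻¹ * symp a b) * χ (2⁻¹ * symp (f b) (f a)) =
        χ (2⁻¹ * symp b a) * χ (2⁻¹ * symp (f a) (f b)) := by
      apply mul_right_cancel₀ (mul_ne_zero (hc'0 (a + b)) (mul_ne_zero (hc'0 a) (hc'0 b)))
      linear_combination (c' a * c' b * χ (2⁻¹ * symp (f b) (f a))) * h1 -
        (c' a * c' b * χ (2⁻¹ * symp (f a) (f b))) * h2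
    rw [← chi_add, ← chi_add, chi_inj, symp_swap b a, symp_swap (f b) (f a)] at h3
    linear_combination -h3 + (symp a b - symp (f a) (f b)) * two_mul_inv_two hd
  have hc'add : ∀ a b, c' (a + b) = c' a * c' b := by
    intro a b
    have h1 := hphase a b
    rw [hsymp, mul_comm] at h1
    exact mul_right_cancel₀ (chi_ne_zero _) h1
  -- Now `c'` is a character of a group of exponent `d`, so it has the form `χ ∘ κ` with `κ`
  -- additive.
  have hc'root : ∀ a, ∃ k : ZMod d, c' a = χ k := by
    intro a
    apply exists_chi_eq
    have h0 : c' 0 = 1 := by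
      have := hc'add 0 0
      rw [add_zero] at this
      exact (mul_right_cancel₀ (hc'0 0) ((one_mul _).trans this)).symm
    have hpow : ∀ j : ℕ, c' ((j : ZMod d) • a) = c' a ^ j := by
      intro j
      induction j with
      | zero => simp [h0]
      | succ j ih => rw [Nat.cast_succ, add_smul, one_smul, hc'add, ih, pow_succ]
    rw [← hpow, ZMod.natCast_self, zero_smul, h0]
  choose κ hκ using hc'root
  have hκadd : ∀ a b, κ (a + b) = κ a + κ b := by
    intro a b
    rw [← chi_inj, chi_add, ← hκ, ← hκ, ← hκ, hc'add]
  let F : Phase d n →+ Phase d n := AddMonoidHom.mk' f hadd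
  let Fe : Phase d n ≃+ Phase d n :=
    AddEquiv.ofBijective F (Finite.injective_iff_bijective.1 hinj)
  -- The translation is paired with the image point `f a`, whence the inverse of `f`.
  obtain ⟨t, ht⟩ := exists_symp_eq ((AddMonoidHom.mk' κ hκadd).comp Fe.symm.toAddMonoidHom)
  have hconj : ∀ a, U * grossWeyl a * Uᴴ = (χ (symp t (f a)) : ℂ) • grossWeyl (f a) := by
    intro a
    rw [hf, hκ, ht]
    refine congrArg (fun k => (χ k : ℂ) • grossWeyl (f a)) ?_
    change κ a = κ (Fe.symm (Fe a))
    rw [AddEquiv.symm_apply_apply]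
  refine ⟨F.toZModLinearMap d, t, hsymp, hconj, fun a => ?_⟩
  change U * phasePoint a * Uᴴ = phasePoint (f a + t)
  rw [phasePoint_eq hd, phasePoint_eq hd, Matrix.mul_smul, Matrix.smul_mul, Finset.mul_sum,
    Finset.sum_mul]
  congr 1
  rw [← Equiv.sum_comp Fe.toEquiv (fun b => χ (symp (f a + t) b) • grossWeyl b)]
  refine Finset.sum_congr rfl fun b _ => ?_
  rw [Matrix.mul_smul, Matrix.smul_mul, hconj, smul_smul, ← chi_add, ← hsymp a b, ← symp_add_left]
  rfl

/-! ### Measurements -/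

/-- A nonzero vector in the range shows that the rescaled eigenvalue is some `χ j`; uniqueness of
the spectral projector does the rest. -/
lemma IsSpectralProjector.exists_eq_isoProj (hd : Odd d) {a : Phase d n} {z : ℂ} {P : Op d n}
    (hP : IsSpectralProjector a z P) :
    ∃ j : ZMod d, z = χ (halfPQ a + j) ∧ P = isoProj (fun i : ZMod d => grossWeyl (i • a)) j := by
  obtain ⟨φ, hφ, hPφ⟩ : ∃ φ, φ ≠ 0 ∧ P *ᵥ φ = φ := by
    by_contra! h
    apply hP.ne_zero
    refine Matrix.ext_of_mulVec_single fun i => ?_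
    rw [Matrix.zero_mulVec]
    by_contra hne
    exact h _ hne (by rw [Matrix.mulVec_mulVec, hP.idempotent])
  have h1 : grossWeyl a *ᵥ φ = (χ (-halfPQ a) * z) • φ := by
    rw [grossWeyl_eq, Matrix.smul_mulVec, (hP.range_eq φ).1 hPφ, smul_smul]
  obtain ⟨j, hj⟩ := exists_eigenvalue_eq_chi hd hφ h1
  have hu := isCyclicRep_grossWeyl hd a
  refine ⟨j, ?_, ?_⟩
  · rw [chi_add, ← hj, ← mul_assoc, ← chi_add, add_neg_cancel, AddChar.map_zero_eq_one, one_mul]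
  · refine hP.unique (hu.isSpectralProjector (chi_ne_zero (-halfPQ a)) ?_ hj ?_)
    · rw [one_smul, grossWeyl_eq]
    · intro h0
      have h2 := (hu.isoProj_mulVec_iff j φ).2 (by rw [one_smul, h1, hj])
      rw [h0, Matrix.zero_mulVec] at h2
      exact hφ h2.symm

/-- A measurement of a quadrature reveals its value and randomizes the conjugate one. -/
lemma conjBy_isoProj_phasePoint (hd : Odd d) (a l : Phase d n) (j : ZMod d) :
    conjBy (isoProj (fun i : ZMod d => grossWeyl (i • a)) j) (phasePoint l) =
      if symp a l = j then (d : ℂ)⁻¹ • ∑ i : ZMod d, phasePoint (l + i • a) else 0 := by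
  have hu := isCyclicRep_grossWeyl hd a
  set u := fun i : ZMod d => grossWeyl (i • a) with hu'
  set P := isoProj u j with hP
  set B := ∑ i : ZMod d, phasePoint (l + i • a) with hB
  -- Moving `u i` to the right of the phase point operator translates it by `i • a`; the trailing
  -- `P` absorbs `u i` and cancels the phase.
  have h1 : P * phasePoint l * P = (d : ℂ)⁻¹ • (B * P) := by
    change ((d : ℂ)⁻¹ • ∑ i : ZMod d, χ (-(i * j)) • u i) * phasePoint l * P = _
    rw [Matrix.smul_mul, Matrix.smul_mul, Finset.sum_mul, Finset.sum_mul, hB, Finset.sum_mul]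
    congr 1
    refine Finset.sum_congr rfl fun i _ => ?_
    have h2 : u i * phasePoint l = phasePoint (l + i • a) * u i := by
      rw [← grossWeyl_conj_phasePoint hd, mul_assoc, hu', grossWeyl_conjTranspose_mul, mul_one]
    rw [Matrix.smul_mul, Matrix.smul_mul, h2, mul_assoc, hP, hu.mul_isoProj, Matrix.mul_smul,
      smul_smul, ← chi_add, neg_add_cancel, AddChar.map_zero_eq_one, one_smul]
  -- Summing along the direction `a` removes every Weyl operator that does not commute with that of
  -- `a`. So `B` absorbs each `u i` up to a phase (`hBu`), and `B * P` is `B` or zero.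
  have hB2 : B = ((d : ℂ) ^ n)⁻¹ • ∑ b : Phase d n,
      ((if symp a b = 0 then (d : ℂ) else 0) * χ (symp l b)) • grossWeyl b := by
    rw [hB]
    simp only [phasePoint_eq hd]
    rw [← Finset.smul_sum, Finset.sum_comm]
    congr 1
    refine Finset.sum_congr rfl fun b _ => ?_
    rw [← Finset.sum_smul, ← sum_chi_mul, Finset.sum_mul]
    congr 1
    refine Finset.sum_congr rfl fun i _ => ?_
    rw [← chi_add, symp_add_left, symp_smul_left, add_comm]
  have hBu : ∀ i, B * u i = χ (i * symp a l) • B := by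
    intro i
    rw [hB2, Matrix.smul_mul, smul_comm (χ (i * symp a l))]
    congr 1
    rw [Finset.sum_mul, Finset.smul_sum]
    rw [← Equiv.sum_comp (Equiv.addRight (i • a)) (fun b => χ (i * symp a l) •
      ((if symp a b = 0 then (d : ℂ) else 0) * χ (symp l b)) • grossWeyl b)]
    refine Finset.sum_congr rfl fun b _ => ?_
    rw [Equiv.coe_addRight, symp_add_right, symp_smul_right, symp_self, mul_zero, add_zero]
    by_cases hab : symp a b = 0
    · rw [if_pos hab, Matrix.smul_mul, hu', grossWeyl_mul_of_symp_eq_zero hd (by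
        rw [symp_smul_right, symp_swap, hab]; ring), smul_smul, mul_left_comm, ← chi_add]
      congr 3
      rw [symp_add_right, symp_smul_right, symp_swap a l]
      ring
    · simp only [if_neg hab, zero_mul, zero_smul, smul_zero]
  have hBP : B * P = if symp a l = j then B else 0 := by
    rw [hP, isoProj, Matrix.mul_smul, Finset.mul_sum]
    have h2 : ∀ i : ZMod d, B * χ (-(i * j)) • u i = χ (i * (symp a l - j)) • B := by
      intro i
      rw [Matrix.mul_smul, hBu, smul_smul, ← chi_add]
      congr 2
      ring
    simp only [h2]
    rw [← Finset.sum_smul, sum_chi_mul, smul_smul]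
    by_cases h : symp a l = j
    · rw [if_pos (sub_eq_zero.2 h), if_pos h, inv_mul_cancel₀ natCast_dim_ne_zero, one_smul]
    · rw [if_neg (fun h' => h (sub_eq_zero.1 h')), if_neg h, mul_zero, zero_smul]
  rw [conjBy_apply, hu.isoProj_isHermitian j, h1, hBP]
  split_ifs <;> simp

/-- The cardinality counts parameters and not points: if `a` is not free, several `i` give the same
translate. -/
lemma grossMatrix_conjBy_isoProj (hd : Odd d) (a : Phase d n) (j : ZMod d) (l' l : Phase d n) :
    grossMatrix (conjBy (isoProj (fun i : ZMod d => grossWeyl (i • a)) j)) l' l =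
      if symp a l = j then ({i : ZMod d | l' = l + i • a}.ncard : ℂ) / d else 0 := by
  rw [grossMatrix_apply, conjBy_isoProj_phasePoint hd]
  split_ifs with h
  · rw [Matrix.mul_smul, Finset.mul_sum, Matrix.trace_smul, Matrix.trace_sum]
    simp only [trace_phasePoint_mul hd]
    rw [← Finset.sum_filter, Finset.sum_const, nsmul_eq_mul, smul_eq_mul, Set.ncard_eq_toFinset_card',
      Set.toFinset_ofPred]
    have := pow_dim_ne_zero (d := d) (n := n)
    field_simp
  · simp

/-! ### Gross's representation is substochastic -/

/-- Complex matrices which are real, nonnegative and substochastic. -/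
def IsSubstochastic {α β : Type*} [Fintype α] (K : Matrix α β ℂ) : Prop :=
  ∃ A : Matrix α β ℝ, (∀ i j, K i j = A i j) ∧ (∀ i j, 0 ≤ A i j) ∧ ∀ j, ∑ i, A i j ≤ 1

lemma sum_grossMatrix (hd : Odd d) (T : SuperOp d n m) (l : Phase d n) :
    ∑ l', grossMatrix T l' l = (T (phasePoint l)).trace := by
  simp only [grossMatrix_apply]
  rw [← Finset.mul_sum, ← Matrix.trace_sum, ← Finset.sum_mul, sum_phasePoint hd, Matrix.smul_mul,
    one_mul, Matrix.trace_smul, smul_eq_mul, inv_mul_cancel_left₀ pow_dim_ne_zero]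

lemma isSubstochastic_of_map (hd : Odd d) {T : SuperOp d n m} (f : Phase d n → Phase d m)
    (h : ∀ a, T (phasePoint a) = phasePoint (f a)) : IsSubstochastic (grossMatrix T) := by
  refine ⟨Matrix.of fun a' a => if a' = f a then 1 else 0, fun a' a => ?_, fun a' a => ?_,
    fun a => ?_⟩
  · rw [grossMatrix_of_apply hd (h a), Matrix.of_apply]
    split_ifs <;> simp
  · rw [Matrix.of_apply]; split_ifs <;> norm_num
  · simp

-- Generators are uniform distributions, maps of phase space or randomized indicator functions;
-- substochasticity survives composition, products and mixtures.
open Classical in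
lemma isSubstochastic_eval (hd : Odd d) {N : ℕ∞} (P : Proc d N n m) :
    IsSubstochastic (grossMatrix P.eval) := by
  induction P with
  | @prep n hn ψ hψ =>
    refine ⟨Matrix.of fun l _ => if l ∈ knownSet ψ then ((knownSet ψ).ncard : ℝ)⁻¹ else 0,
      fun l o => ?_, fun l o => ?_, fun o => ?_⟩
    · rw [Proc.eval, grossMatrix_prepare hd hψ, Matrix.of_apply]
      split_ifs <;> simp
    · rw [Matrix.of_apply]; split_ifs <;> positivity
    · simp only [Matrix.of_apply]
      rw [Finset.sum_ite, Finset.sum_const_zero, add_zero, Finset.sum_const, nsmul_eq_mul,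
        Set.ncard_eq_toFinset_card']
      have : (Finset.univ.filter (· ∈ knownSet ψ)).card = (knownSet ψ).toFinset.card := by
        congr 1; ext; simp
      rw [this]
      exact mul_inv_le_one
  | gate hn U hU =>
    obtain ⟨S, t, -, -, h⟩ := hU.exists_symplectic hd
    exact isSubstochastic_of_map hd _ h
  | @meas n hn a z P hP =>
    obtain ⟨j, -, rfl⟩ := hP.exists_eq_isoProj hd
    refine ⟨Matrix.of fun l' l => if symp a l = j then
      ({i : ZMod d | l' = l + i • a}.ncard : ℝ) / d else 0, fun l' l => ?_, fun l' l => ?_,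
      fun l => ?_⟩
    · rw [Proc.eval, grossMatrix_conjBy_isoProj hd, Matrix.of_apply]
      split_ifs <;> simp
    · rw [Matrix.of_apply]; split_ifs <;> positivity
    · have h := sum_grossMatrix hd (conjBy (isoProj (fun i : ZMod d => grossWeyl (i • a)) j)) l
      simp only [grossMatrix_conjBy_isoProj hd, conjBy_isoProj_phasePoint hd, Matrix.of_apply] at h ⊢
      by_cases hl : symp a l = j
      · simp only [hl, if_true] at h ⊢
        rw [Matrix.trace_smul, Matrix.trace_sum] at h
        simp only [trace_phasePoint hd, Finset.sum_const, Finset.card_univ, ZMod.card, nsmul_eq_mul,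
          mul_one, smul_eq_mul, inv_mul_cancel₀ (natCast_dim_ne_zero (d := d))] at h
        apply le_of_eq
        rw [← Complex.ofReal_inj]
        push_cast
        exact h
      · simp [hl]
  | @discard n hn =>
    exact isSubstochastic_of_map hd (fun _ => 0) fun a => by
      rw [Proc.eval, discardOp_apply, trace_phasePoint hd, one_smul, phasePoint_zero hd]
  | wires hn σ => exact isSubstochastic_of_map hd _ (conjBy_wireMatrix_phasePoint hd σ)
  | @seq n m k S T hS hT =>
    obtain ⟨A, hA, hA0, hA1⟩ := hS
    obtain ⟨B, hB, hB0, hB1⟩ := hT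
    refine ⟨A * B, fun i j => ?_, fun i j => ?_, fun j => ?_⟩
    · rw [Proc.eval, grossMatrix_comp hd, Matrix.mul_apply, Matrix.mul_apply]
      push_cast
      exact Finset.sum_congr rfl fun b _ => by rw [hA, hB]
    · rw [Matrix.mul_apply]
      exact Finset.sum_nonneg fun b _ => mul_nonneg (hA0 _ _) (hB0 _ _)
    · simp only [Matrix.mul_apply]
      rw [Finset.sum_comm]
      simp only [← Finset.sum_mul]
      exact (Finset.sum_le_sum fun b _ => mul_le_of_le_one_left (hB0 b j) (hA1 b)).trans (hB1 j)
  | @par n m n' m' hn hm T T' hT hT' =>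
    obtain ⟨A, hA, hA0, hA1⟩ := hT
    obtain ⟨B, hB, hB0, hB1⟩ := hT'
    refine ⟨parMatrix A B, fun i j => ?_, fun i j => mul_nonneg (hA0 _ _) (hB0 _ _), fun j => ?_⟩
    · rw [Proc.eval, grossMatrix_par hd, parMatrix_apply, parMatrix_apply, hA, hB]
      push_cast
      rfl
    · simp only [sum_append, parMatrix_apply, append_comp_castAdd, append_comp_natAdd]
      rw [← Finset.sum_mul_sum]
      exact mul_le_one₀ (hA1 _) (Finset.sum_nonneg fun b _ => hB0 _ _) (hB1 _)
  | mix p hp hp' T T' hT hT' =>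
    obtain ⟨A, hA, hA0, hA1⟩ := hT
    obtain ⟨B, hB, hB0, hB1⟩ := hT'
    have hq : 0 ≤ 1 - p := by linarith
    refine ⟨p • A + (1 - p) • B, fun i j => ?_, fun i j => ?_, fun j => ?_⟩
    · rw [Proc.eval, grossMatrix_add, grossMatrix_smul, grossMatrix_smul]
      simp only [Matrix.add_apply, Matrix.smul_apply, smul_eq_mul, hA, hB]
      push_cast
      rfl
    · simp only [Matrix.add_apply, Matrix.smul_apply, smul_eq_mul]
      exact add_nonneg (mul_nonneg hp (hA0 _ _)) (mul_nonneg hq (hB0 _ _))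
    · simp only [Matrix.add_apply, Matrix.smul_apply, smul_eq_mul]
      rw [Finset.sum_add_distrib, ← Finset.mul_sum, ← Finset.mul_sum]
      nlinarith [hA1 j, hB1 j]

end Odd

/-! ## Uniqueness in odd dimension -/

section Parity

variable {d : ℕ} [NeZero d] {n : ℕ}

/-- The parity operator. -/
def parityGate (d : ℕ) [NeZero d] (n : ℕ) : Op d n := Matrix.of fun x y => if x = -y then 1 else 0

lemma parityGate_conj_apply (M : Op d n) (x y : Config d n) :
    (parityGate d n * M * (parityGate d n)ᴴ) x y = M (-x) (-y) := by
  have h : ∀ x u : Config d n, x = -u ↔ u = -x := fun x u =>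
    ⟨fun h => by rw [h, neg_neg], fun h => by rw [h, neg_neg]⟩
  simp only [Matrix.mul_apply, Matrix.conjTranspose_apply, parityGate, Matrix.of_apply, h]
  simp

lemma parityGate_conj_weyl (a : Phase d n) :
    parityGate d n * weyl a * (parityGate d n)ᴴ = weyl (-a) := by
  ext x y
  rw [parityGate_conj_apply, weyl_apply, weyl_apply]
  by_cases h : x = y + pos (-a)
  · rw [if_pos h, if_pos (by rw [h, pos_neg]; abel), mom_neg, neg_dotProduct, dotProduct_neg]
  · rw [if_neg h, if_neg]
    intro h'
    exact h (by rw [← neg_neg x, h', pos_neg]; abel)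

lemma parityGate_conj_grossWeyl (a : Phase d n) :
    parityGate d n * grossWeyl a * (parityGate d n)ᴴ = grossWeyl (-a) := by
  rw [grossWeyl_eq, grossWeyl_eq, Matrix.mul_smul, Matrix.smul_mul, parityGate_conj_weyl]
  simp [halfPQ_eq]

lemma parityGate_conj_conj (M : Op d n) :
    parityGate d n * (parityGate d n * M * (parityGate d n)ᴴ) * (parityGate d n)ᴴ = M := by
  ext x y
  rw [parityGate_conj_apply, parityGate_conj_apply, neg_neg, neg_neg]

lemma isClifford_parityGate : IsClifford (parityGate d n) := by
  refine ⟨?_, fun a => ⟨-a, 1, by rw [parityGate_conj_weyl, one_smul]⟩⟩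
  rw [Matrix.mem_unitaryGroup_iff, Matrix.star_eq_conjTranspose]
  ext x y
  have := parityGate_conj_apply (1 : Op d n) x y
  rw [mul_one] at this
  rw [this, Matrix.one_apply, Matrix.one_apply]
  simp

lemma weyl_conj_eq_grossWeyl_conj (c : Phase d n) (M : Op d n) :
    weyl c * M * (weyl c)ᴴ = grossWeyl c * M * (grossWeyl c)ᴴ := by
  rw [weyl_eq_grossWeyl, Matrix.conjTranspose_smul, Matrix.smul_mul, Matrix.smul_mul,
    Matrix.mul_smul, smul_smul, chi_mul_star, one_smul]

end Parity

namespace PosRep.IsFrame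

variable {d : ℕ} [NeZero d] {N : ℕ∞} {Λ : Type u} [Fintype Λ] {R : PosRep d N Λ}
  {Φ : Op d 1 ≃ₗ[ℂ] ((Fin 1 → Λ) → ℂ)} (hΦ : R.IsFrame Φ)

lemma eq_of_forall {l l' : Fin 1 → Λ} (h : ∀ M, Φ M l = Φ M l') : l = l' := by
  classical
  have := h (Φ.symm (Pi.single l 1))
  rw [LinearEquiv.apply_symm_apply, Pi.single_eq_same, Pi.single_apply] at this
  by_contra hne
  rw [if_neg (Ne.symm hne)] at this
  exact one_ne_zero this

include hΦ

/-- In odd dimension, some ontic state is invariant under parity. -/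
lemma exists_parity_fixed (hd : Odd d) (hN : 1 ≤ N) :
    ∃ l, ∀ M, Φ (parityGate d 1 * M * (parityGate d 1)ᴴ) l = Φ M l := by
  classical
  obtain ⟨π, hπ⟩ := hΦ.exists_perm hN (isClifford_parityGate (d := d) (n := 1))
  have h2 : π ^ 2 ^ 1 = 1 := by
    ext1 l
    rw [pow_one, pow_two, Equiv.Perm.mul_apply, Equiv.Perm.one_apply]
    exact eq_of_forall (Φ := Φ) fun M => by
      conv_lhs => rw [← parityGate_conj_conj M]
      rw [hπ, hπ]
  -- An involution of a set of `d ^ 2` points, an odd number, has a fixed point.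
  have hodd : ¬ 2 ∣ Fintype.card (Fin 1 → Λ) := by
    rw [hΦ.card_eq, ← even_iff_two_dvd, Nat.not_even_iff_odd]
    simp only [Phase, Fintype.card_fun, Fintype.card_prod, ZMod.card, Fintype.card_fin]
    exact (hd.mul hd).pow
  obtain ⟨l, hl⟩ := Equiv.Perm.exists_fixed_point_of_prime hodd h2
  refine ⟨l, fun M => ?_⟩
  conv_lhs => rw [← hl]
  exact hπ M l

lemma sum_eq_trace (hN : 1 ≤ N) (M : Op d 1) : ∑ l, Φ M l = M.trace := by
  have hN1 : ((1 : ℕ) : ℕ∞) ≤ N := by exact_mod_cast hN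
  have h := hΦ.effect _ (isProcess_discard hN1) M
  rw [R.map_discard hN1, discardOp_apply] at h
  simpa using h.symm

/-- The identity operator is invariant under translations, so `Φ 1` is constant; its `d ^ 2` values
add up to the trace `d`. -/
lemma one_apply (hN : 1 ≤ N) (l : Fin 1 → Λ) : Φ 1 l = (d : ℂ)⁻¹ := by
  have hconst : ∀ l', Φ 1 l' = Φ 1 l := by
    intro l'
    obtain ⟨b, hb⟩ := hΦ.exists_translation hN l l'
    have := hb 1
    rwa [mul_one, weyl_mul_conjTranspose] at this
  have h := hΦ.sum_eq_trace hN 1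
  simp only [hconst, Finset.sum_const, Finset.card_univ, hΦ.card_eq] at h
  rw [Matrix.trace_one] at h
  simp only [Phase, Config, Fintype.card_fun, Fintype.card_prod, ZMod.card, Fintype.card_fin,
    pow_one, nsmul_eq_mul, Nat.cast_mul] at h
  have hd0 := natCast_dim_ne_zero (d := d)
  rw [mul_assoc] at h
  exact eq_inv_of_mul_eq_one_right (mul_left_cancel₀ hd0 (h.trans (mul_one _).symm))

/-- At a parity-invariant ontic state, all Weyl operators have the value `1`. -/
lemma grossWeyl_apply (hd : Odd d) (hN : 1 ≤ N) {l : Fin 1 → Λ}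
    (hl : ∀ M, Φ (parityGate d 1 * M * (parityGate d 1)ᴴ) l = Φ M l) (a : Phase d 1) :
    Φ (grossWeyl a) l = (d : ℂ)⁻¹ := by
  classical
  obtain ⟨v, i, hv, rfl⟩ := exists_isFree a
  have hu := isCyclicRep_grossWeyl hd v
  set Q := isoProj fun j : ZMod d => grossWeyl (j • v) with hQdef
  have hQ : ∀ k, IsSharp (Q k) := hu.isSharp hv fun j => ⟨_, chi_ne_zero (-halfPQ (j • v)), rfl⟩
  have hS : ∀ k, IsProcess N (stateOp (Q k)) := fun k => isProcess_stateOp hN (hQ k)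
  have hE : ∀ k, IsProcess N (effectOp (Q k)) := fun k => isProcess_effectOp hN (hQ k)
  set μ : ZMod d → (Fin 1 → Λ) → ℝ := fun k l => R.map (stateOp (Q k)) l ![] with hμdef
  set ε : ZMod d → (Fin 1 → Λ) → ℝ := fun k l => R.map (effectOp (Q k)) ![] l with hεdef
  have hμ : ∀ k l, Φ (Q k) l = μ k l := by
    intro k l
    have := hΦ.state _ (hS k) l
    rwa [stateOp_apply, Matrix.one_apply_eq, one_smul] at this
  have hε : ∀ k M, (Q k * M).trace = ∑ l, (ε k l : ℂ) * Φ M l := by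
    intro k M
    have := hΦ.effect _ (hE k) M
    rwa [effectOp_apply, Matrix.smul_apply, Matrix.one_apply_eq, smul_eq_mul, mul_one] at this
  -- The operator represented by the point mass at `l` has trace one, and the projectors `Q k`
  -- resolve the identity.
  have hεsum : ∀ l, ∑ k, ε k l = 1 := by
    intro l
    set M := Φ.symm (Pi.single l 1) with hM
    have hΦM : Φ M = Pi.single l 1 := by rw [hM, LinearEquiv.apply_symm_apply]
    have h1 : ∀ k, (Q k * M).trace = ε k l := by
      intro k
      rw [hε, hΦM]
      simp [Pi.single_apply]
    have h2 : ∑ k, (Q k * M).trace = M.trace := by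
      rw [← Matrix.trace_sum, ← Finset.sum_mul, hu.sum_isoProj, one_mul]
    have h3 : M.trace = 1 := by
      rw [← hΦ.sum_eq_trace hN, hΦM]
      simp
    rw [← Complex.ofReal_inj]
    push_cast
    simp only [← h1, h2, h3]
  -- The trace of `Q j * Q k` vanishes and is a sum of nonnegative terms.
  have horth : ∀ j k, j ≠ k → ∀ l, ε j l * μ k l = 0 := by
    intro j k hjk l
    have h1 := hε j (Q k)
    rw [hu.isoProj_mul, if_neg hjk, Matrix.trace_zero] at h1
    simp only [hμ] at h1
    have h2 : ∑ l, ε j l * μ k l = 0 := by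
      rw [← Complex.ofReal_inj]
      push_cast
      exact h1.symm
    exact (Finset.sum_eq_zero_iff_of_nonneg fun l _ => mul_nonneg (R.nonneg _ (hE j) _ _)
      (R.nonneg _ (hS k) _ _)).1 h2 l (Finset.mem_univ _)
  have hpar : ∀ k, μ (-k) l = μ k l := by
    intro k
    have h1 : parityGate d 1 * Q k * (parityGate d 1)ᴴ = Q (-k) := by
      rw [hQdef, isoProj, isoProj, Matrix.mul_smul, Matrix.smul_mul, Finset.mul_sum, Finset.sum_mul]
      congr 1
      rw [← Equiv.sum_comp (Equiv.neg (ZMod d)) (fun j => χ (-(j * -k)) • grossWeyl (j • v))]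
      refine Finset.sum_congr rfl fun j _ => ?_
      rw [Matrix.mul_smul, Matrix.smul_mul, parityGate_conj_grossWeyl, Equiv.neg_apply, neg_smul,
        neg_mul_neg]
    rw [← Complex.ofReal_inj, ← hμ, ← hμ, ← h1, hl]
  -- Since `d` is odd, `-k ≠ k`. Every `j` differs from `k` or from `-k`, and both states have the
  -- same weight at `l`; so every response function would vanish there if the weight did not.
  have hzero : ∀ k, k ≠ 0 → μ k l = 0 := by
    intro k hk
    have hkk : k ≠ -k := by
      intro h
      apply hk
      have h2 : (2 : ZMod d) * k = 0 := by linear_combination h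
      calc k = (2 * 2⁻¹) * k := by rw [two_mul_inv_two hd, one_mul]
        _ = 2⁻¹ * (2 * k) := by ring
        _ = 0 := by rw [h2, mul_zero]
    have h1 : ∀ j, ε j l * μ k l = 0 := by
      intro j
      by_cases hj : j = k
      · rw [← hpar, hj]
        exact horth k (-k) hkk l
      · exact horth j k hj l
    calc μ k l = ∑ j, ε j l * μ k l := by rw [← Finset.sum_mul, hεsum, one_mul]
      _ = 0 := Finset.sum_eq_zero fun j _ => h1 j
  have hexp : ∀ j : ZMod d, Φ (grossWeyl (j • v)) l = Φ (Q 0) l := by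
    intro j
    have h1 : grossWeyl (j • v) = ∑ k, χ (j * k) • Q k := hu.eq_sum_isoProj j
    rw [h1, map_sum, Finset.sum_apply, Finset.sum_eq_single 0]
    · simp
    · intro k _ hk
      rw [map_smul, Pi.smul_apply, hμ, hzero k hk]
      simp
    · simp
  have h0 := hexp 0
  rw [zero_smul, grossWeyl_zero, hΦ.one_apply hN] at h0
  rw [hexp, h0]

/-- The frame of a nonnegative representation of one qudit consists of the phase point operators. -/
lemma exists_label (hd : Odd d) (hN : 1 ≤ N) :
    ∃ e : Λ ≃ ZMod d × ZMod d, ∀ M l, Φ M l = (d : ℂ)⁻¹ * (phasePoint (e ∘ l) * M).trace := by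
  obtain ⟨l₀, hl₀⟩ := hΦ.exists_parity_fixed hd hN
  have hbase : ∀ M, Φ M l₀ = (d : ℂ)⁻¹ * (phasePoint 0 * M).trace := by
    have h : (LinearMap.proj l₀ : ((Fin 1 → Λ) → ℂ) →ₗ[ℂ] ℂ) ∘ₗ Φ.toLinearMap =
        (d : ℂ)⁻¹ • (Matrix.traceLinearMap _ ℂ ℂ ∘ₗ LinearMap.mulLeft ℂ (phasePoint 0)) := by
      refine linearMap_ext_grossWeyl fun a => ?_
      change Φ (grossWeyl a) l₀ = (d : ℂ)⁻¹ * (phasePoint 0 * grossWeyl a).trace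
      rw [trace_phasePoint_mul_grossWeyl hd, symp_zero_right, AddChar.map_zero_eq_one, mul_one,
        hΦ.grossWeyl_apply hd hN hl₀]
    exact fun M => LinearMap.congr_fun h M
  -- Label each ontic state by a translation that reaches it from `l₀`. The label determines
  -- evaluation at the state, and the cardinalities agree.
  choose f hf using hΦ.exists_translation hN l₀
  have hf' : ∀ l M, Φ M l = Φ ((weyl (f l))ᴴ * M * weyl (f l)) l₀ := by
    intro l M
    have hM : weyl (f l) * ((weyl (f l))ᴴ * M * weyl (f l)) * (weyl (f l))ᴴ = M := by
      calc _ = (weyl (f l) * (weyl (f l))ᴴ) * M * (weyl (f l) * (weyl (f l))ᴴ) := by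
            simp only [mul_assoc]
        _ = M := by rw [weyl_mul_conjTranspose, one_mul, mul_one]
    have := hf l ((weyl (f l))ᴴ * M * weyl (f l))
    rwa [hM] at this
  have hinj : Function.Injective f := fun l l' h => eq_of_forall (Φ := Φ) fun M =>
    (hf' l M).trans (by rw [h]; exact (hf' l' M).symm)
  have hbij := (Fintype.bijective_iff_injective_and_card f).2 ⟨hinj, hΦ.card_eq⟩
  refine ⟨(Equiv.funUnique (Fin 1) Λ).symm.trans ((Equiv.ofBijective f hbij).trans
    (Equiv.funUnique (Fin 1) (ZMod d × ZMod d))), fun M l => ?_⟩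
  have he : (⇑((Equiv.funUnique (Fin 1) Λ).symm.trans ((Equiv.ofBijective f hbij).trans
      (Equiv.funUnique (Fin 1) (ZMod d × ZMod d)))) ∘ l : Phase d 1) = f l := by
    have hl : (Equiv.funUnique (Fin 1) Λ).symm (l 0) = l := by
      ext i
      rw [Subsingleton.elim i 0]
      rfl
    ext1 i
    rw [Subsingleton.elim i 0]
    change f ((Equiv.funUnique (Fin 1) Λ).symm (l 0)) 0 = f l 0
    rw [hl]
  rw [he, hf', hbase]
  have hA : phasePoint (f l) = weyl (f l) * phasePoint 0 * (weyl (f l))ᴴ := by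
    rw [weyl_conj_eq_grossWeyl_conj, grossWeyl_conj_phasePoint hd, zero_add]
  rw [hA, ← mul_assoc, ← mul_assoc, Matrix.trace_mul_comm _ (weyl (f l))]
  simp only [mul_assoc]

end PosRep.IsFrame

/-! ### From one qudit to larger registers -/

namespace PosRep

variable {d : ℕ} [NeZero d] {N : ℕ∞} {Λ : Type u} [Fintype Λ] (R : PosRep d N Λ)
  {n m k n' m' : ℕ}

/-- Gross's representation on a relabelled sample space. -/
def grossOn (e : Λ ≃ ZMod d × ZMod d) (T : SuperOp d n m) :
    Matrix (Fin m → Λ) (Fin n → Λ) ℂ := Matrix.of fun l' l => grossMatrix T (e ∘ l') (e ∘ l)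

/-- The representation as a complex matrix. -/
def cmap (T : SuperOp d n m) : Matrix (Fin m → Λ) (Fin n → Λ) ℂ := (R.map T).map (algebraMap ℝ ℂ)

lemma grossOn_comp (hd : Odd d) (e : Λ ≃ ZMod d × ZMod d) (S : SuperOp d m k) (T : SuperOp d n m) :
    grossOn e (S ∘ₗ T) = grossOn e S * grossOn e T := by
  ext l' l
  rw [Matrix.mul_apply, grossOn, Matrix.of_apply, grossMatrix_comp hd, Matrix.mul_apply,
    ← Equiv.sum_comp (Equiv.arrowCongr (Equiv.refl (Fin m)) e)]
  rfl

lemma cmap_comp {S : SuperOp d m k} {T : SuperOp d n m} (hS : IsProcess N S)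
    (hT : IsProcess N T) : R.cmap (S ∘ₗ T) = R.cmap S * R.cmap T := by
  rw [cmap, R.map_seq _ _ hS hT, Matrix.map_mul]
  rfl

lemma cmap_scalar (hd : Odd d) (e : Λ ≃ ZMod d × ZMod d) {T : SuperOp d 0 0}
    (hT : IsProcess N T) : R.cmap T = grossOn e T := by
  ext l' l
  rw [grossOn, Matrix.of_apply, grossMatrix_scalar hd, ← R.map_scalar T hT,
    Subsingleton.elim l' ![], Subsingleton.elim l ![]]
  rfl

/-- Representations of measure-and-prepare processes on which `R` agrees with Gross's
representation. -/
def grossFactoring (e : Λ ≃ ZMod d × ZMod d) (n : ℕ) : Set (Matrix (Fin n → Λ) (Fin n → Λ) ℝ) :=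
  {A | ∃ (S : SuperOp d 0 n) (E : SuperOp d n 0), IsProcess N S ∧ IsProcess N E ∧
    R.cmap S = grossOn e S ∧ R.cmap E = grossOn e E ∧ A = R.map S * R.map E}

lemma cmap_par (hd : Odd d) {e : Λ ≃ ZMod d × ZMod d} {T : SuperOp d n m} {T' : SuperOp d n' m'}
    (hT : IsProcess N T) (hT' : IsProcess N T') (hn : ((n + n' : ℕ) : ℕ∞) ≤ N)
    (hm : ((m + m' : ℕ) : ℕ∞) ≤ N) (h : R.cmap T = grossOn e T) (h' : R.cmap T' = grossOn e T') :
    R.cmap (superTensor T T') = grossOn e (superTensor T T') := by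
  ext l' l
  have h1 := congrFun (congrFun h (l' ∘ Fin.castAdd m')) (l ∘ Fin.castAdd n')
  have h2 := congrFun (congrFun h' (l' ∘ Fin.natAdd m)) (l ∘ Fin.natAdd n)
  rw [cmap, R.map_par _ _ hn hm hT hT', Matrix.map_apply, parMatrix_apply, map_mul]
  rw [grossOn, Matrix.of_apply, grossMatrix_par hd, parMatrix_apply]
  exact congrArg₂ (· * ·) h1 h2

variable {R} in
lemma IsFrame.cmap_state (hd : Odd d) {Φ : Op d 1 ≃ₗ[ℂ] ((Fin 1 → Λ) → ℂ)} (hΦ : R.IsFrame Φ)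
    {e : Λ ≃ ZMod d × ZMod d} (he : ∀ M l, Φ M l = (d : ℂ)⁻¹ * (phasePoint (e ∘ l) * M).trace)
    {S : SuperOp d 0 1} (hS : IsProcess N S) : R.cmap S = grossOn e S := by
  ext l o
  rw [grossOn, Matrix.of_apply, grossMatrix_apply, phasePoint_zero hd, pow_one, ← he,
    hΦ.state _ hS, Subsingleton.elim o ![]]
  rfl

-- The frame represents phase point operators by point masses, so evaluating an effect on one of
-- them reads off a single entry.
variable {R} in
lemma IsFrame.cmap_effect (hd : Odd d) {Φ : Op d 1 ≃ₗ[ℂ] ((Fin 1 → Λ) → ℂ)} (hΦ : R.IsFrame Φ)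
    {e : Λ ≃ ZMod d × ZMod d} (he : ∀ M l, Φ M l = (d : ℂ)⁻¹ * (phasePoint (e ∘ l) * M).trace)
    {E : SuperOp d 1 0} (hE : IsProcess N E) : R.cmap E = grossOn e E := by
  classical
  ext o l
  have h := hΦ.effect _ hE (phasePoint (e ∘ l))
  have h1 : ∀ l', Φ (phasePoint (e ∘ l)) l' = if l' = l then 1 else 0 := by
    intro l'
    rw [he, trace_phasePoint_mul hd]
    simp only [e.injective.comp_left.eq_iff, pow_one]
    split_ifs
    · exact inv_mul_cancel₀ natCast_dim_ne_zero
    · exact mul_zero _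
  simp only [h1, mul_ite, mul_one, mul_zero, Finset.sum_ite_eq', Finset.mem_univ, if_true] at h
  rw [grossOn, Matrix.of_apply, grossMatrix_apply, phasePoint_zero hd, one_mul, pow_zero, inv_one,
    one_mul, op_zero_eq (E _), Matrix.trace_smul, Matrix.trace_one, h, Subsingleton.elim o ![]]
  simp [cmap]

/-- Local tomography in the representation: the identity matrix is spanned by products of states
and effects on which the representation is Gross's. -/
lemma one_mem_span_grossFactoring [DecidableEq Λ] (hd : Odd d)
    {e : Λ ≃ ZMod d × ZMod d}
    (h1 : (1 : Matrix (Fin 1 → Λ) (Fin 1 → Λ) ℝ) ∈ Submodule.span ℝ (R.grossFactoring e 1)) (n : ℕ)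
    (hn : (n : ℕ∞) ≤ N) :
    (1 : Matrix (Fin n → Λ) (Fin n → Λ) ℝ) ∈ Submodule.span ℝ (R.grossFactoring e n) := by
  induction n with
  | zero =>
    have hid := isProcess_id (d := d) hn
    refine Submodule.subset_span ⟨_, _, hid, hid, R.cmap_scalar hd e hid, R.cmap_scalar hd e hid, ?_⟩
    have := R.map_id_eq_one (d := d) (n := 0) hn
    rw [this, mul_one]
  | succ n ih =>
    have hn' : (n : ℕ∞) ≤ N := le_trans (by exact_mod_cast Nat.le_succ n) hn
    have h0 : ((0 + 0 : ℕ) : ℕ∞) ≤ N := by simp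
    rw [← parMatrix_one]
    have := Submodule.apply_mem_map₂ (parMatrixₗ Λ ℝ n n 1 1) (ih hn') h1
    rw [Submodule.map₂_span_span] at this
    refine Submodule.span_mono ?_ this
    rintro _ ⟨_, ⟨S, E, hS, hE, hS1, hE1, rfl⟩, _, ⟨S', E', hS', hE', hS1', hE1', rfl⟩, rfl⟩
    refine ⟨superTensor S S', superTensor E E', hS.par hS' h0 hn, hE.par hE' hn h0,
      R.cmap_par hd hS hS' h0 hn hS1 hS1', R.cmap_par hd hE hE' hn h0 hE1 hE1', ?_⟩
    change parMatrix (R.map S * R.map E) (R.map S' * R.map E') = _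
    rw [parMatrix_mul]
    refine congrArg₂ (· * ·) (R.map_par S S' h0 hn hS hS').symm (R.map_par E E' hn h0 hE hE').symm

/-- In odd dimension, every nonnegative representation is Gross's. -/
theorem exists_eq_gross (hd : Odd d) (hN : 1 ≤ N) :
    ∃ e : Λ ≃ ZMod d × ZMod d, ∀ {n m : ℕ} (T : SuperOp d n m), IsProcess N T →
      ∀ (l' : Fin m → Λ) (l : Fin n → Λ),
        ((R.map T l' l : ℝ) : ℂ) = grossMatrix T (e ∘ l') (e ∘ l) := by
  classical
  obtain ⟨Φ, hΦ⟩ := R.exists_frame hN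
  obtain ⟨e, he⟩ := hΦ.exists_label hd hN
  have h1 : (1 : Matrix (Fin 1 → Λ) (Fin 1 → Λ) ℝ) ∈ Submodule.span ℝ (R.grossFactoring e 1) := by
    obtain ⟨r, c, S, E, hS, hE, -, h⟩ := R.exists_decomposition hN
    rw [h]
    exact Submodule.sum_mem _ fun i _ => Submodule.smul_mem _ _ (Submodule.subset_span
      ⟨S i, E i, hS i, hE i, hΦ.cmap_state hd he (hS i), hΦ.cmap_effect hd he (hE i), rfl⟩)
  have hspan := R.one_mem_span_grossFactoring hd h1
  refine ⟨e, fun {n m} T hT l' l => ?_⟩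
  -- Composing with a measure-and-prepare matrix on the output leaves the closed circuit `E' ∘ₗ T ∘ₗ
  -- S`, a number on which both representations agree. Such matrices span the identity; `key` below
  -- repeats the argument on the input.
  have hleft : ∀ S : SuperOp d 0 n, IsProcess N S → R.cmap S = grossOn e S →
      R.cmap T * R.cmap S = grossOn e T * R.cmap S := by
    intro S hS hS1
    have key : ∀ A ∈ Submodule.span ℝ (R.grossFactoring e m),
        A.map (algebraMap ℝ ℂ) * (R.cmap T * R.cmap S) =
          A.map (algebraMap ℝ ℂ) * (grossOn e T * R.cmap S) := by
      intro A hA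
      induction hA using Submodule.span_induction with
      | mem A hA =>
        obtain ⟨S', E', hS', hE', hS1', hE1', rfl⟩ := hA
        rw [Matrix.map_mul]
        change (R.cmap S' * R.cmap E') * _ = (R.cmap S' * R.cmap E') * _
        rw [Matrix.mul_assoc, Matrix.mul_assoc]
        congr 1
        rw [← R.cmap_comp hT hS, ← R.cmap_comp hE' (hT.comp hS),
          R.cmap_scalar hd e (hE'.comp (hT.comp hS)), grossOn_comp hd, grossOn_comp hd, hE1', hS1]
      | zero => simp
      | add A B _ _ hA hB =>
        rw [Matrix.map_add _ (_root_.map_add _), Matrix.add_mul, Matrix.add_mul, hA, hB]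
      | smul c A _ hA =>
        have : (c • A).map (algebraMap ℝ ℂ) = (c : ℂ) • A.map (algebraMap ℝ ℂ) := by
          ext i j; simp
        rw [this, Matrix.smul_mul, Matrix.smul_mul, hA]
    have := key 1 (hspan m hT.le.2)
    rwa [Matrix.map_one _ (_root_.map_zero _) (_root_.map_one _), Matrix.one_mul, Matrix.one_mul] at this
  have key : ∀ A ∈ Submodule.span ℝ (R.grossFactoring e n),
      R.cmap T * A.map (algebraMap ℝ ℂ) = grossOn e T * A.map (algebraMap ℝ ℂ) := by
    intro A hA
    induction hA using Submodule.span_induction with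
    | mem A hA =>
      obtain ⟨S, E, hS, hE, hS1, hE1, rfl⟩ := hA
      rw [Matrix.map_mul]
      change R.cmap T * (R.cmap S * R.cmap E) = grossOn e T * (R.cmap S * R.cmap E)
      rw [← Matrix.mul_assoc, ← Matrix.mul_assoc, hleft S hS hS1]
    | zero => simp
    | add A B _ _ hA hB =>
      rw [Matrix.map_add _ (_root_.map_add _), Matrix.mul_add, Matrix.mul_add, hA, hB]
    | smul c A _ hA =>
      have : (c • A).map (algebraMap ℝ ℂ) = (c : ℂ) • A.map (algebraMap ℝ ℂ) := by
        ext i j; simp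
      rw [this, Matrix.mul_smul, Matrix.mul_smul, hA]
  have := key 1 (hspan n hT.le.1)
  rw [Matrix.map_one _ (_root_.map_zero _) (_root_.map_one _), Matrix.mul_one, Matrix.mul_one] at this
  exact congrFun (congrFun this l') l

end PosRep

/-! ## Gross's representation and Spekkens' toy theory -/

section Existence

variable {d : ℕ} [NeZero d] {N : ℕ∞} {n m : ℕ}

/-- The matrix of real parts of Gross's representation. -/
def grossReal (T : SuperOp d n m) : Matrix (Phase d m) (Phase d n) ℝ :=
  (grossMatrix T).map Complex.re

lemma IsProcess.isSubstochastic (hd : Odd d) {T : SuperOp d n m} (hT : IsProcess N T) :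
    IsSubstochastic (grossMatrix T) := by
  obtain ⟨P, rfl⟩ := hT
  exact isSubstochastic_eval hd P

lemma coe_grossReal (hd : Odd d) {T : SuperOp d n m} (hT : IsProcess N T) (l' : Phase d m)
    (l : Phase d n) : (grossReal T l' l : ℂ) = grossMatrix T l' l := by
  obtain ⟨A, hA, -, -⟩ := hT.isSubstochastic hd
  rw [grossReal, Matrix.map_apply, hA, Complex.ofReal_re]

lemma grossReal_nonneg (hd : Odd d) {T : SuperOp d n m} (hT : IsProcess N T) (l' : Phase d m)
    (l : Phase d n) : 0 ≤ grossReal T l' l := by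
  obtain ⟨A, hA, hA0, -⟩ := hT.isSubstochastic hd
  rw [grossReal, Matrix.map_apply, hA, Complex.ofReal_re]
  exact hA0 _ _

lemma sum_grossReal_le_one (hd : Odd d) {T : SuperOp d n m} (hT : IsProcess N T)
    (l : Phase d n) : ∑ l', grossReal T l' l ≤ 1 := by
  obtain ⟨A, hA, -, hA1⟩ := hT.isSubstochastic hd
  simp only [grossReal, Matrix.map_apply, hA, Complex.ofReal_re]
  exact hA1 l

lemma grossReal_comp (hd : Odd d) {k : ℕ} {S : SuperOp d m k} {T : SuperOp d n m}
    (hS : IsProcess N S) (hT : IsProcess N T) :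
    grossReal (S ∘ₗ T) = grossReal S * grossReal T := by
  ext l' l
  rw [← Complex.ofReal_inj, coe_grossReal hd (hS.comp hT), grossMatrix_comp hd, Matrix.mul_apply,
    Matrix.mul_apply]
  push_cast
  exact Finset.sum_congr rfl fun b _ => by rw [coe_grossReal hd hS, coe_grossReal hd hT]

lemma grossReal_par (hd : Odd d) {n' m' : ℕ} {T : SuperOp d n m} {T' : SuperOp d n' m'}
    (hT : IsProcess N T) (hT' : IsProcess N T') :
    grossReal (superTensor T T') = parMatrix (grossReal T) (grossReal T') := by
  ext l' l
  rw [parMatrix_apply, grossReal, Matrix.map_apply, grossMatrix_par hd, parMatrix_apply,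
    ← coe_grossReal hd hT, ← coe_grossReal hd hT', ← Complex.ofReal_mul, Complex.ofReal_re]

lemma grossReal_wires (hd : Odd d) (σ : Equiv.Perm (Fin n)) :
    grossReal (conjBy (d := d) (wireMatrix (ZMod d) ℂ σ)) = wireMatrix (ZMod d × ZMod d) ℝ σ := by
  ext l' l
  rw [grossReal, Matrix.map_apply, grossMatrix_wires hd, wireMatrix, wireMatrix, Matrix.of_apply,
    Matrix.of_apply]
  split_ifs <;> simp

lemma grossReal_discard (hd : Odd d) :
    grossReal (discardOp d n) = Matrix.of fun _ _ => 1 := by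
  ext l' l
  rw [grossReal, Matrix.map_apply, grossMatrix_discard hd, Matrix.of_apply, Complex.one_re]

lemma grossReal_scalar (hd : Odd d) {T : SuperOp d 0 0} (hT : IsProcess N T) :
    ((grossReal T ![] ![] : ℝ) : ℂ) = scalar T := by
  rw [coe_grossReal hd hT, grossMatrix_scalar hd]

lemma grossReal_add (T T' : SuperOp d n m) :
    grossReal (T + T') = grossReal T + grossReal T' := by
  ext l' l
  rw [grossReal, grossMatrix_add]
  simp [grossReal]

lemma grossReal_mix (p : ℝ) (T T' : SuperOp d n m) :
    grossReal ((p : ℂ) • T + ((1 - p : ℝ) : ℂ) • T') = p • grossReal T + (1 - p) • grossReal T' := by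
  ext l' l
  rw [grossReal_add]
  simp only [grossReal, grossMatrix_smul, Matrix.add_apply, Matrix.map_apply, Matrix.smul_apply,
    smul_eq_mul, Complex.re_ofReal_mul]

/-- Gross's representation. -/
def grossRep (hd : Odd d) (N : ℕ∞) : QuasiRep d N (ZMod d × ZMod d) where
  map := grossReal
  map_seq _ _ hS hT := grossReal_comp hd hS hT
  map_par _ _ _ _ hT hT' := grossReal_par hd hT hT'
  map_wires σ _ := grossReal_wires hd σ
  map_discard _ := grossReal_discard hd
  map_scalar _ hT := grossReal_scalar hd hT
  map_mix p T T' _ _ _ _ := grossReal_mix p T T'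
  map_add T T' _ _ _ := grossReal_add T T'

lemma grossRep_nonneg (hd : Odd d) : (grossRep hd N).Nonneg := by
  intro n m T hT l' l
  exact ⟨grossReal_nonneg hd hT l' l,
    (Finset.single_le_sum (fun i _ => grossReal_nonneg hd hT i l) (Finset.mem_univ l')).trans
      (sum_grossReal_le_one hd hT l)⟩

/-- Gross's representation as an ontological model. -/
def spekkensModel (hd : Odd d) (N : ℕ∞) : OntModel d N (ZMod d × ZMod d) where
  map P := grossReal P.eval
  nonneg P := grossReal_nonneg hd ⟨P, rfl⟩
  sum_le_one P := sum_grossReal_le_one hd ⟨P, rfl⟩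
  map_seq S T := grossReal_comp hd ⟨S, rfl⟩ ⟨T, rfl⟩
  map_par _ _ T T' := grossReal_par hd ⟨T, rfl⟩ ⟨T', rfl⟩
  map_wires _ σ := grossReal_wires hd σ
  map_discard _ := grossReal_discard hd
  map_mix p _ _ T T' := grossReal_mix p T.eval T'.eval
  map_meas_total hn a z P hP hsum l := by
    rw [← Complex.ofReal_inj]
    push_cast
    -- The total weight of one outcome at `l` is the expectation of its projector in the phase point
    -- operator; these add up to the trace of that operator.
    have h : ∀ i, ∑ l', ((grossReal (Proc.meas hn a (z i) (P i) (hP i)).eval l' l : ℝ) : ℂ) =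
        (P i * phasePoint l).trace := by
      intro i
      simp only [coe_grossReal hd (isProcess_meas hn (hP i)), Proc.eval]
      rw [sum_grossMatrix hd, conjBy_apply, (hP i).isHermitian.eq, Matrix.trace_mul_comm,
        ← mul_assoc, (hP i).idempotent]
    simp only [h]
    rw [← Matrix.trace_sum, ← Finset.sum_mul, hsum, one_mul, trace_phasePoint hd]
  map_scalar P := grossReal_scalar hd ⟨P, rfl⟩

lemma superTensor_id_zero (T : SuperOp d n m) :
    superTensor T (LinearMap.id : SuperOp d 0 0) = T := by
  have h : ∀ {n : ℕ} (A : Op d n) (B : Op d 0), parMatrix A B = B ![] ![] • A := by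
    intro n A B
    ext x y
    rw [parMatrix_apply, Subsingleton.elim (x ∘ Fin.natAdd n) ![],
      Subsingleton.elim (y ∘ Fin.natAdd n) ![], mul_comm]
    rfl
  refine linearMap_ext_par fun A B => ?_
  rw [superTensor_apply_par, LinearMap.id_apply, h, h]
  exact (map_smul T _ _).symm

/-- Local tomography: operationally equivalent procedures realize the same process. -/
lemma OpEquiv.eval_eq (hN : 1 ≤ N) {P Q : Proc d N n m} (h : OpEquiv P Q) : P.eval = Q.eval := by
  have hsc : ∀ (S : Proc d N 0 n) (E : Proc d N m 0),
      E.eval ∘ₗ P.eval ∘ₗ S.eval = E.eval ∘ₗ Q.eval ∘ₗ S.eval := by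
    intro S E
    -- An empty side register suffices, because single-system circuits are already tomographically
    -- complete.
    have h1 := h 0 (by simp) P.le.1 P.le.2 S E
    have h2 : ∀ P : Proc d N n m, (E.seq ((Proc.par (m' := 0) (n' := 0) P.le.1 P.le.2 P
        (Proc.wires (by simp) 1)).seq S)).eval = E.eval ∘ₗ P.eval ∘ₗ S.eval := by
      intro P
      have h3 := superTensor_id_zero P.eval
      rw [← conjBy_one, ← wireMatrix_one] at h3
      simp only [Proc.eval]
      exact congrArg (fun T : SuperOp d n m => E.eval ∘ₗ T ∘ₗ S.eval) h3
    rw [superOp_zero_eq (E.eval ∘ₗ P.eval ∘ₗ S.eval), superOp_zero_eq (E.eval ∘ₗ Q.eval ∘ₗ S.eval),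
      ← h2 P, ← h2 Q]
    exact congrArg (· • LinearMap.id) h1
  have hleft : ∀ S : Proc d N 0 n, P.eval ∘ₗ S.eval = Q.eval ∘ₗ S.eval := by
    intro S
    have key : ∀ A ∈ Submodule.span ℝ (factoring d N m),
        A ∘ₗ P.eval ∘ₗ S.eval = A ∘ₗ Q.eval ∘ₗ S.eval := by
      intro A hA
      induction hA using Submodule.span_induction with
      | mem A hA =>
        obtain ⟨S', E', -, ⟨E, rfl⟩, rfl⟩ := hA
        rw [LinearMap.comp_assoc, LinearMap.comp_assoc, hsc]
      | zero => simp
      | add A B _ _ hA hB => rw [LinearMap.add_comp, LinearMap.add_comp, hA, hB]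
      | smul c A _ hA => rw [LinearMap.smul_comp, LinearMap.smul_comp, hA]
    exact key _ (id_mem_span hN m P.le.2)
  have key : ∀ A ∈ Submodule.span ℝ (factoring d N n), P.eval ∘ₗ A = Q.eval ∘ₗ A := by
    intro A hA
    induction hA using Submodule.span_induction with
    | mem A hA =>
      obtain ⟨S', E', ⟨S, rfl⟩, -, rfl⟩ := hA
      rw [← LinearMap.comp_assoc, ← LinearMap.comp_assoc, hleft]
    | zero => simp
    | add A B _ _ hA hB => rw [LinearMap.comp_add, LinearMap.comp_add, hA, hB]
    | smul c A _ hA =>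
      have : ∀ T : SuperOp d n m, T ∘ₗ (c • A) = c • (T ∘ₗ A) := fun T => by
        rw [← coe_smul_superOp, LinearMap.comp_smul, coe_smul_superOp]
      rw [this, this, hA]
  exact key _ (id_mem_span hN n P.le.1)

lemma spekkensModel_noncontextual (hd : Odd d) (hN : 1 ≤ N) :
    (spekkensModel (d := d) hd N).Noncontextual := by
  intro n m P Q h
  change grossReal P.eval = grossReal Q.eval
  rw [h.eval_eq hN]

/-- Ontological models which represent processes by Gross's representation are Spekkens' toy
theory. -/
lemma OntModel.isSpekkens_of_gross (hd : Odd d) {Λ : Type u} [Fintype Λ] (M : OntModel d N Λ)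
    (e : Λ ≃ ZMod d × ZMod d) (h : ∀ {n m : ℕ} (P : Proc d N n m) (l' : Fin m → Λ) (l : Fin n → Λ),
      ((M.map P l' l : ℝ) : ℂ) = grossMatrix P.eval (e ∘ l') (e ∘ l)) : M.IsSpekkens e where
  prep hn ψ hψ l' l := by
    rw [← Complex.ofReal_inj, h, Proc.eval, grossMatrix_prepare hd hψ]
    split_ifs <;> simp
  gate hn U hU := by
    obtain ⟨S, t, h1, h2, h3⟩ := hU.exists_symplectic hd
    refine ⟨S, t, h1, h2, fun l' l => ?_⟩
    rw [← Complex.ofReal_inj, h, Proc.eval, grossMatrix_of_apply hd (h3 _)]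
    split_ifs <;> simp
  meas hn a z P hP := by
    obtain ⟨j, hj, hPj⟩ := hP.exists_eq_isoProj hd
    refine ⟨j, hj, fun l' l => ?_⟩
    rw [← Complex.ofReal_inj, h, Proc.eval]
    have := grossMatrix_conjBy_isoProj hd a j (e ∘ l') (e ∘ l)
    rw [← hPj] at this
    rw [this]
    split_ifs <;> simp

end Existence

end Stab
end

theorem theorem1 (d : ℕ) [NeZero d] (N : ℕ∞) (hN : 1 ≤ N) :
    (Odd d →
      (∃ G : Stab.QuasiRep d N (ZMod d × ZMod d), G.Nonneg ∧ G.IsGross (Equiv.refl _)) ∧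
      (∀ (Λ : Type u) [Fintype Λ] (R : Stab.QuasiRep d N Λ), R.Nonneg →
        ∃ e : Λ ≃ ZMod d × ZMod d, R.IsGross e) ∧
      (∃ M : Stab.OntModel d N (ZMod d × ZMod d),
        M.Noncontextual ∧ M.IsSpekkens (Equiv.refl _)) ∧
      (∀ (Λ : Type u) [Fintype Λ] (M : Stab.OntModel d N Λ), M.Noncontextual →
        ∃ e : Λ ≃ ZMod d × ZMod d, M.IsSpekkens e)) ∧
    (Even d →
      (∀ (Λ : Type u) [Fintype Λ] (R : Stab.QuasiRep d N Λ), ¬ R.Nonneg) ∧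
      (∀ (Λ : Type u) [Fintype Λ] (M : Stab.OntModel d N Λ), ¬ M.Noncontextual)) := by
  refine ⟨fun hd => ⟨⟨Stab.grossRep hd N, Stab.grossRep_nonneg hd, ?_⟩, ?_,
    ⟨Stab.spekkensModel hd N, Stab.spekkensModel_noncontextual hd hN, ?_⟩, ?_⟩,
    fun hd => ⟨fun Λ _ R hR => ?_, fun Λ _ M hM => ?_⟩⟩
  · intro n m T hT l' l
    exact Stab.coe_grossReal hd hT l' l
  · intro Λ _ R hR
    obtain ⟨e, he⟩ := (R.toPosRep hR).exists_eq_gross hd hN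
    exact ⟨e, fun T hT l' l => he T hT l' l⟩
  · exact Stab.OntModel.isSpekkens_of_gross hd _ _ fun P l' l =>
      Stab.coe_grossReal hd ⟨P, rfl⟩ l' l
  · intro Λ _ M hM
    obtain ⟨e, he⟩ := (M.toPosRep hM).exists_eq_gross hd hN
    refine ⟨e, Stab.OntModel.isSpekkens_of_gross hd M e fun P l' l => ?_⟩
    rw [← he P.eval ⟨P, rfl⟩, ← M.processMap_eval hM]
    rfl
  · exact (R.toPosRep hR).false_of_even hd hN
  · exact (M.toPosRep hM).false_of_even hd hN
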